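/- Let $\delta\ge 0$ be an integer and let $\mathbb F_\delta$ be the Hirzebruch surface, with $H_2(\mathbb F_\delta,\mathbb Z)=\mathbb ZE\oplus\mathbb ZF$, $E^2=\delta$, $E\cdot F=1$, $F^2=0$; its toric divisors have classes $F$, $F$, $E_\infty=E-\delta F$ and $E$. For integers $a,b>0$, a floor diagram $\mathcal D$ of class $aE+bF$ is a connected oriented graph without oriented cycles (multiple edges allowed), with $a$ vertices (floors), finitely many bounded edges $e$ carrying weights $w(e)\in\mathbb Z_{>0}$, $b+\delta a$ sinks and $b$ sources (unbounded edges of weight $1$, leaving, resp. entering, a vertex), such that at every vertex the total outgoing weight exceeds the total incoming weight by $\delta$. Its genus is its first Betti number. A marking is a bijection from the set of vertices and edges to $\{1,\dots,n\}$ that increases along the orientation, and isomorphisms of marked floor diagrams preserve weights and markings. With $E^0(\mathcal D)$ the set of bounded edges, put $$\overline{BG}_g(aE+bF)(q)=\sum_{(\mathcal D,\mathfrak m)}(q^{1/2}-q^{-1/2})^{2b+\delta a}\prod_{e\in E^0(\mathcal D)}\bigl(q^{w(e)/2}-q^{-w(e)/2}\bigr)^2,$$ where the sum is over isomorphism classes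 of marked floor diagrams of class $aE+bF$ and genus $g$, and $$\widetilde{BG}_g(aE+bF)(x)=x^{ab+\delta a^2/2}\;\overline{BG}_g(aE+bF)(1/x)\in\mathbb Z[[x]]$$ (the exponent $ab+\delta a^2/2$ is the area of the Newton polygon with vertices $(0,0),(b,0),(b+\delta a,a),(0,a)$). A function $A:H_2(\mathbb F_\delta,\mathbb Z)\to\mathbb Z[[x]]$ is called a genus $g$ asymptotic refined invariant of $\mathbb F_\delta$ if $A(aE+bF)$ is a polynomial in $a,b$ with coefficients in $\mathbb Q[[x]]$ and if for every $n$ there is $C>0$ such that $\widetilde{BG}_g(\beta)\equiv A(\beta)\bmod x^n$ for every ample class $\beta=aE+bF$ with $\beta\cdot D\ge C$ for all toric divisors $D$. **Theorem.** For every $\delta\ge0$, the surface $\mathbb F_\delta$ has exactly one genus $1$ asymptotic refined invariant $AR_1^{\mathbb F_\delta}$, and for all $a,b\in\mathbb Z$ $$AR_1^{\mathbb F_\delta}(aE+bF)=p(x)^4\bigl(g_{\max}-12E_2(x)\bigr),\qquad g_{\max}=\tfrac12(a-1)(2b+\delta a-2),$$ where $p(x)=\sum_{n\ge0}p(n)x^n$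 is the generating series of the partition numbers and $E_2(x)=\sum_{n\ge1}\sigma_1(n)x^n$ with $\sigma_1(n)=\sum_{d\mid n}d$. -/

import Mathlib

open scoped LaurentPolynomial PowerSeries

/-- The combinatorial data of an `h`-transverse lattice polygon that floor diagrams see: its height,
the integral lengths of its top and bottom horizontal edges, and the multiset `left` (resp. `right`)
in which `k` appears as often as the integral length of the side with primitive outgoing normal
vector `(-1, k)` (resp. `(1, k)`). -/
structure HTransverseData where
  height : ℕ
  top : ℕ
  bottom : ℕ
  left : Multiset ℤ
  right : Multiset ℤ

/-- The Newton polygon of the class `aE + bF` on the Hirzebruch surface `𝔽_δ`: the trapezoid with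
vertices `(0,0)`, `(b,0)`, `(b+δa,a)`, `(0,a)`.  Its outgoing normals are `(0,1)` with multiplicity
`b + δa`, `(0,-1)` with multiplicity `b`, and `(-1,0)`, `(1,-δ)` with multiplicity `a`. -/
abbrev hirzebruchPolygon (δ a b : ℕ) : HTransverseData where
  height := a
  top := b + δ * a
  bottom := b
  left := Multiset.replicate a 0
  right := Multiset.replicate a (-(δ : ℤ))

/-- Twice the Euclidean area of the trapezoid `hirzebruchPolygon δ a b`, which has height `a` and
parallel sides of lengths `b` and `b + δa`. -/
def hirzebruchTwiceArea (δ a b : ℕ) : ℕ := a * (b + (b + δ * a))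

/-- A floor diagram with Newton polygon `P`: a weighted connected oriented acyclic graph (multiple
edges allowed) whose vertices are the floors `Fin P.height`, with bounded edges `Fin numEdges`,
sinks `Fin P.top` and sources `Fin P.bottom`.  The sink `s` leaves the floor `sinkFloor s` and the
source `s` enters the floor `sourceFloor s`; these ends have weight `1`.  The functions `L`, `R` are
bijections onto the multisets `P.left`, `P.right`. -/
structure FloorDiagram (P : HTransverseData) where
  numEdges : ℕ
  src : Fin numEdges → Fin P.height
  tgt : Fin numEdges → Fin P.height
  weight : Fin numEdges → ℕ
  sinkFloor : Fin P.top → Fin P.height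
  sourceFloor : Fin P.bottom → Fin P.height
  L : Fin P.height → ℤ
  R : Fin P.height → ℤ
  weight_pos : ∀ e, 0 < weight e
  map_L : Finset.univ.val.map L = P.left
  map_R : Finset.univ.val.map R = P.right
  /-- the divergence (total weight entering minus total weight leaving) of `v` is `R v + L v` -/
  divergence : ∀ v,
    ((∑ e with tgt e = v, (weight e : ℤ)) + ∑ s with sourceFloor s = v, (1 : ℤ))
      - ((∑ e with src e = v, (weight e : ℤ)) + ∑ s with sinkFloor s = v, (1 : ℤ)) = R v + L v
  connected : (SimpleGraph.fromRel fun u v => ∃ e, src e = u ∧ tgt e = v).Connected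
  acyclic : ∀ v, ¬ Relation.TransGen (fun u v => ∃ e, src e = u ∧ tgt e = v) v v

namespace FloorDiagram

variable {P : HTransverseData}

/-- The genus: the first Betti number `|E⁰| - |V| + 1` of the underlying connected graph. -/
def genus (D : FloorDiagram P) : ℤ := (D.numEdges : ℤ) - (P.height : ℤ) + 1

/-- The set `V(D) ∪ E(D)` of vertices, bounded edges, sinks and sources. -/
inductive Cell (D : FloorDiagram P) : Type
  | floor (v : Fin P.height)
  | edge (e : Fin D.numEdges)
  | sink (s : Fin P.top)
  | source (s : Fin P.bottom)

/-- The relation between an edge and an adjacent vertex given by the orientation; the partial order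
on `V(D) ∪ E(D)` induced by the orientation is its transitive closure. -/
inductive Cell.Step (D : FloorDiagram P) : D.Cell → D.Cell → Prop
  | leave (e : Fin D.numEdges) : Cell.Step D (.floor (D.src e)) (.edge e)
  | enter (e : Fin D.numEdges) : Cell.Step D (.edge e) (.floor (D.tgt e))
  | sink (s : Fin P.top) : Cell.Step D (.floor (D.sinkFloor s)) (.sink s)
  | source (s : Fin P.bottom) : Cell.Step D (.source s) (.floor (D.sourceFloor s))

/-- The multiplicity with cleared denominators
`∏_{e bounded} (q^{w(e)/2} - q^{-w(e)/2})² · ∏_{e end} (q^{1/2} - q^{-1/2})`.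
The variable `T` of the Laurent polynomials stands for `q^{1/2}`. -/
noncomputable def mult (D : FloorDiagram P) : ℤ[T;T⁻¹] :=
  (∏ e, (LaurentPolynomial.T (D.weight e : ℤ) - LaurentPolynomial.T (-(D.weight e : ℤ))) ^ 2)
    * (LaurentPolynomial.T 1 - LaurentPolynomial.T (-1)) ^ (P.top + P.bottom)

end FloorDiagram

/-- A marked floor diagram: a floor diagram with an increasing bijection from `V ∪ E` to
`{0, …, n - 1}`, where `n = |V ∪ E|`. -/
structure MarkedFloorDiagram (P : HTransverseData) extends FloorDiagram P where
  marking : toFloorDiagram.Cell ≃ Fin (P.height + numEdges + P.top + P.bottom)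
  increasing : ∀ x y, Relation.TransGen (FloorDiagram.Cell.Step toFloorDiagram) x y →
    marking x < marking y

namespace MarkedFloorDiagram

variable {P : HTransverseData}

/-- An isomorphism of marked floor diagrams: bijections between the floors, bounded edges, sinks and
sources, compatible with the incidences, orientations, weights, `L`, `R` and the markings. -/
structure Iso (D D' : MarkedFloorDiagram P) where
  onFloor : Fin P.height ≃ Fin P.height
  onEdge : Fin D.numEdges ≃ Fin D'.numEdges
  onSink : Fin P.top ≃ Fin P.top
  onSource : Fin P.bottom ≃ Fin P.bottom
  src_eq : ∀ e, D'.src (onEdge e) = onFloor (D.src e)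
  tgt_eq : ∀ e, D'.tgt (onEdge e) = onFloor (D.tgt e)
  weight_eq : ∀ e, D'.weight (onEdge e) = D.weight e
  sinkFloor_eq : ∀ s, D'.sinkFloor (onSink s) = onFloor (D.sinkFloor s)
  sourceFloor_eq : ∀ s, D'.sourceFloor (onSource s) = onFloor (D.sourceFloor s)
  L_eq : ∀ v, D'.L (onFloor v) = D.L v
  R_eq : ∀ v, D'.R (onFloor v) = D.R v
  marking_floor : ∀ v, (D'.marking (.floor (onFloor v)) : ℕ) = D.marking (.floor v)
  marking_edge : ∀ e, (D'.marking (.edge (onEdge e)) : ℕ) = D.marking (.edge e)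
  marking_sink : ∀ s, (D'.marking (.sink (onSink s)) : ℕ) = D.marking (.sink s)
  marking_source : ∀ s, (D'.marking (.source (onSource s)) : ℕ) = D.marking (.source s)

/-- The identity isomorphism. -/
def Iso.refl (D : MarkedFloorDiagram P) : Iso D D where
  onFloor := Equiv.refl _
  onEdge := Equiv.refl _
  onSink := Equiv.refl _
  onSource := Equiv.refl _
  src_eq _ := rfl
  tgt_eq _ := rfl
  weight_eq _ := rfl
  sinkFloor_eq _ := rfl
  sourceFloor_eq _ := rfl
  L_eq _ := rfl
  R_eq _ := rfl
  marking_floor _ := rfl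
  marking_edge _ := rfl
  marking_sink _ := rfl
  marking_source _ := rfl

/-- The inverse of an isomorphism. -/
def Iso.symm {D D' : MarkedFloorDiagram P} (f : Iso D D') : Iso D' D where
  onFloor := f.onFloor.symm
  onEdge := f.onEdge.symm
  onSink := f.onSink.symm
  onSource := f.onSource.symm
  src_eq e := by
    rw [Equiv.eq_symm_apply, ← f.src_eq, Equiv.apply_symm_apply]
  tgt_eq e := by
    rw [Equiv.eq_symm_apply, ← f.tgt_eq, Equiv.apply_symm_apply]
  weight_eq e := by
    rw [← f.weight_eq, Equiv.apply_symm_apply]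
  sinkFloor_eq s := by
    rw [Equiv.eq_symm_apply, ← f.sinkFloor_eq, Equiv.apply_symm_apply]
  sourceFloor_eq s := by
    rw [Equiv.eq_symm_apply, ← f.sourceFloor_eq, Equiv.apply_symm_apply]
  L_eq v := by
    rw [← f.L_eq, Equiv.apply_symm_apply]
  R_eq v := by
    rw [← f.R_eq, Equiv.apply_symm_apply]
  marking_floor v := by
    rw [← f.marking_floor, Equiv.apply_symm_apply]
  marking_edge e := by
    rw [← f.marking_edge, Equiv.apply_symm_apply]
  marking_sink s := by
    rw [← f.marking_sink, Equiv.apply_symm_apply]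
  marking_source s := by
    rw [← f.marking_source, Equiv.apply_symm_apply]

/-- The composition of two isomorphisms. -/
def Iso.trans {D D' D'' : MarkedFloorDiagram P} (f : Iso D D') (g : Iso D' D'') : Iso D D'' where
  onFloor := f.onFloor.trans g.onFloor
  onEdge := f.onEdge.trans g.onEdge
  onSink := f.onSink.trans g.onSink
  onSource := f.onSource.trans g.onSource
  src_eq e := by simp [g.src_eq, f.src_eq]
  tgt_eq e := by simp [g.tgt_eq, f.tgt_eq]
  weight_eq e := by simp [g.weight_eq, f.weight_eq]
  sinkFloor_eq s := by simp [g.sinkFloor_eq, f.sinkFloor_eq]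
  sourceFloor_eq s := by simp [g.sourceFloor_eq, f.sourceFloor_eq]
  L_eq v := by simp [g.L_eq, f.L_eq]
  R_eq v := by simp [g.R_eq, f.R_eq]
  marking_floor v := by simp [g.marking_floor, f.marking_floor]
  marking_edge e := by simp [g.marking_edge, f.marking_edge]
  marking_sink s := by simp [g.marking_sink, f.marking_sink]
  marking_source s := by simp [g.marking_source, f.marking_source]

/-- Isomorphism as an equivalence relation on marked floor diagrams. -/
instance isoSetoid (P : HTransverseData) : Setoid (MarkedFloorDiagram P) where
  r D D' := Nonempty (Iso D D')
  iseqv :=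
    { refl := fun D => ⟨Iso.refl D⟩
      symm := fun ⟨f⟩ => ⟨f.symm⟩
      trans := fun ⟨f⟩ ⟨g⟩ => ⟨f.trans g⟩ }

theorem genus_eq_of_iso {D D' : MarkedFloorDiagram P} (f : Iso D D') :
    D.genus = D'.genus := by
  have h : D.numEdges = D'.numEdges := by simpa using Fintype.card_congr f.onEdge
  simp only [FloorDiagram.genus, h]

theorem mult_eq_of_iso {D D' : MarkedFloorDiagram P} (f : Iso D D') :
    D.mult = D'.mult := by
  unfold FloorDiagram.mult
  congr 1
  exact Fintype.prod_equiv f.onEdge _ _ fun e => by rw [f.weight_eq]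

end MarkedFloorDiagram

/-- Isomorphism classes of marked floor diagrams with Newton polygon `P`. -/
def MarkedFloorDiagramClass (P : HTransverseData) : Type :=
  Quotient (MarkedFloorDiagram.isoSetoid P)

namespace MarkedFloorDiagramClass

variable {P : HTransverseData}

/-- The genus of an isomorphism class. -/
def genus (c : MarkedFloorDiagramClass P) : ℤ :=
  Quotient.lift (fun D : MarkedFloorDiagram P => D.genus)
    (fun _ _ (h : Nonempty _) => h.elim MarkedFloorDiagram.genus_eq_of_iso) c

/-- The multiplicity of an isomorphism class. -/
noncomputable def mult (c : MarkedFloorDiagramClass P) : ℤ[T;T⁻¹] :=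
  Quotient.lift (fun D : MarkedFloorDiagram P => D.mult)
    (fun _ _ (h : Nonempty _) => h.elim MarkedFloorDiagram.mult_eq_of_iso) c

end MarkedFloorDiagramClass

/-- The genus `g` tropical refined invariant with cleared denominators, a Laurent polynomial in
`T = q^{1/2}`: the (finite) sum of the multiplicities of the isomorphism classes of marked floor
diagrams of genus `g` with Newton polygon `P`. -/
noncomputable def refinedInvariant (P : HTransverseData) (g : ℕ) : ℤ[T;T⁻¹] :=
  ∑ᶠ c : {c : MarkedFloorDiagramClass P // c.genus = (g : ℤ)}, c.1.mult

/-- The refined invariant of the class `aE + bF` on `𝔽_δ` after the change of variable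
`x^{Area} · (refined invariant)(1/x)`, as a power series in `x`.  In the Laurent polynomials `T` now
stands for `x^{1/2}`, so that the coefficient of `x^i` is the coefficient of `T^{2i}`. -/
noncomputable def refinedSeries (δ g a b : ℕ) : ℤ⟦X⟧ :=
  PowerSeries.mk fun i =>
    (LaurentPolynomial.T (hirzebruchTwiceArea δ a b : ℤ)
      * LaurentPolynomial.invert (refinedInvariant (hirzebruchPolygon δ a b) g)).coeff (2 * (i : ℤ))

/-- `A : H₂(𝔽_δ, ℤ) → ℤ⟦x⟧`, with `A a b` the value at `aE + bF`, is the genus `g` asymptotic refined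
invariant of `𝔽_δ`: it is a polynomial function of `(a, b)`, and the refined invariant is
`A + o(1)` for the `x`-adic topology when the intersection numbers `a`, `b`, `b + δa` of `aE + bF`
with the toric divisors (of classes `F`, `E_∞ = E - δF` and `E`) go to infinity.
An integer-valued polynomial may have denominators, hence the coefficients in `ℚ⟦x⟧`. -/
def IsAsymptoticRefinedInvariant (δ g : ℕ) (A : ℤ → ℤ → ℤ⟦X⟧) : Prop :=
  (∃ Q : MvPolynomial (Fin 2) ℚ⟦X⟧, ∀ a b : ℤ,
      PowerSeries.map (Int.castRingHom ℚ) (A a b) = MvPolynomial.eval ![(a : ℚ⟦X⟧), (b : ℚ⟦X⟧)] Q) ∧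
  ∀ n : ℕ, ∃ C : ℕ, 0 < C ∧ ∀ a b : ℕ, C ≤ a → C ≤ b → C ≤ b + δ * a →
    (PowerSeries.X : ℤ⟦X⟧) ^ n ∣ refinedSeries δ g a b - A a b

/-- The generating series `p(x)` of the partition numbers. -/
noncomputable def partitionSeries : ℤ⟦X⟧ :=
  PowerSeries.mk fun n => (Fintype.card (Nat.Partition n) : ℤ)

/-- `E₂(x) = ∑_{n ≥ 1} σ₁(n) xⁿ`. -/
noncomputable def eisensteinTwo : ℤ⟦X⟧ :=
  PowerSeries.mk fun n => (ArithmeticFunction.sigma 1 n : ℤ)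

/-- `g_max = ½ (a - 1) (2b + δa - 2)`, the genus of a smooth curve in the class `aE + bF`. -/
def gMax (δ : ℕ) (a b : ℤ) : ℤ := (a - 1) * (2 * b + δ * a - 2) / 2

/-- The division in `gMax` is exact. -/
theorem two_mul_gMax (δ : ℕ) (a b : ℤ) :
    2 * gMax δ a b = (a - 1) * (2 * b + δ * a - 2) := by
  unfold gMax
  apply Int.mul_ediv_cancel'
  obtain ⟨k, hk⟩ := Int.even_mul_pred_self a
  exact ⟨(a - 1) * (b - 1) + δ * k, by linear_combination (δ : ℤ) * hk⟩

/-- The letters of the word of a marked floor diagram: `none` stands for a floor, `some (i, j)` for an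
arc from the floor `i` to the floor `j`, the floors being numbered from `1` to `a` along the marking.
Sources start at `0` and sinks end at `a + 1`. -/
abbrev ArcLetter : Type := Option (ℕ × ℕ)

def isFloorLetter : ArcLetter → Bool
  | none => true
  | some _ => false

def isSourceLetter : ArcLetter → Bool
  | none => false
  | some p => p.1 = 0

def isSinkLetter (a : ℕ) : ArcLetter → Bool
  | none => false
  | some p => p.2 = a + 1

def isBoundedLetter (a : ℕ) : ArcLetter → Bool
  | none => false
  | some p => p.1 ≠ 0 ∧ p.2 ≠ a + 1

/-- Whether an arc crosses the cut between the floors `k` and `k + 1`. -/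
def crossesCut (k : ℕ) : ArcLetter → Bool
  | none => false
  | some p => p.1 ≤ k ∧ k < p.2

/-- The number of floors strictly between the ends of an arc. -/
def arcSpan : ArcLetter → ℕ
  | none => 0
  | some p => p.2 - p.1 - 1

/-- `IsPlaced g S`: if `g` floors precede `S`, then every arc of `S` lies between its end points. -/
def IsPlaced : ℕ → List ArcLetter → Prop
  | _, [] => True
  | g, none :: S => IsPlaced (g + 1) S
  | g, some p :: S => (p.1 ≤ g ∧ g < p.2) ∧ IsPlaced g S

/-- The words of marked floor diagrams with `a` floors, `m` bounded edges, `t` sinks, `b` sources and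
divergence `-δ`, disregarding connectedness. -/
structure IsFloorWord (δ a m t b : ℕ) (W : List (ArcLetter × ℕ)) : Prop where
  floors : W.countP (fun l => isFloorLetter l.1) = a
  bounded : W.countP (fun l => isBoundedLetter a l.1) = m
  sinks : W.countP (fun l => isSinkLetter a l.1) = t
  sources : W.countP (fun l => isSourceLetter l.1) = b
  placed : IsPlaced 0 (W.map Prod.fst)
  le : ∀ p w, (some p, w) ∈ W → p.2 ≤ a + 1 ∧ ¬ (p.1 = 0 ∧ p.2 = a + 1)
  weight_pos : ∀ p w, (some p, w) ∈ W → 0 < w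
  weight_floor : ∀ w, (none, w) ∈ W → w = 0
  weight_end : ∀ p w, (some p, w) ∈ W → p.1 = 0 ∨ p.2 = a + 1 → w = 1
  flux : ∀ k, 1 ≤ k → k < a →
    (W.map fun l => if crossesCut k l.1 then l.2 else 0).sum = b + δ * k

theorem countP_take_eq_card {α : Type*} (q : α → Bool) (l : List α) (p : ℕ) :
    (l.take p).countP q = (Finset.univ.filter fun r : Fin l.length => (r : ℕ) < p ∧ q l[r]).card := by
  induction l generalizing p with
  | nil => simp
  | cons x l ih =>
    cases p with
    | zero => simp
    | succ p =>
      rw [List.take_succ_cons, List.countP_cons, ih, Fin.univ_succ, Finset.filter_cons]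
      simp only [List.length_cons]
      by_cases h : q x
      · simp [h, Finset.filter_map]
      · simp [h, Finset.filter_map]

theorem isPlaced_iff_forall_getElem (g : ℕ) (S : List ArcLetter) :
    IsPlaced g S ↔ ∀ (r : ℕ) (h : r < S.length) (p : ℕ × ℕ), S[r] = some p →
      p.1 ≤ g + (S.take r).countP isFloorLetter ∧ g + (S.take r).countP isFloorLetter < p.2 := by
  induction S generalizing g with
  | nil => simp [IsPlaced]
  | cons x S ih =>
    cases x with
    | none =>
      rw [IsPlaced, ih]
      constructor
      · intro h r hr p hp
        cases r with
        | zero => simp at hp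
        | succ r =>
          have := h r (by simpa using hr) p (by simpa using hp)
          simp [List.countP_cons, isFloorLetter]; omega
      · intro h r hr p hp
        have := h (r + 1) (by simpa using hr) p (by simpa using hp)
        simp [List.countP_cons, isFloorLetter] at this; omega
    | some p =>
      rw [IsPlaced, ih]
      constructor
      · rintro ⟨h0, h⟩ r hr p hp
        cases r with
        | zero => simp at hp; subst hp; simpa using h0
        | succ r =>
          have := h r (by simpa using hr) p (by simpa using hp)
          simp [isFloorLetter]; omega
      · intro h
        refine ⟨by simpa using h 0 (by simp) p rfl, fun r hr p hp => ?_⟩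
        have := h (r + 1) (by simpa using hr) p (by simpa using hp)
        simp [isFloorLetter] at this; omega

namespace FloorDiagram

variable {P : HTransverseData}

/-- The cells, split by their kind. -/
def cellEquiv (D : FloorDiagram P) :
    D.Cell ≃ (Fin P.height ⊕ Fin D.numEdges) ⊕ (Fin P.top ⊕ Fin P.bottom) where
  toFun
    | .floor v => .inl (.inl v)
    | .edge e => .inl (.inr e)
    | .sink s => .inr (.inl s)
    | .source s => .inr (.inr s)
  invFun
    | .inl (.inl v) => .floor v
    | .inl (.inr e) => .edge e
    | .inr (.inl s) => .sink s
    | .inr (.inr s) => .source s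
  left_inv c := by cases c <;> rfl
  right_inv c := by rcases c with (v | e) | (s | s) <;> rfl

instance (D : FloorDiagram P) : Fintype D.Cell := Fintype.ofEquiv _ D.cellEquiv.symm

theorem sum_cell {M : Type*} [AddCommMonoid M] (D : FloorDiagram P) (f : D.Cell → M) :
    ∑ c, f c = (∑ v, f (.floor v) + ∑ e, f (.edge e)) +
      (∑ s, f (.sink s) + ∑ s, f (.source s)) := by
  rw [← D.cellEquiv.symm.sum_comp, Fintype.sum_sum_type, Fintype.sum_sum_type,
    Fintype.sum_sum_type]
  rfl

theorem prod_cell {M : Type*} [CommMonoid M] (D : FloorDiagram P) (f : D.Cell → M) :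
    ∏ c, f c = ((∏ v, f (.floor v)) * ∏ e, f (.edge e)) *
      ((∏ s, f (.sink s)) * ∏ s, f (.source s)) := by
  rw [← D.cellEquiv.symm.prod_comp, Fintype.prod_sum_type, Fintype.prod_sum_type,
    Fintype.prod_sum_type]
  rfl

end FloorDiagram

namespace MarkedFloorDiagram

variable {P : HTransverseData} (D : MarkedFloorDiagram P)

/-- The position of a floor in the order of the marking, starting from `1`. -/
def floorRank (v : Fin P.height) : ℕ :=
  (Finset.univ.filter fun u => D.marking (.floor u) ≤ D.marking (.floor v)).card

def letter : D.Cell → ArcLetter × ℕ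
  | .floor _ => (none, 0)
  | .edge e => (some (D.floorRank (D.src e), D.floorRank (D.tgt e)), D.weight e)
  | .sink s => (some (D.floorRank (D.sinkFloor s), P.height + 1), 1)
  | .source s => (some (0, D.floorRank (D.sourceFloor s)), 1)

/-- The word of a marked floor diagram. -/
def word : List (ArcLetter × ℕ) := List.ofFn fun p => D.letter (D.marking.symm p)

theorem length_word : D.word.length = P.height + D.numEdges + P.top + P.bottom := by
  simp [word]

theorem getElem_word (p : ℕ) (h : p < D.word.length) :
    D.word[p] = D.letter (D.marking.symm ⟨p, by simpa [word] using h⟩) := by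
  simp [word]

theorem mem_word {l : ArcLetter × ℕ} : l ∈ D.word ↔ ∃ c, D.letter c = l := by
  rw [word, List.mem_ofFn]
  exact (D.marking.symm.surjective.exists (p := fun c => D.letter c = l)).symm

theorem sum_map_word {M : Type*} [AddCommMonoid M] (f : ArcLetter × ℕ → M) :
    (D.word.map f).sum = ∑ c, f (D.letter c) := by
  rw [word, List.map_ofFn, List.sum_ofFn, ← D.marking.symm.sum_comp]
  rfl

theorem prod_map_word {M : Type*} [CommMonoid M] (f : ArcLetter × ℕ → M) :
    (D.word.map f).prod = ∏ c, f (D.letter c) := by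
  rw [word, List.map_ofFn, List.prod_ofFn, ← D.marking.symm.prod_comp]
  rfl

theorem countP_word (q : ArcLetter × ℕ → Bool) :
    D.word.countP q = ∑ c, if q (D.letter c) then 1 else 0 := by
  rw [← D.sum_map_word fun l => if q l then 1 else 0]
  induction D.word with
  | nil => simp
  | cons x l ih => simp [List.countP_cons, ih, add_comm]

theorem floorRank_lt_iff {u v : Fin P.height} :
    D.floorRank u < D.floorRank v ↔ D.marking (.floor u) < D.marking (.floor v) := by
  constructor
  · intro h
    by_contra! h'
    exact absurd h (not_lt.2 (Finset.card_le_card fun w hw => by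
      simp only [Finset.mem_filter, Finset.mem_univ, true_and] at hw ⊢
      exact hw.trans h'))
  · intro h
    refine Finset.card_lt_card ⟨fun w hw => ?_, fun hs => ?_⟩
    · simp only [Finset.mem_filter, Finset.mem_univ, true_and] at hw ⊢
      exact hw.trans h.le
    · have := @hs v (by simp)
      simp only [Finset.mem_filter, Finset.mem_univ, true_and] at this
      exact absurd h (not_lt.2 this)

theorem floorRank_injective : Function.Injective D.floorRank := by
  intro u v h
  have h1 := mt D.floorRank_lt_iff.2 h.not_lt
  have h2 := mt D.floorRank_lt_iff.2 h.symm.not_lt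
  have := D.marking.injective (le_antisymm (not_lt.1 h2) (not_lt.1 h1))
  simpa using this

theorem floorRank_pos (v : Fin P.height) : 0 < D.floorRank v :=
  Finset.card_pos.2 ⟨v, by simp⟩

theorem floorRank_le (v : Fin P.height) : D.floorRank v ≤ P.height :=
  (Finset.card_le_univ _).trans_eq (Fintype.card_fin _)

theorem card_floorRank_le {k : ℕ} (hk : k ≤ P.height) :
    (Finset.univ.filter fun v => D.floorRank v ≤ k).card = k := by
  have himg : Finset.univ.image D.floorRank = Finset.Icc 1 P.height := by
    refine Finset.eq_of_subset_of_card_le (fun r hr => ?_) ?_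
    · obtain ⟨v, -, rfl⟩ := Finset.mem_image.1 hr
      exact Finset.mem_Icc.2 ⟨D.floorRank_pos v, D.floorRank_le v⟩
    · rw [Finset.card_image_of_injective _ D.floorRank_injective]
      simp
  rw [← Finset.card_image_of_injective _ D.floorRank_injective]
  have : (Finset.univ.filter fun v => D.floorRank v ≤ k).image D.floorRank = Finset.Icc 1 k := by
    ext r
    have hr : r ∈ Finset.univ.image D.floorRank ↔ 1 ≤ r ∧ r ≤ P.height := by
      rw [himg, Finset.mem_Icc]
    simp only [Finset.mem_image, Finset.mem_univ, true_and, Finset.mem_filter,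
      Finset.mem_Icc] at hr ⊢
    constructor
    · rintro ⟨v, hv, rfl⟩
      exact ⟨D.floorRank_pos v, hv⟩
    · rintro ⟨h1, h2⟩
      obtain ⟨v, rfl⟩ := hr.2 ⟨h1, h2.trans hk⟩
      exact ⟨v, h2, rfl⟩
  rw [this]
  simp

/-- The number of floors before a given position of the word. -/
theorem countP_take_word (p : ℕ) :
    ((D.word.map Prod.fst).take p).countP isFloorLetter =
      (Finset.univ.filter fun v => (D.marking (.floor v) : ℕ) < p).card := by
  rw [countP_take_eq_card]
  symm
  refine Finset.card_bij (fun v _ => ⟨D.marking (.floor v), ?_⟩) ?_ ?_ ?_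
  · simp [length_word]
  · intro v hv
    simp only [Finset.mem_filter, Finset.mem_univ, true_and] at hv ⊢
    refine ⟨hv, ?_⟩
    simp [getElem_word, letter, isFloorLetter]
  · intro u _ v _ h
    simp only [Fin.mk.injEq] at h
    simpa using D.marking.injective (Fin.ext h)
  · rintro ⟨r, hr⟩ h
    simp only [Finset.mem_filter, Finset.mem_univ, true_and] at h
    obtain ⟨h1, h2⟩ := h
    have hr' : r < P.height + D.numEdges + P.top + P.bottom := by simpa [length_word] using hr
    have h3 : isFloorLetter (D.letter (D.marking.symm ⟨r, hr'⟩)).1 = true := by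
      simpa [getElem_word] using h2
    obtain ⟨c, hc⟩ := D.marking.surjective ⟨r, hr'⟩
    rw [← hc, Equiv.symm_apply_apply] at h3
    cases c with
    | floor v =>
      refine ⟨v, ?_, ?_⟩
      · simp [hc, h1]
      · simp [hc]
    | edge e => simp [letter, isFloorLetter] at h3
    | sink e => simp [letter, isFloorLetter] at h3
    | source e => simp [letter, isFloorLetter] at h3

theorem floorRank_le_card {v : Fin P.height} {p : ℕ} (h : (D.marking (.floor v) : ℕ) < p) :
    D.floorRank v ≤ (Finset.univ.filter fun v => (D.marking (.floor v) : ℕ) < p).card :=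
  Finset.card_le_card fun u hu => by
    simp only [Finset.mem_filter, Finset.mem_univ, true_and] at hu ⊢
    exact lt_of_le_of_lt hu h

theorem card_lt_floorRank {v : Fin P.height} {p : ℕ} (h : p < (D.marking (.floor v) : ℕ)) :
    (Finset.univ.filter fun v => (D.marking (.floor v) : ℕ) < p).card < D.floorRank v := by
  refine Finset.card_lt_card ⟨fun u hu => ?_, fun hs => ?_⟩
  · simp only [Finset.mem_filter, Finset.mem_univ, true_and] at hu ⊢
    exact Fin.le_def.2 (hu.trans h).le
  · have := @hs v (by simp)
    simp only [Finset.mem_filter, Finset.mem_univ, true_and] at this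
    omega

theorem isPlaced_word : IsPlaced 0 (D.word.map Prod.fst) := by
  rw [isPlaced_iff_forall_getElem]
  intro r hr p hp
  rw [D.countP_take_word, zero_add]
  have hr' : r < P.height + D.numEdges + P.top + P.bottom := by simpa [length_word] using hr
  obtain ⟨c, hc⟩ := D.marking.surjective ⟨r, hr'⟩
  have hp' : (D.letter c).1 = some p := by
    simpa [getElem_word, ← hc] using hp
  have hcr : (D.marking c : ℕ) = r := by rw [hc]
  cases c with
  | floor v => simp [letter] at hp'
  | edge e =>
    simp only [letter, Option.some.injEq] at hp'
    subst hp'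
    have h1 := D.increasing _ _ (.single (FloorDiagram.Cell.Step.leave e))
    have h2 := D.increasing _ _ (.single (FloorDiagram.Cell.Step.enter e))
    rw [Fin.lt_def, hcr] at h1 h2
    exact ⟨D.floorRank_le_card h1, D.card_lt_floorRank h2⟩
  | sink s =>
    simp only [letter, Option.some.injEq] at hp'
    subst hp'
    have h1 := D.increasing _ _ (.single (FloorDiagram.Cell.Step.sink s))
    rw [Fin.lt_def, hcr] at h1
    refine ⟨D.floorRank_le_card h1, Nat.lt_succ_of_le ?_⟩
    simpa using Finset.card_le_univ (Finset.univ.filter fun u =>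
      (D.marking (.floor u) : ℕ) < r)
  | source s =>
    simp only [letter, Option.some.injEq] at hp'
    subst hp'
    have h1 := D.increasing _ _ (.single (FloorDiagram.Cell.Step.source s))
    rw [Fin.lt_def, hcr] at h1
    exact ⟨Nat.zero_le _, D.card_lt_floorRank h1⟩

theorem floorRank_src_lt (e : Fin D.numEdges) :
    D.floorRank (D.src e) < D.floorRank (D.tgt e) := by
  rw [floorRank_lt_iff]
  exact (D.increasing _ _ (.single (FloorDiagram.Cell.Step.leave e))).trans
    (D.increasing _ _ (.single (FloorDiagram.Cell.Step.enter e)))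

theorem flux_word {δ : ℕ} (hδ : ∀ v, D.R v + D.L v = -(δ : ℤ)) {k : ℕ} (hk : 1 ≤ k)
    (hk' : k < P.height) :
    (D.word.map fun l => if crossesCut k l.1 then l.2 else 0).sum = P.bottom + δ * k := by
  have hsum : ∑ v with D.floorRank v ≤ k,
      (((∑ e with D.tgt e = v, (D.weight e : ℤ)) + ∑ s with D.sourceFloor s = v, (1 : ℤ))
      - ((∑ e with D.src e = v, (D.weight e : ℤ)) + ∑ s with D.sinkFloor s = v, (1 : ℤ)))
      = -(δ * k : ℤ) := by
    rw [Finset.sum_congr rfl fun v _ => (D.divergence v).trans (hδ v)]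
    simp [D.card_floorRank_le hk'.le, mul_comm]
  have hfib : ∀ {N : ℕ} (f : Fin N → Fin P.height) (c : Fin N → ℤ),
      ∑ v with D.floorRank v ≤ k, ∑ e with f e = v, c e =
        ∑ e, if D.floorRank (f e) ≤ k then c e else 0 := by
    intro N f c
    rw [← Finset.sum_filter]
    refine (Finset.sum_congr rfl fun v hv => ?_).trans
      (Finset.sum_fiberwise_of_maps_to (s := Finset.univ.filter fun e => D.floorRank (f e) ≤ k)
        (t := Finset.univ.filter fun v => D.floorRank v ≤ k) (g := f) ?_ c)
    · refine Finset.sum_congr ?_ fun _ _ => rfl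
      ext e
      simp only [Finset.mem_filter, Finset.mem_univ, true_and] at hv ⊢
      exact ⟨fun h => ⟨h ▸ hv, h⟩, fun h => h.2⟩
    · intro e he
      simpa using he
  rw [Finset.sum_sub_distrib, Finset.sum_add_distrib, Finset.sum_add_distrib, hfib, hfib, hfib,
    hfib] at hsum
  rw [sum_map_word, FloorDiagram.sum_cell]
  zify
  have e1 : ∀ e : Fin D.numEdges, (((if crossesCut k (D.letter (.edge e)).1 then
      (D.letter (.edge e)).2 else 0 : ℕ) : ℤ)) =
      (if D.floorRank (D.src e) ≤ k then (D.weight e : ℤ) else 0) -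
        if D.floorRank (D.tgt e) ≤ k then (D.weight e : ℤ) else 0 := by
    intro e
    have := D.floorRank_src_lt e
    simp only [letter, crossesCut, decide_eq_true_eq]
    split_ifs <;> omega
  have e2 : ∀ s : Fin P.top, (((if crossesCut k (D.letter (.sink s)).1 then
      (D.letter (.sink s)).2 else 0 : ℕ) : ℤ)) =
      if D.floorRank (D.sinkFloor s) ≤ k then 1 else 0 := by
    intro s
    simp only [letter, crossesCut, decide_eq_true_eq]
    split_ifs <;> omega
  have e3 : ∀ s : Fin P.bottom, (((if crossesCut k (D.letter (.source s)).1 then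
      (D.letter (.source s)).2 else 0 : ℕ) : ℤ)) =
      1 - if D.floorRank (D.sourceFloor s) ≤ k then 1 else 0 := by
    intro s
    simp only [letter, crossesCut, decide_eq_true_eq]
    split_ifs <;> omega
  have e4 : ∀ v : Fin P.height, (((if crossesCut k (D.letter (.floor v)).1 then
      (D.letter (.floor v)).2 else 0 : ℕ) : ℤ)) = 0 := by
    intro v
    simp [letter, crossesCut]
  push_cast at e1 e2 e3 e4 ⊢
  rw [Finset.sum_congr rfl fun v _ => e4 v, Finset.sum_congr rfl fun e _ => e1 e,
    Finset.sum_congr rfl fun e _ => e2 e,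
    Finset.sum_congr rfl fun e _ => e3 e, Finset.sum_sub_distrib, Finset.sum_sub_distrib]
  simp
  simp at hsum
  linarith

theorem isFloorWord_word {δ : ℕ} (hδ : ∀ v, D.R v + D.L v = -(δ : ℤ)) :
    IsFloorWord δ P.height D.numEdges P.top P.bottom D.word := by
  have hp := D.floorRank_pos
  have hp0 : ∀ v, D.floorRank v ≠ 0 := fun v => (hp v).ne'
  have hl : ∀ v, D.floorRank v ≠ P.height + 1 := fun v => by
    have := D.floorRank_le v
    omega
  refine ⟨?_, ?_, ?_, ?_, D.isPlaced_word, ?_, ?_, ?_, ?_, fun k => D.flux_word hδ⟩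
  · rw [countP_word, FloorDiagram.sum_cell]
    simp [letter, isFloorLetter]
  · rw [countP_word, FloorDiagram.sum_cell]
    simp [letter, isBoundedLetter, hp0, hl]
  · rw [countP_word, FloorDiagram.sum_cell]
    simp [letter, isSinkLetter, hl]
  · rw [countP_word, FloorDiagram.sum_cell]
    simp [letter, isSourceLetter, hp0]
  · intro p w h
    obtain ⟨c, hc⟩ := D.mem_word.1 h
    cases c with
    | floor v => simp [letter] at hc
    | edge e =>
      simp only [letter, Prod.mk.injEq, Option.some.injEq] at hc
      obtain ⟨rfl, -⟩ := hc
      exact ⟨(D.floorRank_le _).trans (Nat.le_succ _), fun h => hp0 _ h.1⟩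
    | sink e =>
      simp only [letter, Prod.mk.injEq, Option.some.injEq] at hc
      obtain ⟨rfl, -⟩ := hc
      exact ⟨le_rfl, fun h => hp0 _ h.1⟩
    | source e =>
      simp only [letter, Prod.mk.injEq, Option.some.injEq] at hc
      obtain ⟨rfl, -⟩ := hc
      exact ⟨(D.floorRank_le _).trans (Nat.le_succ _), fun h => hl _ h.2⟩
  · intro p w h
    obtain ⟨c, hc⟩ := D.mem_word.1 h
    cases c with
    | floor v => simp [letter] at hc
    | edge e =>
      simp only [letter, Prod.mk.injEq, Option.some.injEq] at hc
      exact hc.2 ▸ D.weight_pos e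
    | sink e => simp [letter] at hc; omega
    | source e => simp [letter] at hc; omega
  · intro w h
    obtain ⟨c, hc⟩ := D.mem_word.1 h
    cases c with
    | floor v => simp [letter] at hc; omega
    | edge e => simp [letter] at hc
    | sink e => simp [letter] at hc
    | source e => simp [letter] at hc
  · intro p w h h'
    obtain ⟨c, hc⟩ := D.mem_word.1 h
    cases c with
    | floor v => simp [letter] at hc
    | edge e =>
      simp only [letter, Prod.mk.injEq, Option.some.injEq] at hc
      obtain ⟨rfl, -⟩ := hc
      exact absurd h' (by simp [hp0, hl])
    | sink e => simp [letter] at hc; omega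
    | source e => simp [letter] at hc; omega

end MarkedFloorDiagram

namespace MarkedFloorDiagram

variable {P : HTransverseData}

theorem isFloorLetter_letter (D : MarkedFloorDiagram P) (c : D.Cell) :
    isFloorLetter (D.letter c).1 = true ↔ ∃ v, c = .floor v := by
  cases c <;> simp [letter, isFloorLetter]

theorem isBoundedLetter_letter (D : MarkedFloorDiagram P) (c : D.Cell) :
    isBoundedLetter P.height (D.letter c).1 = true ↔ ∃ e, c = .edge e := by
  have hp0 : ∀ v, D.floorRank v ≠ 0 := fun v => (D.floorRank_pos v).ne'
  have hl : ∀ v, D.floorRank v ≠ P.height + 1 := fun v => by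
    have := D.floorRank_le v
    omega
  cases c <;> simp [letter, isBoundedLetter, hp0, hl]

theorem isSinkLetter_letter (D : MarkedFloorDiagram P) (c : D.Cell) :
    isSinkLetter P.height (D.letter c).1 = true ↔ ∃ s, c = .sink s := by
  have hl : ∀ v, D.floorRank v ≠ P.height + 1 := fun v => by
    have := D.floorRank_le v
    omega
  cases c <;> simp [letter, isSinkLetter, hl]

theorem isSourceLetter_letter (D : MarkedFloorDiagram P) (c : D.Cell) :
    isSourceLetter (D.letter c).1 = true ↔ ∃ s, c = .source s := by
  have hp0 : ∀ v, D.floorRank v ≠ 0 := fun v => (D.floorRank_pos v).ne'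
  cases c <;> simp [letter, isSourceLetter, hp0]

theorem floorRank_eq_countP (D : MarkedFloorDiagram P) (v : Fin P.height) :
    D.floorRank v =
      ((D.word.map Prod.fst).take ((D.marking (.floor v) : ℕ) + 1)).countP isFloorLetter := by
  rw [countP_take_word, floorRank]
  simp only [Order.lt_add_one_iff, Fin.le_def]

theorem letter_eq_of_word_eq {D D' : MarkedFloorDiagram P} (h : D.word = D'.word) (c : D.Cell) :
    ∃ c' : D'.Cell, (D'.marking c' : ℕ) = D.marking c ∧ D'.letter c' = D.letter c := by
  have hlen := D.length_word
  rw [h, length_word] at hlen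
  refine ⟨D'.marking.symm ⟨D.marking c, by rw [hlen]; exact (D.marking c).2⟩, by simp, ?_⟩
  have h1 : ∀ (l l' : List (ArcLetter × ℕ)) (_ : l = l') (p : ℕ) (hp : p < l.length)
    (hp' : p < l'.length), l[p] = l'[p] := by rintro l _ rfl p _ _; rfl
  have h2 := h1 _ _ h (D.marking c) (by simp [length_word]) (by
    rw [length_word, hlen]
    exact (D.marking c).2)
  rw [getElem_word, getElem_word] at h2
  simpa using h2.symm

theorem nonempty_iso_of_word_eq {D D' : MarkedFloorDiagram P} (h : D.word = D'.word)
    (hL : ∀ v v', D'.L v' = D.L v) (hR : ∀ v v', D'.R v' = D.R v) : Nonempty (Iso D D') := by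
  have hE : D.numEdges = D'.numEdges := by
    have := D.length_word
    rw [h, length_word] at this
    omega
  have key := letter_eq_of_word_eq h
  have hfloor : ∀ v, ∃ v', (D'.marking (.floor v') : ℕ) = D.marking (.floor v) := by
    intro v
    obtain ⟨c, h1, h2⟩ := key (.floor v)
    obtain ⟨v', rfl⟩ := (D'.isFloorLetter_letter c).1
      (by rw [h2, isFloorLetter_letter]; exact ⟨v, rfl⟩)
    exact ⟨v', h1⟩
  have hedge : ∀ e, ∃ e', (D'.marking (.edge e') : ℕ) = D.marking (.edge e) ∧
      D'.letter (.edge e') = D.letter (.edge e) := by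
    intro v
    obtain ⟨c, h1, h2⟩ := key (.edge v)
    obtain ⟨v', rfl⟩ := (D'.isBoundedLetter_letter c).1
      (by rw [h2, isBoundedLetter_letter]; exact ⟨v, rfl⟩)
    exact ⟨v', h1, h2⟩
  have hsink : ∀ e, ∃ e', (D'.marking (.sink e') : ℕ) = D.marking (.sink e) ∧
      D'.letter (.sink e') = D.letter (.sink e) := by
    intro v
    obtain ⟨c, h1, h2⟩ := key (.sink v)
    obtain ⟨v', rfl⟩ := (D'.isSinkLetter_letter c).1
      (by rw [h2, isSinkLetter_letter]; exact ⟨v, rfl⟩)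
    exact ⟨v', h1, h2⟩
  have hsource : ∀ e, ∃ e', (D'.marking (.source e') : ℕ) = D.marking (.source e) ∧
      D'.letter (.source e') = D.letter (.source e) := by
    intro v
    obtain ⟨c, h1, h2⟩ := key (.source v)
    obtain ⟨v', rfl⟩ := (D'.isSourceLetter_letter c).1
      (by rw [h2, isSourceLetter_letter]; exact ⟨v, rfl⟩)
    exact ⟨v', h1, h2⟩
  choose fF hF using hfloor
  choose fE hE1 hE2 using hedge
  choose fT hT1 hT2 using hsink
  choose fS hS1 hS2 using hsource
  have iF : Function.Injective fF := fun u v huv => by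
    have := (hF u).symm.trans (huv ▸ hF v)
    simpa using D.marking.injective (Fin.ext this)
  have iE : Function.Injective fE := fun u v huv => by
    have := (hE1 u).symm.trans (huv ▸ hE1 v)
    simpa using D.marking.injective (Fin.ext this)
  have iT : Function.Injective fT := fun u v huv => by
    have := (hT1 u).symm.trans (huv ▸ hT1 v)
    simpa using D.marking.injective (Fin.ext this)
  have iS : Function.Injective fS := fun u v huv => by
    have := (hS1 u).symm.trans (huv ▸ hS1 v)
    simpa using D.marking.injective (Fin.ext this)
  have hrank : ∀ v, D'.floorRank (fF v) = D.floorRank v := fun v => by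
    rw [floorRank_eq_countP, floorRank_eq_countP, hF, h]
  have hfl : ∀ {u v}, D'.floorRank u = D.floorRank v → u = fF v := fun {u v} huv =>
    D'.floorRank_injective (huv.trans (hrank v).symm)
  simp only [letter, Prod.mk.injEq, Option.some.injEq] at hE2 hT2 hS2
  exact ⟨{
    onFloor := Equiv.ofBijective fF (Finite.injective_iff_bijective.1 iF)
    onEdge := Equiv.ofBijective fE ((Fintype.bijective_iff_injective_and_card _).2
      ⟨iE, by simpa using hE⟩)
    onSink := Equiv.ofBijective fT (Finite.injective_iff_bijective.1 iT)
    onSource := Equiv.ofBijective fS (Finite.injective_iff_bijective.1 iS)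
    src_eq := fun e => hfl (hE2 e).1.1
    tgt_eq := fun e => hfl (hE2 e).1.2
    weight_eq := fun e => (hE2 e).2
    sinkFloor_eq := fun s => hfl (hT2 s).1.1
    sourceFloor_eq := fun s => hfl (hS2 s).1.2
    L_eq := fun v => hL _ _
    R_eq := fun v => hR _ _
    marking_floor := hF
    marking_edge := hE1
    marking_sink := hT1
    marking_source := hS1 }⟩

theorem floorRank_eq_of_iso {D D' : MarkedFloorDiagram P} (f : Iso D D') (v : Fin P.height) :
    D'.floorRank (f.onFloor v) = D.floorRank v := by
  symm
  refine Finset.card_bij (fun u _ => f.onFloor u) ?_ (fun _ _ _ _ h => f.onFloor.injective h) ?_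
  · intro u hu
    simp only [Finset.mem_filter, Finset.mem_univ, true_and, Fin.le_def] at hu ⊢
    rwa [f.marking_floor, f.marking_floor]
  · intro u hu
    refine ⟨f.onFloor.symm u, ?_, by simp⟩
    simp only [Finset.mem_filter, Finset.mem_univ, true_and, Fin.le_def] at hu ⊢
    rwa [← f.marking_floor, ← f.marking_floor, Equiv.apply_symm_apply]

theorem word_eq_of_iso {D D' : MarkedFloorDiagram P} (f : Iso D D') : D.word = D'.word := by
  have hE : D.numEdges = D'.numEdges := by simpa using Fintype.card_congr f.onEdge
  have key : ∀ c : D.Cell, ∃ c' : D'.Cell, (D'.marking c' : ℕ) = D.marking c ∧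
      D'.letter c' = D.letter c := by
    intro c
    cases c with
    | floor v => exact ⟨.floor (f.onFloor v), f.marking_floor v, rfl⟩
    | edge e =>
      exact ⟨.edge (f.onEdge e), f.marking_edge e, by
        simp [letter, f.src_eq, f.tgt_eq, f.weight_eq, floorRank_eq_of_iso]⟩
    | sink s =>
      exact ⟨.sink (f.onSink s), f.marking_sink s, by
        simp [letter, f.sinkFloor_eq, floorRank_eq_of_iso]⟩
    | source s =>
      exact ⟨.source (f.onSource s), f.marking_source s, by
        simp [letter, f.sourceFloor_eq, floorRank_eq_of_iso]⟩
  refine List.ext_getElem (by simp [length_word, hE]) fun p hp hp' => ?_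
  rw [getElem_word, getElem_word]
  obtain ⟨c', h1, h2⟩ := key (D.marking.symm ⟨p, by simpa [length_word] using hp⟩)
  rw [← h2]
  congr 1
  rw [Equiv.eq_symm_apply]
  exact Fin.ext (by simpa using h1)

end MarkedFloorDiagram

theorem exists_positions (W : List (ArcLetter × ℕ)) (q : ArcLetter → Bool) {m : ℕ}
    (h : W.countP (fun l => q l.1) = m) :
    ∃ e : Fin m → Fin W.length, StrictMono e ∧ ∀ r, q W[r].1 = true ↔ ∃ v, e v = r := by
  have hc : (Finset.univ.filter fun r : Fin W.length => q W[r].1).card = m := by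
    rw [← h]
    have := countP_take_eq_card (fun l : ArcLetter × ℕ => q l.1) W W.length
    simpa using this.symm
  refine ⟨Finset.orderEmbOfFin _ hc, (Finset.orderEmbOfFin _ hc).strictMono, fun r => ?_⟩
  have := Finset.range_orderEmbOfFin _ hc
  rw [← Set.mem_range, this]
  simp

theorem lt_card_filter_lt_iff {a N : ℕ} {e : Fin a → Fin N} (he : StrictMono e) (p : ℕ)
    (v : Fin a) : (v : ℕ) < (Finset.univ.filter fun u => (e u : ℕ) < p).card ↔ (e v : ℕ) < p := by
  constructor
  · intro h
    by_contra! h'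
    have : (Finset.univ.filter fun u => (e u : ℕ) < p) ⊆ Finset.Iio v := fun u hu => by
      simp only [Finset.mem_filter, Finset.mem_univ, true_and] at hu
      exact Finset.mem_Iio.2 (he.lt_iff_lt.1 (Fin.lt_def.2 (hu.trans_le h')))
    have := Finset.card_le_card this
    simp at this
    omega
  · intro h
    have : Finset.Iic v ⊆ (Finset.univ.filter fun u => (e u : ℕ) < p) := fun u hu => by
      simp only [Finset.mem_filter, Finset.mem_univ, true_and]
      exact lt_of_le_of_lt (Fin.le_def.1 (he.monotone (Finset.mem_Iic.1 hu))) h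
    have := Finset.card_le_card this
    simp at this
    omega

theorem IsFloorWord.lt {δ a m t b : ℕ} {W : List (ArcLetter × ℕ)} (hW : IsFloorWord δ a m t b W)
    {p : ℕ × ℕ} {w : ℕ} (h : (some p, w) ∈ W) : p.1 < p.2 := by
  obtain ⟨r, hr, hp⟩ := List.mem_iff_getElem.1 h
  have := (isPlaced_iff_forall_getElem _ _).1 hW.placed r (by simpa using hr) p (by simp [hp])
  omega

/-- The balancing condition at the floor `k + 1`. -/
theorem IsFloorWord.balance {δ a m b : ℕ} {W : List (ArcLetter × ℕ)}
    (hW : IsFloorWord δ a m (b + δ * a) b W) {k : ℕ} (hk : k < a) :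
    (W.map fun l => if (l.1.map Prod.fst) = some (k + 1) then (l.2 : ℤ) else 0).sum -
      (W.map fun l => if (l.1.map Prod.snd) = some (k + 1) then (l.2 : ℤ) else 0).sum = δ := by
  have hflux : ∀ k, k ≤ a →
      (W.map fun l => if crossesCut k l.1 then l.2 else 0).sum = b + δ * k := by
    intro k hk
    rcases Nat.eq_zero_or_pos k with rfl | hk0
    · have : W.map (fun l => if crossesCut 0 l.1 then l.2 else 0) =
          W.map fun l => if isSourceLetter l.1 then 1 else 0 := by
        refine List.map_congr_left fun l hl => ?_
        obtain ⟨_ | p, w⟩ := l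
        · simp [crossesCut, isSourceLetter]
        · have h1 := hW.lt hl
          have h2 := hW.weight_end p w hl
          simp only [crossesCut, isSourceLetter, decide_eq_true_eq]
          split_ifs <;> omega
      rw [this, mul_zero, add_zero, ← hW.sources]
      generalize W = V
      induction V with
      | nil => simp
      | cons x l ih => simp [List.countP_cons, ih, add_comm]
    · rcases hk.lt_or_eq with hk | rfl
      · exact hW.flux k hk0 hk
      · have : W.map (fun l => if crossesCut k l.1 then l.2 else 0) =
            W.map fun l => if isSinkLetter k l.1 then 1 else 0 := by
          refine List.map_congr_left fun l hl => ?_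
          obtain ⟨_ | p, w⟩ := l
          · simp [crossesCut, isSinkLetter]
          · have h1 := hW.lt hl
            have h2 := hW.weight_end p w hl
            have h3 := hW.le p w hl
            simp only [crossesCut, isSinkLetter, decide_eq_true_eq]
            split_ifs <;> omega
        rw [this, ← hW.sinks]
        generalize W = V
        induction V with
        | nil => simp
        | cons x l ih => simp [List.countP_cons, ih, add_comm]
  have h1 := hflux k hk.le
  have h2 := hflux (k + 1) hk
  have key : ∀ V : List (ArcLetter × ℕ), (∀ p w, (some p, w) ∈ V → p.1 < p.2) →
      (V.map fun l => if (l.1.map Prod.fst) = some (k + 1) then (l.2 : ℤ) else 0).sum -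
      (V.map fun l => if (l.1.map Prod.snd) = some (k + 1) then (l.2 : ℤ) else 0).sum =
      ((V.map fun l => if crossesCut (k + 1) l.1 then l.2 else 0).sum : ℕ) -
      ((V.map fun l => if crossesCut k l.1 then l.2 else 0).sum : ℕ) := by
    intro V
    induction V with
    | nil => simp
    | cons x V ih =>
      intro hV
      have ih := ih fun p w h => hV p w (List.mem_cons_of_mem _ h)
      obtain ⟨_ | p, w⟩ := x
      · simpa [crossesCut] using ih
      · have hp := hV p w List.mem_cons_self
        simp only [List.map_cons, List.sum_cons, Nat.cast_add]
        simp only [crossesCut, Option.map_some, Option.some.injEq, decide_eq_true_eq] at ih ⊢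
        split_ifs <;> omega
  rw [key W fun p w h => hW.lt h, h1, h2]
  push_cast
  ring

theorem exists_markedFloorDiagram {δ a m b : ℕ} {W : List (ArcLetter × ℕ)} (ha : 0 < a)
    (hW : IsFloorWord δ a m (b + δ * a) b W)
    (hconn : ∀ k, 1 ≤ k → k < a → ∃ w, (some (k, k + 1), w) ∈ W) :
    ∃ D : MarkedFloorDiagram (hirzebruchPolygon δ a b), D.numEdges = m ∧ D.word = W := by
  obtain ⟨eF, eF_mono, eF_mem⟩ := exists_positions W isFloorLetter hW.floors
  obtain ⟨eB, eB_mono, eB_mem⟩ := exists_positions W (isBoundedLetter a) hW.bounded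
  obtain ⟨eT, eT_mono, eT_mem⟩ := exists_positions W (isSinkLetter a) hW.sinks
  obtain ⟨eS, eS_mono, eS_mem⟩ := exists_positions W isSourceLetter hW.sources
  -- the arcs at the positions of each kind
  have hF : ∀ v, W[eF v] = (none, 0) := fun v => by
    have h1 := (eF_mem _).2 ⟨v, rfl⟩
    have h2 : W[eF v] ∈ W := List.getElem_mem _
    rcases h : W[eF v] with ⟨_ | p, w⟩
    · rw [h] at h2
      rw [hW.weight_floor w h2]
    · rw [h] at h1
      simp [isFloorLetter] at h1
  have hB : ∀ e, ∃ i j : Fin a, ∃ w : ℕ, i < j ∧ 0 < w ∧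
      W[eB e] = (some ((i : ℕ) + 1, (j : ℕ) + 1), w) := fun e => by
    have h1 := (eB_mem _).2 ⟨e, rfl⟩
    have h2 : W[eB e] ∈ W := List.getElem_mem _
    rcases h : W[eB e] with ⟨_ | ⟨i, j⟩, w⟩
    · rw [h] at h1
      simp [isBoundedLetter] at h1
    · rw [h] at h1 h2
      simp only [isBoundedLetter, decide_eq_true_eq] at h1
      have h3 := hW.lt h2
      have h4 := hW.le _ _ h2
      simp only at h3 h4
      refine ⟨⟨i - 1, by omega⟩, ⟨j - 1, by omega⟩, w, ?_, hW.weight_pos _ _ h2, ?_⟩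
      · simp only [Fin.mk_lt_mk]; omega
      · simp only [Nat.sub_add_cancel (show 1 ≤ i by omega),
          Nat.sub_add_cancel (show 1 ≤ j by omega)]
  have hT : ∀ s, ∃ i : Fin a, W[eT s] = (some ((i : ℕ) + 1, a + 1), 1) := fun s => by
    have h1 := (eT_mem _).2 ⟨s, rfl⟩
    have h2 : W[eT s] ∈ W := List.getElem_mem _
    rcases h : W[eT s] with ⟨_ | ⟨i, j⟩, w⟩
    · rw [h] at h1
      simp [isSinkLetter] at h1
    · rw [h] at h1 h2
      simp only [isSinkLetter, decide_eq_true_eq] at h1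
      have h3 := hW.lt h2
      have h4 := hW.le _ _ h2
      have h5 := hW.weight_end _ _ h2 (Or.inr h1)
      simp only at h3 h4
      refine ⟨⟨i - 1, by omega⟩, ?_⟩
      simp only [Nat.sub_add_cancel (show 1 ≤ i by omega), h1, h5]
  have hS : ∀ s, ∃ j : Fin a, W[eS s] = (some (0, (j : ℕ) + 1), 1) := fun s => by
    have h1 := (eS_mem _).2 ⟨s, rfl⟩
    have h2 : W[eS s] ∈ W := List.getElem_mem _
    rcases h : W[eS s] with ⟨_ | ⟨i, j⟩, w⟩
    · rw [h] at h1
      simp [isSourceLetter] at h1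
    · rw [h] at h1 h2
      simp only [isSourceLetter, decide_eq_true_eq] at h1
      have h3 := hW.lt h2
      have h4 := hW.le _ _ h2
      have h5 := hW.weight_end _ _ h2 (Or.inl h1)
      simp only at h3 h4
      refine ⟨⟨j - 1, by omega⟩, ?_⟩
      simp only [Nat.sub_add_cancel (show 1 ≤ j by omega), h1, h5]
  choose src tgt wgt hlt hpos hB using hB
  choose snk hT using hT
  choose src' hS using hS
  have hget : ∀ r s : Fin W.length, r = s → W[r] = W[s] := by
    rintro r _ rfl
    rfl
  -- all positions together
  let pos : (Fin a ⊕ Fin m) ⊕ (Fin (b + δ * a) ⊕ Fin b) → Fin W.length :=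
    Sum.elim (Sum.elim eF eB) (Sum.elim eT eS)
  have hpos_bij : Function.Bijective pos := by
    constructor
    · intro x y hxy
      have hxy' : W[pos x] = W[pos y] := hget _ _ hxy
      have na : ∀ i : Fin a, (i : ℕ) ≠ a := fun i => i.2.ne
      have na' : ∀ i : Fin a, a ≠ (i : ℕ) := fun i => i.2.ne'
      rcases x with (x | x) | (x | x) <;> rcases y with (y | y) | (y | y) <;>
        simp only [pos, Sum.elim_inl, Sum.elim_inr] at hxy hxy' <;>
        simp [hF, hB, hT, hS, na, na'] at hxy'
      · rw [eF_mono.injective hxy]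
      · rw [eB_mono.injective hxy]
      · rw [eT_mono.injective hxy]
      · rw [eS_mono.injective hxy]
    · intro r
      have h2 : W[r] ∈ W := List.getElem_mem _
      by_cases h3 : isFloorLetter W[r].1
      · obtain ⟨v, hv⟩ := (eF_mem r).1 h3
        exact ⟨.inl (.inl v), hv⟩
      by_cases h4 : isBoundedLetter a W[r].1
      · obtain ⟨v, hv⟩ := (eB_mem r).1 h4
        exact ⟨.inl (.inr v), hv⟩
      by_cases h5 : isSinkLetter a W[r].1
      · obtain ⟨v, hv⟩ := (eT_mem r).1 h5
        exact ⟨.inr (.inl v), hv⟩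
      by_cases h6 : isSourceLetter W[r].1
      · obtain ⟨v, hv⟩ := (eS_mem r).1 h6
        exact ⟨.inr (.inr v), hv⟩
      exfalso
      rcases h : W[r] with ⟨_ | ⟨i, j⟩, w⟩
      · rw [h] at h3
        simp [isFloorLetter] at h3
      · rw [h] at h4 h5 h6
        simp [isBoundedLetter, isSinkLetter, isSourceLetter] at h4 h5 h6
        exact h5 (h4 h6)
  have hlen : W.length = a + m + (b + δ * a) + b := by
    have := Fintype.card_congr (Equiv.ofBijective pos hpos_bij)
    simp at this
    omega
  have hsum : ∀ f : ArcLetter × ℕ → ℤ, (W.map f).sum =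
      (∑ v, f W[eF v] + ∑ e, f W[eB e]) + (∑ s, f W[eT s] + ∑ s, f W[eS s]) := by
    intro f
    have : (W.map f).sum = ∑ r : Fin W.length, f W[r] := by
      rw [← List.sum_ofFn]
      congr 1
      exact List.ext_getElem (by simp) fun _ _ _ => by simp
    rw [this, ← (Equiv.ofBijective pos hpos_bij).sum_comp, Fintype.sum_sum_type,
      Fintype.sum_sum_type, Fintype.sum_sum_type]
    rfl
  -- the number of floors in front of a position
  have hgap : ∀ (r : Fin W.length) (i j w : ℕ), W[r] = (some (i, j), w) →
      (∀ v : Fin a, (v : ℕ) < i → eF v < r) ∧ (∀ v : Fin a, j ≤ v + 1 → r < eF v) := by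
    intro r i j w hr
    have h1 := (isPlaced_iff_forall_getElem _ _).1 hW.placed r (by simp) (i, j)
      (by simpa using congrArg Prod.fst hr)
    have h2 : ((W.map Prod.fst).take r).countP isFloorLetter =
        (Finset.univ.filter fun v => (eF v : ℕ) < r).card := by
      rw [countP_take_eq_card]
      symm
      refine Finset.card_bij (fun v _ => ⟨eF v, by simp⟩) ?_ ?_ ?_
      · intro v hv
        simp only [Finset.mem_filter, Finset.mem_univ, true_and] at hv ⊢
        refine ⟨hv, ?_⟩
        have := (eF_mem _).2 ⟨v, rfl⟩
        simpa using this
      · intro u _ v _ h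
        exact eF_mono.injective (Fin.ext (by simpa using h))
      · rintro ⟨x, hx⟩ h
        simp only [Finset.mem_filter, Finset.mem_univ, true_and] at h
        obtain ⟨v, hv⟩ := (eF_mem ⟨x, by simpa using hx⟩).1 (by simpa using h.2)
        refine ⟨v, ?_, ?_⟩
        · simp only [Finset.mem_filter, Finset.mem_univ, true_and, hv]
          exact h.1
        · simp [hv]
    rw [h2] at h1
    simp only [zero_add] at h1
    refine ⟨fun v hv => ?_, fun v hv => ?_⟩
    · exact Fin.lt_def.2 ((lt_card_filter_lt_iff eF_mono r v).1 (by omega))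
    · have h3 := mt (lt_card_filter_lt_iff eF_mono r v).2 (by omega)
      refine lt_of_le_of_ne (Fin.le_def.2 (not_lt.1 h3)) fun h => ?_
      have h4 := (hget _ _ h).symm.trans hr
      rw [hF v] at h4
      simp at h4
  let D₀ : FloorDiagram (hirzebruchPolygon δ a b) :=
    { numEdges := m
      src := src
      tgt := tgt
      weight := wgt
      sinkFloor := snk
      sourceFloor := src'
      L := fun _ => 0
      R := fun _ => -(δ : ℤ)
      weight_pos := hpos
      map_L := by simp
      map_R := by simp
      divergence := by
        intro v
        have h := hW.balance v.2
        rw [hsum, hsum] at h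
        have na' : ∀ i : Fin a, a ≠ (i : ℕ) := fun i => i.2.ne'
        simp [hF, hB, hT, hS, ← Fin.ext_iff, na'] at h
        simp only [Finset.sum_filter]
        simp
        linarith
      connected := by
        have : Nonempty (Fin a) := ⟨⟨0, ha⟩⟩
        refine SimpleGraph.Connected.mk ?_
        have h0 : ∀ k (hk : k < a), (SimpleGraph.fromRel fun u v => ∃ e, src e = u ∧
            tgt e = v).Reachable ⟨0, ha⟩ ⟨k, hk⟩ := by
          intro k
          induction k with
          | zero => intro _; rfl
          | succ k ih =>
            intro hk
            refine (ih (by omega)).trans (SimpleGraph.Adj.reachable ?_)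
            obtain ⟨w, hw⟩ := hconn (k + 1) (by omega) hk
            obtain ⟨r, hr, hrw⟩ := List.mem_iff_getElem.1 hw
            obtain ⟨e, he⟩ := (eB_mem ⟨r, hr⟩).1 (by
              simp [hrw, isBoundedLetter]
              omega)
            have h1 := hB e
            simp only [he, Fin.getElem_fin, hrw, Prod.mk.injEq, Option.some.injEq,
              Nat.add_right_cancel_iff] at h1
            rw [SimpleGraph.fromRel_adj]
            refine ⟨by simp, Or.inl ⟨e, Fin.ext h1.1.1.symm, Fin.ext h1.1.2.symm⟩⟩
        intro u v
        exact (h0 u u.2).symm.trans (h0 v v.2)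
      acyclic := by
        intro v hv
        have : ∀ u v, Relation.TransGen (fun u v => ∃ e, src e = u ∧ tgt e = v) u v → u < v := by
          intro u v h
          induction h with
          | single h => obtain ⟨e, rfl, rfl⟩ := h; exact hlt e
          | tail _ h ih => obtain ⟨e, rfl, rfl⟩ := h; exact ih.trans (hlt e)
        exact lt_irrefl _ (this v v hv) }
  let mk : D₀.Cell ≃ Fin (a + m + (b + δ * a) + b) :=
    (D₀.cellEquiv.trans (Equiv.ofBijective pos hpos_bij)).trans (finCongr hlen)
  have mkF : ∀ v, (mk (.floor v) : ℕ) = eF v := fun v => rfl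
  have mkB : ∀ v, (mk (.edge v) : ℕ) = eB v := fun v => rfl
  have mkT : ∀ v, (mk (.sink v) : ℕ) = eT v := fun v => rfl
  have mkS : ∀ v, (mk (.source v) : ℕ) = eS v := fun v => rfl
  have hinc : ∀ x y, Relation.TransGen (FloorDiagram.Cell.Step D₀) x y → mk x < mk y := by
    have hstep : ∀ x y, FloorDiagram.Cell.Step D₀ x y → mk x < mk y := by
      intro x y h
      rw [Fin.lt_def]
      cases h with
      | leave e =>
        rw [mkF, mkB]
        exact (hgap _ _ _ _ (hB e)).1 _ (Nat.lt_succ_self _)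
      | enter e =>
        rw [mkF, mkB]
        exact (hgap _ _ _ _ (hB e)).2 _ le_rfl
      | sink s =>
        rw [mkF, mkT]
        exact (hgap _ _ _ _ (hT s)).1 _ (Nat.lt_succ_self _)
      | source s =>
        rw [mkF, mkS]
        exact (hgap _ _ _ _ (hS s)).2 _ le_rfl
    intro x y h
    induction h with
    | single h => exact hstep _ _ h
    | tail _ h ih => exact ih.trans (hstep _ _ h)
  let D : MarkedFloorDiagram (hirzebruchPolygon δ a b) :=
    { D₀ with
      marking := mk
      increasing := hinc }
  have hrank : ∀ v : Fin a, D.floorRank v = v + 1 := by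
    intro v
    have : (Finset.univ.filter fun u : Fin a => D.marking (.floor u) ≤ D.marking (.floor v)) =
        Finset.Iic v := by
      ext u
      simp only [Finset.mem_filter, Finset.mem_univ, true_and, Finset.mem_Iic]
      exact eF_mono.le_iff_le
    exact (congrArg Finset.card this).trans (by simp)
  refine ⟨D, rfl, List.ext_getElem (by rw [D.length_word, hlen]) fun p hp hp' => ?_⟩
  rw [D.getElem_word]
  have hp'' : p < a + m + (b + δ * a) + b := hlen ▸ hp'
  obtain ⟨c, hc⟩ := mk.surjective ⟨p, hp''⟩
  have hc1 : D.marking.symm ⟨p, hp''⟩ = c := by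
    rw [Equiv.symm_apply_eq]
    exact hc.symm
  have hc2 : (mk c : ℕ) = p := by rw [hc]
  have hW' : ∀ r : Fin W.length, (r : ℕ) = p → W[p] = W[r] := by
    rintro r rfl
    rfl
  refine (congrArg D.letter hc1).trans ?_
  cases c with
  | floor v => rw [hW' (eF v) hc2, hF]; rfl
  | edge e =>
    rw [hW' (eB e) hc2, hB]
    exact Prod.ext (congrArg some (Prod.ext (hrank _) (hrank _))) rfl
  | sink s =>
    rw [hW' (eT s) hc2, hT]
    exact Prod.ext (congrArg some (Prod.ext (hrank _) rfl)) rfl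
  | source s =>
    rw [hW' (eS s) hc2, hS]
    exact Prod.ext (congrArg some (Prod.ext rfl (hrank _))) rfl

/-- The contribution of a weighted letter to the multiplicity of its word. -/
def letterTerm {R : Type*} [CommRing R] (a : ℕ) (x : R) (l : ArcLetter × ℕ) : R :=
  x ^ (l.2 * arcSpan l.1) *
    if isFloorLetter l.1 then 1 else if isBoundedLetter a l.1 then (1 - x ^ l.2) ^ 2 else 1 - x

theorem map_letterTerm {R S : Type*} [CommRing R] [CommRing S] (f : R →+* S) (a : ℕ) (x : R)
    (l : ArcLetter × ℕ) : f (letterTerm a x l) = letterTerm a (f x) l := by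
  unfold letterTerm
  split_ifs <;> simp

theorem map_prod_letterTerm {R S : Type*} [CommRing R] [CommRing S] (f : R →+* S) (a : ℕ) (x : R)
    (W : List (ArcLetter × ℕ)) :
    f (W.map (letterTerm a x)).prod = (W.map (letterTerm a (f x))).prod := by
  rw [map_list_prod, List.map_map]
  congr 2
  ext l
  exact map_letterTerm f a x l

/-- The even nonnegative part of a Laurent polynomial in `T = x^{1/2}`, as a power series in `x`. -/
noncomputable def evenPart : ℤ[T;T⁻¹] →+ ℤ⟦X⟧ where
  toFun f := PowerSeries.mk fun i => f.coeff (2 * (i : ℤ))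
  map_zero' := by ext; simp
  map_add' f g := by ext; simp

theorem evenPart_aeval (p : Polynomial ℤ) :
    evenPart (Polynomial.aeval (LaurentPolynomial.T 2 : ℤ[T;T⁻¹]) p) = (p : ℤ⟦X⟧) := by
  induction p using Polynomial.induction_on' with
  | add p q hp hq => rw [map_add, map_add, hp, hq, Polynomial.coe_add]
  | monomial n r =>
    ext i
    rw [Polynomial.aeval_monomial, LaurentPolynomial.T_pow]
    simp only [evenPart, AddMonoidHom.coe_mk, ZeroHom.coe_mk, PowerSeries.coeff_mk,
      Polynomial.coeff_coe, Polynomial.coeff_monomial]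
    rw [← LaurentPolynomial.C_eq_algebraMap, ← LaurentPolynomial.single_eq_C_mul_T,
      AddMonoidAlgebra.coeff_single, Finsupp.single_apply]
    congr 1
    simp only [eq_iff_iff]
    omega

namespace MarkedFloorDiagram

theorem two_mul_sum_arcSpan {δ a b : ℕ} (D : MarkedFloorDiagram (hirzebruchPolygon δ a b))
    (ha : 0 < a) (hδ : ∀ v, D.R v + D.L v = -(δ : ℤ)) :
    hirzebruchTwiceArea δ a b = 2 * (D.word.map fun l => l.2 * arcSpan l.1).sum +
      (2 * ∑ e, D.weight e + ((b + δ * a) + b)) := by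
  have h1 : ∑ k ∈ Finset.Ico 1 a, (D.word.map fun l => if crossesCut k l.1 then l.2 else 0).sum =
      ∑ k ∈ Finset.Ico 1 a, (b + δ * k) :=
    Finset.sum_congr rfl fun k hk =>
      D.flux_word hδ (Finset.mem_Ico.1 hk).1 (Finset.mem_Ico.1 hk).2
  simp only [sum_map_word] at h1 ⊢
  rw [Finset.sum_comm] at h1
  have hcard : ∀ i j : ℕ, 1 ≤ i → j ≤ a → ∀ w, ∑ k ∈ Finset.Ico 1 a,
      (if crossesCut k (some (i, j)) then w else 0) = w * (j - i) := by
    intro i j hi hj w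
    rw [← Finset.sum_filter]
    have : (Finset.Ico 1 a).filter (fun k => crossesCut k (some (i, j)) = true) =
        Finset.Ico i j := by
      ext k
      simp [crossesCut]
      omega
    rw [this]
    simp [mul_comm]
  have e1 : ∀ c : D.Cell, ∑ k ∈ Finset.Ico 1 a,
      (if crossesCut k (D.letter c).1 then (D.letter c).2 else 0) =
      (D.letter c).2 * arcSpan (D.letter c).1 +
        if isBoundedLetter a (D.letter c).1 then (D.letter c).2 else 0 := by
    intro c
    have hle := D.floorRank_le
    have hpos := D.floorRank_pos
    simp only at hle
    cases c with
    | floor v => simp [letter, crossesCut, isBoundedLetter]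
    | edge e =>
      change ∑ k ∈ Finset.Ico 1 a, (if crossesCut k (some (D.floorRank (D.src e), D.floorRank (D.tgt e)))
          then D.weight e else 0) =
        D.weight e * arcSpan (some (D.floorRank (D.src e), D.floorRank (D.tgt e))) +
          if isBoundedLetter a (some (D.floorRank (D.src e), D.floorRank (D.tgt e)))
            then D.weight e else 0
      rw [hcard _ _ (hpos _) (hle _)]
      have h2 := D.floorRank_src_lt e
      have h3 := hle (D.tgt e)
      have h4 := hpos (D.src e)
      have h5 : D.floorRank (D.tgt e) ≠ a + 1 := by omega
      simp only [isBoundedLetter, arcSpan, ne_eq, h4.ne', h5, not_false_eq_true, and_self,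
        decide_true, if_true]
      rw [← Nat.mul_succ]
      congr 1
      omega
    | sink s =>
      change ∑ k ∈ Finset.Ico 1 a, (if crossesCut k (some (D.floorRank (D.sinkFloor s), a + 1))
          then 1 else 0) =
        1 * arcSpan (some (D.floorRank (D.sinkFloor s), a + 1)) +
          if isBoundedLetter a (some (D.floorRank (D.sinkFloor s), a + 1)) then 1 else 0
      have h3 := hle (D.sinkFloor s)
      have h4 := hpos (D.sinkFloor s)
      have : ∀ k ∈ Finset.Ico 1 a,
          (if crossesCut k (some (D.floorRank (D.sinkFloor s), a + 1))
          then 1 else 0) =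
          if crossesCut k (some (D.floorRank (D.sinkFloor s), a)) then 1 else 0 := by
        intro k hk
        have := (Finset.mem_Ico.1 hk).2
        simp [crossesCut, this, this.trans (Nat.lt_succ_self a)]
      rw [Finset.sum_congr rfl this, hcard _ _ h4 le_rfl]
      simp [isBoundedLetter, arcSpan]
      omega
    | source s =>
      change ∑ k ∈ Finset.Ico 1 a, (if crossesCut k (some (0, D.floorRank (D.sourceFloor s)))
          then 1 else 0) =
        1 * arcSpan (some (0, D.floorRank (D.sourceFloor s))) +
          if isBoundedLetter a (some (0, D.floorRank (D.sourceFloor s))) then 1 else 0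
      have h3 := hle (D.sourceFloor s)
      have h4 := hpos (D.sourceFloor s)
      have : ∀ k ∈ Finset.Ico 1 a,
          (if crossesCut k (some (0, D.floorRank (D.sourceFloor s)))
          then 1 else 0) =
          if crossesCut k (some (1, D.floorRank (D.sourceFloor s))) then 1 else 0 := by
        intro k hk
        have := (Finset.mem_Ico.1 hk).1
        simp [crossesCut, this]
      rw [Finset.sum_congr rfl this, hcard _ _ le_rfl h3]
      simp [isBoundedLetter, arcSpan]
  rw [Finset.sum_congr rfl fun c _ => e1 c, Finset.sum_add_distrib] at h1
  have e2 : ∑ c, (if isBoundedLetter a (D.letter c).1 then (D.letter c).2 else 0) =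
      ∑ e, D.weight e := by
    rw [D.sum_cell]
    have hp0 : ∀ v, D.floorRank v ≠ 0 := fun v => (D.floorRank_pos v).ne'
    have hl : ∀ v, D.floorRank v ≠ a + 1 := fun v => by
      have := D.floorRank_le v
      simp only at this
      omega
    simp [letter, isBoundedLetter, hp0, hl]
  rw [e2] at h1
  have e3 : ∀ n, 2 * ∑ k ∈ Finset.Ico 1 (n + 1), (b + δ * k) = n * (2 * b + δ * (n + 1)) := by
    intro n
    induction n with
    | zero => simp
    | succ n ih =>
      rw [Finset.sum_Ico_succ_top (by omega), mul_add, ih]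
      ring
  obtain ⟨n, rfl⟩ := Nat.exists_eq_succ_of_ne_zero ha.ne'
  have e4 := e3 n
  rw [← h1] at e4
  simp only [hirzebruchTwiceArea, Nat.succ_eq_add_one]
  nlinarith

theorem evenPart_mult {δ a b : ℕ} (D : MarkedFloorDiagram (hirzebruchPolygon δ a b))
    (ha : 0 < a) (hδ : ∀ v, D.R v + D.L v = -(δ : ℤ)) :
    evenPart (LaurentPolynomial.T (hirzebruchTwiceArea δ a b : ℤ) *
      LaurentPolynomial.invert D.mult) = (D.word.map (letterTerm a (PowerSeries.X : ℤ⟦X⟧))).prod := by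
  have h1 := map_prod_letterTerm (Polynomial.coeToPowerSeries.ringHom (R := ℤ)) a Polynomial.X D.word
  simp only [Polynomial.coeToPowerSeries.ringHom_apply, Polynomial.coe_X] at h1
  rw [← h1, ← evenPart_aeval]
  congr 1
  have h2 := map_prod_letterTerm
    (Polynomial.aeval (LaurentPolynomial.T 2 : ℤ[T;T⁻¹])).toRingHom a
    (Polynomial.X : Polynomial ℤ) D.word
  simp only [AlgHom.toRingHom_eq_coe, RingHom.coe_coe, Polynomial.aeval_X] at h2
  rw [h2]
  have hsplit : (D.word.map (letterTerm a (LaurentPolynomial.T 2 : ℤ[T;T⁻¹]))).prod =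
      LaurentPolynomial.T (2 * ((D.word.map fun l => l.2 * arcSpan l.1).sum : ℕ) : ℤ) *
      ((∏ e, (1 - LaurentPolynomial.T (2 * D.weight e : ℤ)) ^ 2) *
        (1 - LaurentPolynomial.T 2) ^ ((b + δ * a) + b)) := by
    have hp0 : ∀ v, D.floorRank v ≠ 0 := fun v => (D.floorRank_pos v).ne'
    have hl : ∀ v, D.floorRank v ≠ a + 1 := fun v => by
      have := D.floorRank_le v
      simp only at this
      omega
    have e : ∀ V : List (ArcLetter × ℕ), (V.map (letterTerm a (LaurentPolynomial.T 2 : ℤ[T;T⁻¹]))).prod =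
        LaurentPolynomial.T (2 * ((V.map fun l => l.2 * arcSpan l.1).sum : ℕ) : ℤ) *
        (V.map fun l => if isFloorLetter l.1 then 1 else if isBoundedLetter a l.1 then
          (1 - LaurentPolynomial.T (2 * l.2 : ℤ)) ^ 2 else 1 - LaurentPolynomial.T 2).prod := by
      intro V
      induction V with
      | nil => simp
      | cons l V ih =>
        simp only [List.map_cons, List.prod_cons, List.sum_cons, ih, letterTerm,
          LaurentPolynomial.T_pow]
        push_cast
        rw [mul_add, LaurentPolynomial.T_add, mul_comm (2 : ℤ) ((l.2 : ℤ) * _),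
          mul_comm (2 : ℤ) (l.2 : ℤ)]
        ring
    rw [e]
    congr 1
    rw [D.prod_map_word, D.prod_cell]
    simp [letter, isFloorLetter, isBoundedLetter, hp0, hl, pow_add]
  rw [hsplit, D.two_mul_sum_arcSpan ha hδ]
  have hw : ∀ w : ℤ, (LaurentPolynomial.T (-w) - LaurentPolynomial.T w : ℤ[T;T⁻¹]) =
      LaurentPolynomial.T (-w) * (1 - LaurentPolynomial.T (2 * w)) := by
    intro w
    rw [mul_sub, mul_one, ← LaurentPolynomial.T_add]
    congr 2
    ring
  have hm : LaurentPolynomial.invert D.mult =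
      LaurentPolynomial.T (-(2 * ∑ e, (D.weight e : ℤ) + ((b + δ * a) + b))) *
      ((∏ e, (1 - LaurentPolynomial.T (2 * D.weight e : ℤ)) ^ 2) *
        (1 - LaurentPolynomial.T 2) ^ ((b + δ * a) + b)) := by
    unfold FloorDiagram.mult
    rw [map_mul, map_prod, map_pow]
    simp only [map_pow, map_sub, LaurentPolynomial.invert_T, neg_neg, hw]
    rw [Finset.prod_pow, Finset.prod_mul_distrib, Finset.prod_pow]
    have : ∏ e, (LaurentPolynomial.T (-(D.weight e : ℤ)) : ℤ[T;T⁻¹]) =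
        LaurentPolynomial.T (-∑ e, (D.weight e : ℤ)) := by
      rw [← Finset.sum_neg_distrib]
      induction (Finset.univ : Finset (Fin D.numEdges)) using Finset.induction_on with
      | empty => simp
      | insert e s he ih => rw [Finset.prod_insert he, Finset.sum_insert he, ih,
          LaurentPolynomial.T_add]
    rw [this, mul_pow, mul_pow, LaurentPolynomial.T_pow, LaurentPolynomial.T_pow, mul_one, neg_add,
      LaurentPolynomial.T_add]
    push_cast
    rw [mul_neg, mul_neg_one]
    ring
  rw [hm, ← mul_assoc, ← LaurentPolynomial.T_add]
  congr 2
  push_cast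
  ring

end MarkedFloorDiagram

theorem finite_setOf_list_forall_mem {α : Type*} {A : Set α} (hA : A.Finite) (N : ℕ) :
    {l : List α | l.length = N ∧ ∀ x ∈ l, x ∈ A}.Finite := by
  have := hA.to_subtype
  refine ((List.finite_length_eq A N).image (List.map Subtype.val)).subset ?_
  rintro l ⟨h1, h2⟩
  refine ⟨l.attachWith _ h2, by simpa using h1, ?_⟩
  simp

theorem finite_setOf_isFloorWord (δ a m t b N : ℕ) :
    {W : List (ArcLetter × ℕ) | W.length = N ∧ IsFloorWord δ a m t b W}.Finite := by
  have hA : (((Set.range (Option.some : ℕ × ℕ → ArcLetter)).compl ∪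
      Option.some '' (Set.Iic (a + 1) ×ˢ Set.Iic (a + 1))) ×ˢ
      (Set.Iic (b + δ * a + 1) : Set ℕ)).Finite := by
    refine Set.Finite.prod (Set.Finite.union ?_ ?_) (Set.finite_Iic _)
    · refine (Set.finite_singleton (none : ArcLetter)).subset ?_
      intro x hx
      cases x with
      | none => rfl
      | some p => exact absurd ⟨p, rfl⟩ hx
    · exact ((Set.finite_Iic _).prod (Set.finite_Iic _)).image _
  refine (finite_setOf_list_forall_mem hA N).subset ?_
  rintro W ⟨h1, hW⟩
  refine ⟨h1, ?_⟩
  rintro ⟨_ | ⟨i, j⟩, w⟩ hl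
  · refine ⟨Or.inl ?_, ?_⟩
    · rintro ⟨p, hp⟩
      simp at hp
    · simp [hW.weight_floor w hl]
  · have hij : i < j := hW.lt hl
    have hj := (hW.le _ _ hl).1
    simp only at hj
    refine ⟨Or.inr ⟨(i, j), ⟨?_, ?_⟩, rfl⟩, ?_⟩
    · simp only [Set.mem_Iic]; omega
    · simp only [Set.mem_Iic]; omega
    · simp only [Set.mem_Iic]
      by_cases hend : i = 0 ∨ j = a + 1
      · rw [hW.weight_end _ _ hl hend]
        omega
      · have h2 := hW.flux i (by omega) (by omega)
        have h3 : (if crossesCut i (some (i, j)) then w else 0) ≤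
            (W.map fun l => if crossesCut i l.1 then l.2 else 0).sum :=
          List.single_le_sum (by simp) _ (List.mem_map.2 ⟨_, hl, rfl⟩)
        rw [h2] at h3
        simp [crossesCut, hij] at h3
        have h4 : δ * i ≤ δ * a := Nat.mul_le_mul_left _ (by omega)
        omega

theorem MarkedFloorDiagram.L_add_R {δ a b : ℕ} (D : MarkedFloorDiagram (hirzebruchPolygon δ a b)) :
    (∀ v, D.L v = 0) ∧ ∀ v, D.R v = -(δ : ℤ) := by
  refine ⟨fun v => ?_, fun v => ?_⟩
  · have h : D.L v ∈ Finset.univ.val.map D.L := Multiset.mem_map_of_mem _ (Finset.mem_univ v)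
    rw [D.map_L] at h
    exact Multiset.eq_of_mem_replicate h
  · have h : D.R v ∈ Finset.univ.val.map D.R := Multiset.mem_map_of_mem _ (Finset.mem_univ v)
    rw [D.map_R] at h
    exact Multiset.eq_of_mem_replicate h

/-- The refined series as a sum over any family of words that contains every word of a floor diagram
with non-zero contribution exactly once. -/
theorem map_refinedSeries_eq_sum {R : Type*} [CommRing R] (φ : ℤ⟦X⟧ →+* R) {δ a b : ℕ} (ha : 0 < a)
    {ι : Type*} (s : Finset ι) (Ψ : ι → List (ArcLetter × ℕ))
    (hvalid : ∀ i ∈ s, ((Ψ i).map (letterTerm a (φ PowerSeries.X))).prod ≠ 0 →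
      IsFloorWord δ a a (b + δ * a) b (Ψ i) ∧
        ∀ k, 1 ≤ k → k < a → ∃ w, (some (k, k + 1), w) ∈ Ψ i)
    (hinj : ∀ i ∈ s, ∀ j ∈ s, Ψ i = Ψ j → i = j)
    (hsurj : ∀ W, IsFloorWord δ a a (b + δ * a) b W →
      (W.map (letterTerm a (φ PowerSeries.X))).prod ≠ 0 → ∃ i ∈ s, Ψ i = W) :
    φ (refinedSeries δ 1 a b) =
      ∑ i ∈ s, ((Ψ i).map (letterTerm a (φ PowerSeries.X))).prod := by
  let Cl := {c : MarkedFloorDiagramClass (hirzebruchPolygon δ a b) // c.genus = ((1 : ℕ) : ℤ)}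
  let wd : Cl → List (ArcLetter × ℕ) := fun c => (Quotient.out c.1).word
  have hmk : ∀ c : Cl, Quotient.mk _ (Quotient.out c.1) = c.1 := fun c => Quotient.out_eq _
  have hδ : ∀ D : MarkedFloorDiagram (hirzebruchPolygon δ a b), ∀ v, D.R v + D.L v = -(δ : ℤ) :=
    fun D v => by rw [D.L_add_R.1, D.L_add_R.2, add_zero]
  have hgen : ∀ c : Cl, (Quotient.out c.1).numEdges = a := fun c => by
    have h1 : (Quotient.out c.1).genus = ((1 : ℕ) : ℤ) :=
      (congrArg MarkedFloorDiagramClass.genus (hmk c)).trans c.2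
    simp only [FloorDiagram.genus] at h1
    omega
  have hwd_valid : ∀ c : Cl, IsFloorWord δ a a (b + δ * a) b (wd c) := fun c => by
    have := (Quotient.out c.1).isFloorWord_word (hδ _)
    rwa [hgen c] at this
  have hwd_inj : Function.Injective wd := fun c c' h => by
    have h1 := MarkedFloorDiagram.nonempty_iso_of_word_eq h
      (fun v v' => by rw [MarkedFloorDiagram.L_add_R _ |>.1, MarkedFloorDiagram.L_add_R _ |>.1])
      (fun v v' => by rw [MarkedFloorDiagram.L_add_R _ |>.2, MarkedFloorDiagram.L_add_R _ |>.2])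
    have h2 := Quotient.sound (s := MarkedFloorDiagram.isoSetoid _) h1
    exact Subtype.ext ((hmk c).symm.trans (h2.trans (hmk c')))
  have hwd_surj : ∀ D : MarkedFloorDiagram (hirzebruchPolygon δ a b), D.numEdges = a →
      ∃ c : Cl, wd c = D.word := fun D hD => by
    let c : Cl := ⟨Quotient.mk _ D, by
      change D.genus = _
      simp only [FloorDiagram.genus, hD]
      omega⟩
    refine ⟨c, ?_⟩
    obtain ⟨f⟩ := Quotient.exact (s := MarkedFloorDiagram.isoSetoid _) (hmk c)
    exact MarkedFloorDiagram.word_eq_of_iso f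
  have hfin : Finite Cl := by
    have := (finite_setOf_isFloorWord δ a a (b + δ * a) b
      (a + a + (b + δ * a) + b)).to_subtype
    refine Finite.of_injective (β := {W : List (ArcLetter × ℕ) |
      W.length = a + a + (b + δ * a) + b ∧ IsFloorWord δ a a (b + δ * a) b W})
      (fun c => ⟨wd c, ?_, hwd_valid c⟩) fun c c' h => hwd_inj (congrArg Subtype.val h)
    have := (Quotient.out c.1).length_word
    rwa [hgen c] at this
  have := Fintype.ofFinite Cl
  have hser : refinedSeries δ 1 a b = ∑ c : Cl, ((wd c).map (letterTerm a PowerSeries.X)).prod := by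
    have h1 : refinedSeries δ 1 a b = (evenPart.comp ((AddMonoidHom.mulLeft
        (LaurentPolynomial.T (hirzebruchTwiceArea δ a b : ℤ))).comp
        (LaurentPolynomial.invert (R := ℤ)).toAlgHom.toRingHom.toAddMonoidHom))
        (refinedInvariant (hirzebruchPolygon δ a b) 1) := rfl
    rw [h1, refinedInvariant, finsum_eq_sum_of_fintype, map_sum]
    refine Finset.sum_congr rfl fun c _ => ?_
    rw [← (Quotient.out c.1).evenPart_mult ha (hδ _)]
    have : c.1.mult = (Quotient.out c.1).mult :=
      congrArg MarkedFloorDiagramClass.mult (hmk c).symm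
    rw [this]
    rfl
  rw [hser, map_sum]
  simp only [map_prod_letterTerm]
  symm
  have hex : ∀ i (hi : i ∈ s) (h : ((Ψ i).map (letterTerm a (φ PowerSeries.X))).prod ≠ 0),
      ∃ c : Cl, wd c = Ψ i := fun i hi h => by
    obtain ⟨D, h1, h2⟩ := exists_markedFloorDiagram ha (hvalid i hi h).1 (hvalid i hi h).2
    rw [← h2]
    exact hwd_surj D h1
  choose cl hcl using hex
  refine Finset.sum_bij_ne_zero cl (fun _ _ _ => Finset.mem_univ _) ?_ ?_ ?_
  · intro i hi h j hj h' hij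
    exact hinj i hi j hj (by rw [← hcl i hi h, ← hcl j hj h', hij])
  · intro c _ hc
    obtain ⟨i, hi, hic⟩ := hsurj (wd c) (hwd_valid c) hc
    have h : ((Ψ i).map (letterTerm a (φ PowerSeries.X))).prod ≠ 0 := by rwa [hic]
    exact ⟨i, hi, h, hwd_inj ((hcl i hi h).trans hic)⟩
  · intro i hi h
    rw [hcl]

/-- The complete homogeneous symmetric polynomial of degree `b` evaluated at the entries of a list. -/
def completeHom {R : Type*} [CommRing R] : ℕ → List R → R
  | 0, _ => 1
  | _ + 1, [] => 0
  | b + 1, u :: us => u * completeHom b (u :: us) + completeHom (b + 1) us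
termination_by b us => b + us.length

section completeHom

variable {R : Type*} [CommRing R]

@[simp] theorem completeHom_zero (us : List R) : completeHom 0 us = 1 := by
  rw [completeHom]

@[simp] theorem completeHom_succ_nil (b : ℕ) : completeHom (b + 1) ([] : List R) = 0 := by
  rw [completeHom]

theorem completeHom_succ_cons (b : ℕ) (u : R) (us : List R) :
    completeHom (b + 1) (u :: us) = u * completeHom b (u :: us) + completeHom (b + 1) us := by
  rw [completeHom]

theorem completeHom_swap (b : ℕ) (u v : R) (us : List R) :
    completeHom b (u :: v :: us) = completeHom b (v :: u :: us) := by
  induction b using Nat.strong_induction_on with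
  | _ b ih =>
    rcases b with _ | _ | b
    · simp
    · simp only [completeHom_succ_cons, completeHom_zero, zero_add]
      ring
    · have h1 := completeHom_succ_cons (b + 1) u (v :: us)
      have h2 := completeHom_succ_cons (b + 1) v us
      have h3 := completeHom_succ_cons (b + 1) v (u :: us)
      have h4 := completeHom_succ_cons (b + 1) u us
      have h5 := completeHom_succ_cons b u (v :: us)
      have h6 := completeHom_succ_cons b v (u :: us)
      have i1 := ih b (by omega)
      have i2 := ih (b + 1) (by omega)
      linear_combination h1 + h2 - h3 - h4 + u * i2 + u * h6 - v * h5 + v * i2 - u * v * i1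

theorem completeHom_perm {us vs : List R} (h : us.Perm vs) (b : ℕ) :
    completeHom b us = completeHom b vs := by
  induction h generalizing b with
  | nil => rfl
  | cons u _ ih =>
    induction b with
    | zero => simp
    | succ b ihb => rw [completeHom_succ_cons, completeHom_succ_cons, ihb, ih]
  | swap u v us => exact completeHom_swap b v u us
  | trans _ _ h1 h2 => rw [h1, h2]

theorem pow_dvd_completeHom {x : R} {us : List R} (h : ∀ u ∈ us, x ∣ u) (b : ℕ) :
    x ^ b ∣ completeHom b us := by
  induction us generalizing b with
  | nil => cases b <;> simp
  | cons u us ih =>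
    induction b with
    | zero => simp
    | succ b ihb =>
      rw [completeHom_succ_cons, pow_succ']
      exact dvd_add (mul_dvd_mul (h u (by simp)) ihb)
        (by rw [← pow_succ']; exact ih (fun v hv => h v (by simp [hv])) _)

theorem completeHom_cons_eq_sum (b : ℕ) (u : R) (us : List R) :
    completeHom b (u :: us) = ∑ m ∈ Finset.range (b + 1), u ^ (b - m) * completeHom m us := by
  induction b with
  | zero => simp
  | succ b ih =>
    rw [completeHom_succ_cons, ih, Finset.sum_range_succ _ (b + 1), Finset.mul_sum]
    congr 1
    · refine Finset.sum_congr rfl fun m hm => ?_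
      rw [Nat.succ_sub (Nat.lt_succ_iff.1 (Finset.mem_range.1 hm)), pow_succ']
      ring
    · simp

theorem prod_mul_sum_completeHom {x z : R} {n : ℕ} (hn : 0 < n) (hx : x ^ n = 0) (us : List R)
    (h : ∀ u ∈ us, x ∣ u) :
    (us.map fun u => 1 - z * u).prod * ∑ m ∈ Finset.range n, z ^ m * completeHom m us = 1 := by
  induction us with
  | nil =>
    obtain ⟨n, rfl⟩ := Nat.exists_eq_succ_of_ne_zero hn.ne'
    rw [Finset.sum_range_succ']
    simp
  | cons u us ih =>
    have key : (1 - z * u) * ∑ m ∈ Finset.range n, z ^ m * completeHom m (u :: us) =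
        ∑ m ∈ Finset.range n, z ^ m * completeHom m us := by
      obtain ⟨n, rfl⟩ := Nat.exists_eq_succ_of_ne_zero hn.ne'
      have h0 : u * completeHom n (u :: us) = 0 := by
        have : x ^ (n + 1) ∣ u * completeHom n (u :: us) := by
          rw [pow_succ']
          exact mul_dvd_mul (h u (by simp)) (pow_dvd_completeHom h n)
        rw [hx] at this
        exact zero_dvd_iff.1 this
      have e1 : ∑ m ∈ Finset.range (n + 1), z ^ m * completeHom m (u :: us) =
          z * u * ∑ m ∈ Finset.range n, z ^ m * completeHom m (u :: us) +
            ∑ m ∈ Finset.range (n + 1), z ^ m * completeHom m us := by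
        rw [Finset.sum_range_succ', Finset.sum_range_succ' _ n, Finset.mul_sum, ← add_assoc,
          ← Finset.sum_add_distrib]
        simp only [completeHom_succ_cons, completeHom_zero]
        congr 1
        refine Finset.sum_congr rfl fun m _ => ?_
        ring
      rw [sub_mul, one_mul]
      rw [Finset.sum_range_succ (fun m => z ^ m * completeHom m (u :: us))] at e1 ⊢
      linear_combination e1 - z ^ (n + 1) * h0
    rw [List.map_cons, List.prod_cons]
    linear_combination (us.map fun u => 1 - z * u).prod * key +
      ih fun v hv => h v (List.mem_cons_of_mem _ hv)

theorem completeHom_cons_mul_prod {x u z : R} {n b : ℕ} (hn : 0 < n) (hx : x ^ n = 0) (hb : n ≤ b)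
    (huz : u * z = 1) (us : List R) (h : ∀ v ∈ us, x ∣ v) :
    completeHom b (u :: us) * (us.map fun v => 1 - z * v).prod = u ^ b := by
  have e : completeHom b (u :: us) = u ^ b * ∑ m ∈ Finset.range n, z ^ m * completeHom m us := by
    rw [completeHom_cons_eq_sum, Finset.mul_sum]
    symm
    refine Finset.sum_subset_zero_on_sdiff (Finset.range_subset_range.2 (by omega)) ?_ ?_
    · intro m hm
      have hm' : n ≤ m := by
        simpa using (Finset.mem_sdiff.1 hm).2
      have : x ^ n ∣ completeHom m us := (pow_dvd_pow x hm').trans (pow_dvd_completeHom h m)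
      rw [hx] at this
      rw [zero_dvd_iff.1 this, mul_zero]
    · intro m hm
      have hm' : m ≤ b := by
        have := Finset.mem_range.1 hm
        omega
      have : u ^ b * z ^ m = u ^ (b - m) := by
        conv_lhs => rw [← Nat.sub_add_cancel hm', pow_add, mul_assoc, ← mul_pow, huz, one_pow,
          mul_one]
      rw [← mul_assoc, this]
  rw [e, mul_assoc, mul_comm (∑ _ ∈ _, _), prod_mul_sum_completeHom hn hx us h, mul_one]

end completeHom

/-- Floors and bounded edges separate the slots in which the ends of a word lie. -/
def isSepLetter (a : ℕ) (l : ArcLetter) : Bool := isFloorLetter l || isBoundedLetter a l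

def floorCount (l : ArcLetter) : ℕ := if isFloorLetter l then 1 else 0

/-- If `g` floors precede `S`, every end in `S` is attached to a floor on the correct side. -/
def EndsPlaced (a : ℕ) : ℕ → List ArcLetter → Prop
  | _, [] => True
  | g, none :: S => EndsPlaced a (g + 1) S
  | g, some p :: S => (p.1 = 0 → g < p.2 ∧ p.2 ≤ a) ∧ (p.2 = a + 1 → 1 ≤ p.1 ∧ p.1 ≤ g) ∧
      EndsPlaced a g S

/-- The words of length `N` with `b` sources and `t` sinks whose separators form the list `T`,
if `g` floors precede. -/
def fillings (a : ℕ) : ℕ → List ArcLetter → ℕ → ℕ → ℕ → Finset (List ArcLetter)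
  | 0, T, _, b, t => if T = [] ∧ b = 0 ∧ t = 0 then {[]} else ∅
  | N + 1, T, g, b, t =>
    (match T with
      | [] => ∅
      | s :: T' => (fillings a N T' (g + floorCount s) b t).image fun S => s :: S) ∪
    ((if b = 0 then ∅ else (Finset.Ioc g a ×ˢ fillings a N T g (b - 1) t).image
      fun p => some (0, p.1) :: p.2) ∪
    (if t = 0 then ∅ else (Finset.Icc 1 g ×ˢ fillings a N T g b (t - 1)).image
      fun p => some (p.1, a + 1) :: p.2))

theorem mem_fillings {a N : ℕ} {T : List ArcLetter} (hT : ∀ s ∈ T, isSepLetter a s) {g b t : ℕ}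
    {S : List ArcLetter} : S ∈ fillings a N T g b t ↔
      S.length = N ∧ S.filter (isSepLetter a) = T ∧ S.countP isSourceLetter = b ∧
        S.countP (isSinkLetter a) = t ∧ EndsPlaced a g S := by
  induction N generalizing T g b t S with
  | zero =>
    simp only [fillings]
    constructor
    · intro h
      split_ifs at h with h1
      · obtain ⟨rfl, rfl, rfl⟩ := h1
        simp only [Finset.mem_singleton] at h
        subst h
        simp [EndsPlaced]
      · simp at h
    · rintro ⟨h1, h2, h3, h4, -⟩
      rw [List.length_eq_zero_iff] at h1
      subst h1
      simp only [List.filter_nil, List.countP_nil] at h2 h3 h4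
      simp [← h2, ← h3, ← h4]
  | succ N ih =>
    have hsrc : ∀ j, isSepLetter a (some (0, j)) = false := fun j => by
      simp [isSepLetter, isFloorLetter, isBoundedLetter]
    have hsnk : ∀ i, isSepLetter a (some (i, a + 1)) = false := fun j => by
      simp [isSepLetter, isFloorLetter, isBoundedLetter]
    simp only [fillings, Finset.mem_union]
    constructor
    · rintro (h | h | h)
      · cases T with
        | nil => simp at h
        | cons s T' =>
          simp only [Finset.mem_image] at h
          obtain ⟨S', hS', rfl⟩ := h
          rw [ih fun x hx => hT x (List.mem_cons_of_mem _ hx)] at hS'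
          obtain ⟨h1, h2, h3, h4, h5⟩ := hS'
          have hs := hT s List.mem_cons_self
          refine ⟨by simp [h1], by simp [hs, h2], ?_, ?_, ?_⟩
          · rw [List.countP_cons, h3]
            rcases s with _ | p
            · simp [isSourceLetter]
            · simp [isSepLetter, isFloorLetter, isBoundedLetter] at hs
              simp [isSourceLetter, hs]
          · rw [List.countP_cons, h4]
            rcases s with _ | p
            · simp [isSinkLetter]
            · simp [isSepLetter, isFloorLetter, isBoundedLetter] at hs
              simp [isSinkLetter, hs]
          · rcases s with _ | p
            · simpa [EndsPlaced, floorCount, isFloorLetter] using h5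
            · simp [isSepLetter, isFloorLetter, isBoundedLetter] at hs
              simpa [EndsPlaced, floorCount, isFloorLetter, hs] using h5
      · split_ifs at h with hb
        · simp at h
        · simp only [Finset.mem_image, Finset.mem_product, Finset.mem_Ioc, Prod.exists] at h
          obtain ⟨j, S', ⟨hj, hS'⟩, rfl⟩ := h
          obtain ⟨h1, h2, h3, h4, h5⟩ := (ih hT).1 hS'
          refine ⟨by simp [h1], by simp [hsrc, h2], ?_, ?_, ?_⟩
          · simp [isSourceLetter, h3]; omega
          · have : j ≠ a + 1 := by omega
            simp [isSinkLetter, h4, this]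
          · refine ⟨fun _ => hj, fun h => ?_, h5⟩
            simp only at h
            omega
      · split_ifs at h with hb
        · simp at h
        · simp only [Finset.mem_image, Finset.mem_product, Finset.mem_Icc, Prod.exists] at h
          obtain ⟨i, S', ⟨hi, hS'⟩, rfl⟩ := h
          obtain ⟨h1, h2, h3, h4, h5⟩ := (ih hT).1 hS'
          refine ⟨by simp [h1], by simp [hsnk, h2], ?_, ?_, ?_⟩
          · have : i ≠ 0 := by omega
            simp [isSourceLetter, h3, this]
          · simp [isSinkLetter, h4]; omega
          · refine ⟨fun h => ?_, fun _ => hi, h5⟩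
            simp only at h
            omega
    · rintro ⟨h1, h2, h3, h4, h5⟩
      obtain _ | ⟨l, S⟩ := S
      · simp at h1
      simp only [List.length_cons, Nat.add_right_cancel_iff] at h1
      by_cases hl : isSepLetter a l
      · left
        rw [List.filter_cons, if_pos hl] at h2
        subst h2
        simp only [Finset.mem_image]
        refine ⟨S, ?_, rfl⟩
        rw [ih fun x hx => hT x (List.mem_cons_of_mem _ hx)]
        rw [List.countP_cons] at h3 h4
        refine ⟨h1, rfl, ?_, ?_, ?_⟩
        · rcases l with _ | p
          · simpa [isSourceLetter] using h3
          · simp [isSepLetter, isFloorLetter, isBoundedLetter] at hl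
            simpa [isSourceLetter, hl] using h3
        · rcases l with _ | p
          · simpa [isSinkLetter] using h4
          · simp [isSepLetter, isFloorLetter, isBoundedLetter] at hl
            simpa [isSinkLetter, hl] using h4
        · rcases l with _ | p
          · simpa [EndsPlaced, floorCount, isFloorLetter] using h5
          · simpa [floorCount, isFloorLetter] using h5.2.2
      · right
        rw [List.filter_cons, if_neg hl] at h2
        rcases l with _ | ⟨i, j⟩
        · simp [isSepLetter, isFloorLetter] at hl
        obtain ⟨h6, h7, h8⟩ := h5
        simp only at h6 h7
        simp [isSepLetter, isFloorLetter, isBoundedLetter] at hl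
        rw [List.countP_cons] at h3 h4
        simp only [isSourceLetter, isSinkLetter, decide_eq_true_eq] at h3 h4
        by_cases hi : i = 0
        · left
          subst hi
          have h6 := h6 rfl
          have hj : j ≠ a + 1 := by omega
          simp only [if_true, hj, if_false, add_zero] at h3 h4
          rw [if_neg (by omega)]
          simp only [Finset.mem_image, Finset.mem_product, Finset.mem_Ioc, Prod.exists]
          exact ⟨j, S, ⟨h6, (ih hT).2 ⟨h1, h2, by omega, h4, h8⟩⟩, rfl⟩
        · right
          have hj := hl hi
          subst hj
          simp only [if_true, hi, if_false, add_zero] at h3 h4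
          rw [if_neg (by omega)]
          simp only [Finset.mem_image, Finset.mem_product, Finset.mem_Icc, Prod.exists]
          exact ⟨i, S, ⟨h7 rfl, (ih hT).2 ⟨h1, h2, h3, by omega, h8⟩⟩, rfl⟩

/-- The number of floors in front of each of the slots between the separators. -/
def slotGaps : ℕ → List ArcLetter → List ℕ
  | g, [] => [g]
  | g, s :: T => g :: slotGaps (g + floorCount s) T

theorem sum_fillings {R : Type*} [CommRing R] (a : ℕ) (φ : ArcLetter → R) {u v : ℕ → R}
    (hφ : ∀ s, isSepLetter a s → φ s = 1) (hu : ∀ g, ∑ j ∈ Finset.Ioc g a, φ (some (0, j)) = u g)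
    (hv : ∀ g ≤ a, ∑ i ∈ Finset.Icc 1 g, φ (some (i, a + 1)) = v g) (huv : ∀ g ≤ a, u g * v g = 0)
    {N : ℕ} {T : List ArcLetter} (hT : ∀ s ∈ T, isSepLetter a s) {g b t : ℕ}
    (hg : g + T.countP isFloorLetter ≤ a) (hN : N = T.length + b + t) :
    ∑ S ∈ fillings a N T g b t, (S.map φ).prod =
      completeHom b ((slotGaps g T).map u) * completeHom t ((slotGaps g T).map v) := by
  induction N generalizing T g b t with
  | zero =>
    obtain ⟨rfl, rfl, rfl⟩ : T = [] ∧ b = 0 ∧ t = 0 := by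
      rw [← List.length_eq_zero_iff]
      omega
    simp [fillings]
  | succ N ih =>
    have hga : g ≤ a := le_trans (Nat.le_add_right _ _) hg
    have hslot : ∃ us, slotGaps g T = g :: us := by
      cases T with
      | nil => exact ⟨_, rfl⟩
      | cons s T => exact ⟨_, rfl⟩
    obtain ⟨us, hus⟩ := hslot
    have hsrc : ∀ j, isSepLetter a (some (0, j)) = false := fun j => by
      simp [isSepLetter, isFloorLetter, isBoundedLetter]
    have hsnk : ∀ i, isSepLetter a (some (i, a + 1)) = false := fun j => by
      simp [isSepLetter, isFloorLetter, isBoundedLetter]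
    rw [fillings.eq_def]
    dsimp only
    rw [Finset.sum_union, Finset.sum_union]
    · have hB : ∑ S ∈ (if b = 0 then ∅ else (Finset.Ioc g a ×ˢ fillings a N T g (b - 1) t).image
          fun p => some (0, p.1) :: p.2), (S.map φ).prod =
          (if b = 0 then 0 else u g * completeHom (b - 1) (u g :: us.map u)) *
            completeHom t (v g :: us.map v) := by
        split_ifs with hb
        · simp
        · rw [Finset.sum_image]
          · simp only [List.map_cons, List.prod_cons]
            rw [Finset.sum_product' (f := fun j S => φ (some (0, j)) * (List.map φ S).prod)]
            simp only [← Finset.mul_sum]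
            rw [← Finset.sum_mul, hu, ih hT hg (by omega), hus, List.map_cons, List.map_cons,
              mul_assoc]
          · rintro ⟨j, S⟩ _ ⟨j', S'⟩ _ h
            simpa using h
      have hC : ∑ S ∈ (if t = 0 then ∅ else (Finset.Icc 1 g ×ˢ fillings a N T g b (t - 1)).image
          fun p => some (p.1, a + 1) :: p.2), (S.map φ).prod =
          completeHom b (u g :: us.map u) *
            (if t = 0 then 0 else v g * completeHom (t - 1) (v g :: us.map v)) := by
        split_ifs with hb
        · simp
        · rw [Finset.sum_image]
          · simp only [List.map_cons, List.prod_cons]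
            rw [Finset.sum_product' (f := fun j S => φ (some (j, a + 1)) * (List.map φ S).prod)]
            simp only [← Finset.mul_sum]
            rw [← Finset.sum_mul, hv g hga, ih hT hg (by omega), hus, List.map_cons, List.map_cons]
            ring
          · rintro ⟨j, S⟩ _ ⟨j', S'⟩ _ h
            simpa using h
      have hA : ∑ S ∈ (match T with
          | [] => (∅ : Finset (List ArcLetter))
          | s :: T' => (fillings a N T' (g + floorCount s) b t).image fun S => s :: S),
          (S.map φ).prod = completeHom b (us.map u) * completeHom t (us.map v) := by
        cases T with
        | nil =>
          simp only [slotGaps, List.cons.injEq, true_and] at hus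
          subst hus
          simp only [Finset.sum_empty, List.map_nil]
          simp only [List.length_nil] at hN
          cases b with
          | zero => cases t with
            | zero => omega
            | succ t => simp
          | succ b => simp
        | cons s T =>
          simp only [slotGaps, List.cons.injEq, true_and] at hus
          rw [Finset.sum_image (by simp)]
          simp only [List.map_cons, List.prod_cons, hφ s (hT s List.mem_cons_self), one_mul]
          rw [ih (fun x hx => hT x (List.mem_cons_of_mem _ hx)) ?_ ?_, hus]
          · rw [List.countP_cons] at hg
            simp only [floorCount]
            omega
          · simp only [List.length_cons] at hN
            omega
      rw [hA, hB, hC, hus, List.map_cons, List.map_cons]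
      have e : ∀ (b : ℕ) (y : R) (ys : List R), completeHom b (y :: ys) =
          (if b = 0 then 0 else y * completeHom (b - 1) (y :: ys)) + completeHom b ys := by
        intro b y ys
        cases b with
        | zero => simp
        | succ b => rw [completeHom_succ_cons]; simp
      have e0 : (if b = 0 then 0 else u g * completeHom (b - 1) (u g :: us.map u)) *
          (if t = 0 then 0 else v g * completeHom (t - 1) (v g :: us.map v)) = 0 := by
        split_ifs
        · simp
        · simp
        · simp
        · linear_combination completeHom (b - 1) (u g :: us.map u) *
            completeHom (t - 1) (v g :: us.map v) * huv g hga
      have e1 := e b (u g) (us.map u)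
      have e2 := e t (v g) (us.map v)
      set A := if b = 0 then 0 else u g * completeHom (b - 1) (u g :: us.map u)
      set A' := if t = 0 then 0 else v g * completeHom (t - 1) (v g :: us.map v)
      rw [e1, e2]
      linear_combination e0
    · rw [Finset.disjoint_left]
      intro S h1 h2
      split_ifs at h1 h2 <;> simp at h1 h2
      obtain ⟨j, S1, ⟨hj, _⟩, rfl⟩ := h1
      obtain ⟨i, S2, ⟨hi, _⟩, h⟩ := h2
      simp at h
      omega
    · rw [Finset.disjoint_left]
      intro S h1 h2
      cases T with
      | nil => simp at h1
      | cons s T =>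
        simp only [Finset.mem_image] at h1
        obtain ⟨S1, _, rfl⟩ := h1
        have hs := hT s List.mem_cons_self
        rw [Finset.mem_union] at h2
        rcases h2 with h2 | h2
        · split_ifs at h2
          · simp at h2
          · obtain ⟨p, _, h⟩ := Finset.mem_image.1 h2
            simp only [List.cons.injEq] at h
            rw [← h.1, hsrc] at hs
            simp at hs
        · split_ifs at h2
          · simp at h2
          · obtain ⟨p, _, h⟩ := Finset.mem_image.1 h2
            simp only [List.cons.injEq] at h
            rw [← h.1, hsnk] at hs
            simp at hs

/-- The separators `none, (k, k+1), none, …, (k+m-1, k+m), none` of a chain of `m + 1` floors. -/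
def chainSeps : ℕ → ℕ → List ArcLetter
  | _, 0 => [none]
  | k, m + 1 => none :: some (k, k + 1) :: chainSeps (k + 1) m

theorem length_chainSeps (k m : ℕ) : (chainSeps k m).length = 2 * m + 1 := by
  induction m generalizing k with
  | zero => rfl
  | succ m ih => simp [chainSeps, ih]; ring

@[to_additive]
theorem prod_map_chainSeps {M : Type*} [CommMonoid M] (h : ArcLetter → M) (k m : ℕ) :
    ((chainSeps k m).map h).prod =
      h none ^ (m + 1) * ∏ r ∈ Finset.Ico k (k + m), h (some (r, r + 1)) := by
  induction m generalizing k with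
  | zero => simp [chainSeps]
  | succ m ih =>
    simp only [chainSeps, List.map_cons, List.prod_cons]
    rw [ih, Finset.prod_eq_prod_Ico_succ_bot (by omega : k < k + (m + 1)), pow_succ _ (m + 1),
      show k + 1 + m = k + (m + 1) by ring]
    rw [mul_comm (h none ^ (m + 1)) (h none)]
    simp only [mul_assoc, mul_left_comm]

theorem mem_take_chainSeps {k m p : ℕ} {q : ℕ × ℕ} :
    some q ∈ (chainSeps k m).take p ↔ ∃ r < m, 2 * r + 1 < p ∧ q = (k + r, k + r + 1) := by
  induction m generalizing k p with
  | zero =>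
    rcases p with _ | p <;> simp [chainSeps]
  | succ m ih =>
    rcases p with _ | _ | p
    · simp
    · simp [chainSeps]
    · simp only [chainSeps, List.take_succ_cons, List.mem_cons, reduceCtorEq, Option.some.injEq,
        false_or, ih]
      constructor
      · rintro (rfl | ⟨r, h1, h2, rfl⟩)
        · exact ⟨0, by omega, by omega, rfl⟩
        · exact ⟨r + 1, by omega, by omega, by
            rw [show k + 1 + r = k + (r + 1) by ring]⟩
      · rintro ⟨_ | r, h1, h2, rfl⟩
        · exact Or.inl rfl
        · exact Or.inr ⟨r, by omega, by omega, by
            rw [show k + 1 + r = k + (r + 1) by ring]⟩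

theorem mem_chainSeps {k m : ℕ} {q : ℕ × ℕ} :
    some q ∈ chainSeps k m ↔ ∃ r < m, q = (k + r, k + r + 1) := by
  rw [← List.take_length (l := chainSeps k m), mem_take_chainSeps, length_chainSeps]
  constructor
  · rintro ⟨r, h1, -, h2⟩
    exact ⟨r, h1, h2⟩
  · rintro ⟨r, h1, h2⟩
    exact ⟨r, h1, by omega, h2⟩

theorem countP_take_chainSeps {k m p : ℕ} (hp : p ≤ 2 * m + 1) :
    ((chainSeps k m).take p).countP isFloorLetter = (p + 1) / 2 := by
  induction m generalizing k p with
  | zero =>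
    rcases p with _ | _ | p
    · simp
    · simp [chainSeps, isFloorLetter]
    · omega
  | succ m ih =>
    rcases p with _ | _ | p
    · simp
    · simp [chainSeps, isFloorLetter]
    · simp only [chainSeps, List.take_succ_cons, List.countP_cons, isFloorLetter]
      rw [ih (by omega)]
      simp
      omega

theorem countP_floor_chainSeps (k m : ℕ) : (chainSeps k m).countP isFloorLetter = m + 1 := by
  have := countP_take_chainSeps (k := k) (m := m) (p := 2 * m + 1) le_rfl
  rw [List.take_of_length_le (length_chainSeps k m).le] at this
  rw [this]
  omega

theorem isPlaced_chainSeps (g m : ℕ) : IsPlaced g (chainSeps (g + 1) m) := by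
  induction m generalizing g with
  | zero => simp [chainSeps, IsPlaced]
  | succ m ih => exact ⟨⟨le_rfl, by simp⟩, ih _⟩

theorem isPlaced_append_cons {g : ℕ} {A B : List ArcLetter} {q : ℕ × ℕ} :
    IsPlaced g (A ++ some q :: B) ↔ IsPlaced g (A ++ B) ∧
      q.1 ≤ g + A.countP isFloorLetter ∧ g + A.countP isFloorLetter < q.2 := by
  induction A generalizing g with
  | nil => simp [IsPlaced, and_comm]
  | cons l A ih =>
    rcases l with _ | p
    · simp only [List.cons_append, IsPlaced, ih, List.countP_cons, isFloorLetter, if_true]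
      rw [show g + 1 + A.countP isFloorLetter = g + (A.countP isFloorLetter + 1) by ring]
    · simp [IsPlaced, ih, isFloorLetter, and_assoc]

theorem IsPlaced.lt_of_mem {g : ℕ} {S : List ArcLetter} (h : IsPlaced g S) {q : ℕ × ℕ}
    (hq : some q ∈ S) : g < q.2 ∧ q.1 < q.2 := by
  obtain ⟨r, hr, hp⟩ := List.mem_iff_getElem.1 hq
  have := (isPlaced_iff_forall_getElem _ _).1 h r hr q hp
  omega

theorem slotGaps_append_cons (g : ℕ) (A B : List ArcLetter) (q : ℕ × ℕ) :
    (slotGaps g (A ++ some q :: B)).Perm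
      ((g + A.countP isFloorLetter) :: slotGaps g (A ++ B)) := by
  induction A generalizing g with
  | nil => simp [slotGaps, floorCount, isFloorLetter]
  | cons l A ih =>
    simp only [List.cons_append, slotGaps]
    refine ((ih _).cons g).trans ((List.Perm.swap _ _ _).trans ?_)
    rw [List.countP_cons, floorCount, add_assoc,
      add_comm (A.countP isFloorLetter)]

theorem coe_slotGaps_chainSeps (g k m : ℕ) : (slotGaps g (chainSeps k m) : Multiset ℕ) =
    g ::ₘ (g + m + 1) ::ₘ ((Finset.Ico (g + 1) (g + 1 + m)).val +
      (Finset.Ico (g + 1) (g + 1 + m)).val) := by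
  induction m generalizing g k with
  | zero => simp [chainSeps, slotGaps, floorCount, isFloorLetter]; rfl
  | succ m ih =>
    have h1 : (Finset.Ico (g + 1) (g + 1 + (m + 1))).val =
        (g + 1) ::ₘ (Finset.Ico (g + 1 + 1) (g + 1 + 1 + m)).val := by
      rw [← Finset.insert_Ico_add_one_left_eq_Ico (by omega : g + 1 < g + 1 + (m + 1)),
        Finset.insert_val_of_notMem (by simp)]
      congr 3
      ring
    simp only [chainSeps, slotGaps, floorCount, isFloorLetter, if_true, Bool.false_eq_true, if_false,
      add_zero]
    rw [← Multiset.cons_coe, ← Multiset.cons_coe, ih, h1, show g + 1 + m + 1 = g + (m + 1) + 1 by ring]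
    simp only [Multiset.cons_add, Multiset.add_cons]
    congr 1
    rw [Multiset.cons_swap (g + 1) (g + (m + 1) + 1), Multiset.cons_swap (g + 1) (g + (m + 1) + 1)]

theorem eq_chainSeps {g m : ℕ} {U : List ArcLetter} (hp : IsPlaced g U)
    (hf : U.countP isFloorLetter = m + 1)
    (harcs : ((U.filter fun l => !isFloorLetter l : List ArcLetter) : Multiset ArcLetter) =
      (Finset.Ico (g + 1) (g + 1 + m)).val.map fun k => some (k, k + 1)) :
    U = chainSeps (g + 1) m := by
  have hmem : ∀ {g m : ℕ} {U : List ArcLetter}, ((U.filter fun l => !isFloorLetter l :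
      List ArcLetter) : Multiset ArcLetter) =
      ((Finset.Ico (g + 1) (g + 1 + m)).val.map fun k => some (k, k + 1)) → ∀ q,
      some q ∈ U ↔ ∃ k, g + 1 ≤ k ∧ k < g + 1 + m ∧ q = (k, k + 1) := by
    intro g m U h q
    have h1 : some q ∈ ((U.filter fun l => !isFloorLetter l : List ArcLetter) :
        Multiset ArcLetter) ↔ some q ∈ U := by
      simp [isFloorLetter]
    rw [← h1, h, Multiset.mem_map]
    simp [and_assoc, eq_comm]
  induction m generalizing g U with
  | zero =>
    have hm := hmem harcs
    obtain _ | ⟨_ | q, U⟩ := U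
    · simp at hf
    · obtain _ | ⟨_ | q, U⟩ := U
      · rfl
      · simp [List.countP_cons, isFloorLetter] at hf
      · obtain ⟨k, _, _, _⟩ := (hm q).1 (by simp)
        omega
    · obtain ⟨k, _, _, _⟩ := (hm q).1 (by simp)
      omega
  | succ m ih =>
    have hm := hmem harcs
    obtain _ | ⟨_ | q, U⟩ := U
    · simp at hf
    · have hfirst : some (g + 1, g + 1 + 1) ∈ U := by
        simpa using (hm (g + 1, g + 1 + 1)).2 ⟨g + 1, le_rfl, by omega, rfl⟩
      obtain _ | ⟨_ | q, U⟩ := U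
      · simp at hfirst
      · have := (IsPlaced.lt_of_mem (g := g + 2) hp (q := (g + 1, g + 1 + 1))
          (by simpa using hfirst)).1
        simp only at this
        omega
      · obtain ⟨k, h1, h2, rfl⟩ := (hm q).1 (by simp)
        obtain ⟨⟨h3, h4⟩, h5⟩ := hp
        simp only at h3 h4
        obtain rfl : k = g + 1 := by omega
        rw [chainSeps, ih (g := g + 1) h5]
        · simpa [List.countP_cons, isFloorLetter] using hf
        · have e : (Finset.Ico (g + 1) (g + 1 + (m + 1))).val =
              (g + 1) ::ₘ (Finset.Ico (g + 1 + 1) (g + 1 + 1 + m)).val := by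
            rw [← Finset.insert_Ico_add_one_left_eq_Ico (by omega : g + 1 < g + 1 + (m + 1)),
              Finset.insert_val_of_notMem (by simp)]
            congr 3
            ring
          rw [e, Multiset.map_cons] at harcs
          change ((some (g + 1, g + 1 + 1) :: U.filter (fun l => !isFloorLetter l) :
            List ArcLetter) : Multiset ArcLetter) = _ at harcs
          rw [← Multiset.cons_coe] at harcs
          exact (Multiset.cons_inj_right _).1 harcs
    · obtain ⟨k, h1, h2, rfl⟩ := (hm q).1 (by simp)
      have := hp.1.1
      simp only at this
      omega

/-- The separators of a chain of `a` floors with one additional edge `e` at position `p`. -/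
def sepsWith (a : ℕ) (e : ℕ × ℕ) (p : ℕ) : List ArcLetter :=
  (chainSeps 1 (a - 1)).take p ++ some e :: (chainSeps 1 (a - 1)).drop p

/-- The positions at which the additional edge can be inserted; an edge parallel to an edge of the
chain is inserted before it. -/
def insertPositions (e : ℕ × ℕ) : Finset ℕ :=
  if e.2 = e.1 + 1 then {2 * e.1 - 1} else Finset.Ico (2 * e.1 - 1) (2 * e.2 - 1)

/-- The possible additional edges. -/
def extraEdges (a : ℕ) : Finset (ℕ × ℕ) :=
  (Finset.Icc 1 a ×ˢ Finset.Icc 1 a).filter fun e => e.1 < e.2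

theorem mem_extraEdges {a : ℕ} {e : ℕ × ℕ} :
    e ∈ extraEdges a ↔ 1 ≤ e.1 ∧ e.1 < e.2 ∧ e.2 ≤ a := by
  simp [extraEdges]
  omega

theorem gap_of_mem_insertPositions {a : ℕ} {e : ℕ × ℕ} (he : e ∈ extraEdges a) {p : ℕ}
    (hp : p ∈ insertPositions e) : e.1 ≤ (p + 1) / 2 ∧ (p + 1) / 2 < e.2 ∧ p ≤ 2 * (a - 1) + 1 := by
  rw [mem_extraEdges] at he
  unfold insertPositions at hp
  split_ifs at hp with h
  · rw [Finset.mem_singleton] at hp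
    omega
  · rw [Finset.mem_Ico] at hp
    omega

theorem notMem_take_of_mem_insertPositions {a : ℕ} {e : ℕ × ℕ} (he : e ∈ extraEdges a) {p : ℕ}
    (hp : p ∈ insertPositions e) : some e ∉ (chainSeps 1 (a - 1)).take p := by
  rw [mem_extraEdges] at he
  rw [mem_take_chainSeps]
  rintro ⟨r, h1, h2, rfl⟩
  simp only [insertPositions, if_true, Finset.mem_singleton] at hp
  omega

theorem sepsWith_perm (a : ℕ) (e : ℕ × ℕ) (p : ℕ) :
    (sepsWith a e p).Perm (some e :: chainSeps 1 (a - 1)) := by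
  unfold sepsWith
  refine List.perm_middle.trans ?_
  rw [List.take_append_drop]

theorem sepsWith_injective {a : ℕ} {e e' : ℕ × ℕ} {p p' : ℕ} (he : e ∈ extraEdges a)
    (he' : e' ∈ extraEdges a) (hp : p ∈ insertPositions e) (hp' : p' ∈ insertPositions e')
    (h : sepsWith a e p = sepsWith a e' p') : e = e' ∧ p = p' := by
  have hperm := (sepsWith_perm a e p).symm.trans (h ▸ sepsWith_perm a e' p')
  have hee : e = e' := by
    have := Multiset.coe_eq_coe.2 hperm
    rw [← Multiset.cons_coe, ← Multiset.cons_coe, Multiset.cons_inj_left] at this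
    simpa using this
  subst hee
  refine ⟨rfl, ?_⟩
  have hidx : ∀ {p}, p ∈ insertPositions e → (sepsWith a e p).idxOf (some e) = p := by
    intro p hp
    rw [sepsWith, List.idxOf_append_of_notMem (notMem_take_of_mem_insertPositions he hp)]
    have := (gap_of_mem_insertPositions he hp).2.2
    simp [length_chainSeps]
    omega
  rw [← hidx hp, h, hidx hp']

theorem exists_eq_sepsWith {a : ℕ} (ha : 0 < a) {T : List ArcLetter}
    (hsep : ∀ s ∈ T, isSepLetter a s) (hle : ∀ q, some q ∈ T → q.2 ≤ a + 1)
    (hp : IsPlaced 0 T) (hf : T.countP isFloorLetter = a)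
    (hb : T.countP (isBoundedLetter a) = a)
    (hchain : ∀ k, 1 ≤ k → k < a → some (k, k + 1) ∈ T) :
    ∃ e ∈ extraEdges a, ∃ p ∈ insertPositions e, T = sepsWith a e p := by
  obtain ⟨m, rfl⟩ := Nat.exists_eq_succ_of_ne_zero ha.ne'
  have hfilter : T.countP (isBoundedLetter (m + 1)) = (T.filter fun l => !isFloorLetter l).length := by
    rw [← List.countP_eq_length_filter]
    refine List.countP_congr fun l hl => ?_
    have := hsep l hl
    rcases l with _ | q
    · simp [isBoundedLetter, isFloorLetter]
    · simp [isSepLetter, isFloorLetter] at this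
      simp [this, isFloorLetter]
  set C : Multiset ArcLetter := (Finset.Ico (0 + 1) (0 + 1 + m)).val.map fun k => some (k, k + 1)
    with hC
  have hCle : C ≤ ((T.filter fun l => !isFloorLetter l : List ArcLetter) : Multiset ArcLetter) := by
    rw [Multiset.le_iff_subset]
    · intro l hl
      obtain ⟨k, hk, rfl⟩ := Multiset.mem_map.1 hl
      rw [Finset.mem_val, Finset.mem_Ico] at hk
      simpa [isFloorLetter] using hchain k (by omega) (by omega)
    · refine Multiset.Nodup.map (fun k k' h => ?_) (Finset.nodup _)
      simpa using h
  obtain ⟨u, hu⟩ := Multiset.le_iff_exists_add.1 hCle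
  have hcard : u.card = 1 := by
    have h1 := congrArg Multiset.card hu
    rw [Multiset.card_add, Multiset.coe_card, ← hfilter, hb, hC, Multiset.card_map,
      Finset.card_val, Nat.card_Ico] at h1
    omega
  obtain ⟨l, rfl⟩ := Multiset.card_eq_one.1 hcard
  have hlT : l ∈ T.filter fun l => !isFloorLetter l := by
    rw [← Multiset.mem_coe, hu]
    simp
  rw [List.mem_filter] at hlT
  obtain ⟨hlT, hlf⟩ := hlT
  rcases l with _ | e
  · simp [isFloorLetter] at hlf
  obtain ⟨A, B, rfl, hA⟩ := List.eq_append_cons_of_mem hlT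
  rw [isPlaced_append_cons] at hp
  have hU : A ++ B = chainSeps 1 m := by
    refine eq_chainSeps hp.1 ?_ ?_
    · simpa [isFloorLetter] using hf
    · rw [← hC]
      rw [add_comm, Multiset.singleton_add] at hu
      have : (((A ++ some e :: B).filter fun l => !isFloorLetter l : List ArcLetter) :
          Multiset ArcLetter) = some e ::ₘ
          (((A ++ B).filter fun l => !isFloorLetter l : List ArcLetter) : Multiset ArcLetter) := by
        rw [Multiset.cons_coe, Multiset.coe_eq_coe]
        simp [isFloorLetter]
      rw [this] at hu
      exact (Multiset.cons_inj_right _).1 hu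
  have hA' : A = (chainSeps 1 m).take A.length := by rw [← hU]; simp
  have hB' : B = (chainSeps 1 m).drop A.length := by rw [← hU]; simp
  have hlen : A.length ≤ 2 * m + 1 := by
    rw [← length_chainSeps 1 m, ← hU, List.length_append]
    omega
  have hgap : A.countP isFloorLetter = (A.length + 1) / 2 := by
    rw [← countP_take_chainSeps (k := 1) hlen, ← hA']
  rw [hgap, zero_add] at hp
  obtain ⟨-, hp1, hp2⟩ := hp
  have hbd := hsep (some e) hlT
  have hle' := hle e hlT
  simp [isSepLetter, isFloorLetter, isBoundedLetter] at hbd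
  have he : e ∈ extraEdges (m + 1) := by
    rw [mem_extraEdges]
    omega
  refine ⟨e, he, A.length, ?_, ?_⟩
  · unfold insertPositions
    split_ifs with h
    · rw [Finset.mem_singleton]
      by_contra hne
      refine hA ?_
      rw [hA', mem_take_chainSeps]
      refine ⟨e.1 - 1, by omega, by omega, Prod.ext ?_ ?_⟩ <;> simp only <;> omega
    · rw [Finset.mem_Ico]
      omega
  · rw [sepsWith, Nat.succ_sub_one, ← hA', ← hB']

theorem EndsPlaced.isPlaced {a g : ℕ} {S : List ArcLetter} (h : EndsPlaced a g S)
    (hT : IsPlaced g (S.filter (isSepLetter a))) (hg : g + S.countP isFloorLetter ≤ a) :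
    IsPlaced g S := by
  induction S generalizing g with
  | nil => trivial
  | cons l S ih =>
    rcases l with _ | q
    · rw [List.countP_cons] at hg
      simp only [isFloorLetter, if_true] at hg
      exact ih h (by simpa [isSepLetter, isFloorLetter, IsPlaced] using hT) (by omega)
    · rw [List.countP_cons] at hg
      simp only [isFloorLetter, Bool.false_eq_true, if_false] at hg
      obtain ⟨h1, h2, h3⟩ := h
      by_cases hs : isSepLetter a (some q)
      · rw [List.filter_cons, if_pos hs] at hT
        exact ⟨hT.1, ih h3 hT.2 (by omega)⟩
      · rw [List.filter_cons, if_neg hs] at hT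
        refine ⟨?_, ih h3 hT (by omega)⟩
        simp [isSepLetter, isFloorLetter, isBoundedLetter] at hs
        by_cases h0 : q.1 = 0
        · have := h1 h0
          omega
        · have := h2 (hs h0)
          have := hs h0
          omega

theorem IsPlaced.endsPlaced {a g : ℕ} {S : List ArcLetter} (h : IsPlaced g S)
    (hle : ∀ q, some q ∈ S → q.2 ≤ a + 1 ∧ ¬ (q.1 = 0 ∧ q.2 = a + 1)) : EndsPlaced a g S := by
  induction S generalizing g with
  | nil => trivial
  | cons l S ih =>
    rcases l with _ | q
    · exact ih h fun q hq => hle q (List.mem_cons_of_mem _ hq)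
    · have h1 := hle q List.mem_cons_self
      have h2 := h.1
      exact ⟨fun _ => by omega, fun _ => by omega,
        ih h.2 fun q hq => hle q (List.mem_cons_of_mem _ hq)⟩

theorem IsPlaced.filter_sep {a g : ℕ} {S : List ArcLetter} (h : IsPlaced g S) :
    IsPlaced g (S.filter (isSepLetter a)) := by
  induction S generalizing g with
  | nil => trivial
  | cons l S ih =>
    rcases l with _ | q
    · have hs : isSepLetter a none = true := by simp [isSepLetter, isFloorLetter]
      rw [List.filter_cons, if_pos hs]
      exact ih h
    · rw [List.filter_cons]
      split_ifs
      · exact ⟨h.1, ih h.2⟩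
      · exact ih h.2

theorem EndsPlaced.bounds {a g : ℕ} {S : List ArcLetter} (h : EndsPlaced a g S) {q : ℕ × ℕ}
    (hq : some q ∈ S) : (q.1 = 0 → q.2 ≤ a) ∧ (q.2 = a + 1 → 1 ≤ q.1) := by
  induction S generalizing g with
  | nil => simp at hq
  | cons l S ih =>
    rcases l with _ | q'
    · exact ih h (by simpa using hq)
    · rcases List.mem_cons.1 hq with hq | hq
      · obtain rfl : q = q' := by simpa using hq
        exact ⟨fun h0 => (h.1 h0).2, fun h0 => (h.2.1 h0).1⟩
      · exact ih h.2.2 hq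

/-- Equips the letters of `S` with weights: `w` for the first occurrence of `e`, and the values of `f`
for the other letters. -/
def assignWeights (f : ArcLetter → ℕ) (e : ArcLetter) (w : ℕ) :
    List ArcLetter → List (ArcLetter × ℕ)
  | [] => []
  | l :: S => if l = e then (l, w) :: S.map fun l => (l, f l)
      else (l, f l) :: assignWeights f e w S

section assignWeights

variable {f : ArcLetter → ℕ} {e : ArcLetter} {w : ℕ}

theorem map_fst_assignWeights (S : List ArcLetter) :
    (assignWeights f e w S).map Prod.fst = S := by
  induction S with
  | nil => rfl
  | cons l S ih =>
    rw [assignWeights]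
    split_ifs
    · simp [Function.comp_def]
    · simp [ih]

theorem assignWeights_append_cons {A B : List ArcLetter} (hA : e ∉ A) :
    assignWeights f e w (A ++ e :: B) =
      (A.map fun l => (l, f l)) ++ (e, w) :: B.map fun l => (l, f l) := by
  induction A with
  | nil => simp [assignWeights]
  | cons l A ih =>
    rw [List.mem_cons, not_or] at hA
    rw [List.cons_append, assignWeights, if_neg (Ne.symm hA.1), ih hA.2]
    simp

theorem assignWeights_perm {S : List ArcLetter} (he : e ∈ S) :
    (assignWeights f e w S).Perm ((e, w) :: (S.erase e).map fun l => (l, f l)) := by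
  obtain ⟨A, B, rfl, hA⟩ := List.eq_append_cons_of_mem he
  rw [assignWeights_append_cons hA, List.erase_append_right _ hA, List.erase_cons_head,
    List.map_append]
  exact List.perm_middle

theorem assignWeights_injective {S : List ArcLetter} (he : e ∈ S) {f' : ArcLetter → ℕ} {w' : ℕ}
    (h : assignWeights f e w S = assignWeights f' e w' S) : w = w' := by
  obtain ⟨A, B, rfl, hA⟩ := List.eq_append_cons_of_mem he
  rw [assignWeights_append_cons hA, assignWeights_append_cons hA] at h
  have := List.append_inj_right h (by simp)
  simp at this
  exact this.1

end assignWeights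

/-- The flux through the `k`-th cut that is not carried by the ends of `S`. -/
def freeFlux (δ a b k : ℕ) (S : List ArcLetter) : ℕ :=
  b + δ * k - S.countP fun l => crossesCut k l && !isSepLetter a l

/-- The weights of the letters other than the additional edge `e` of weight `w`. -/
def letterWeight (δ a b : ℕ) (e : ℕ × ℕ) (w : ℕ) (S : List ArcLetter) : ArcLetter → ℕ
  | none => 0
  | some q => if isBoundedLetter a (some q) then
      freeFlux δ a b q.1 S - (if crossesCut q.1 (some e) then w else 0) else 1

/-- The word with letters `S` whose additional edge `e` has weight `w`. -/
def extraWord (δ a b : ℕ) (e : ℕ × ℕ) (w : ℕ) (S : List ArcLetter) : List (ArcLetter × ℕ) :=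
  assignWeights (letterWeight δ a b e w S) (some e) w S

/-- The total span of the ends in `S`. -/
def endSpan (a : ℕ) (S : List ArcLetter) : ℕ :=
  (S.map fun l => if isSepLetter a l then 0 else arcSpan l).sum

theorem isSepLetter_chainSeps {a : ℕ} (ha : 0 < a) {l : ArcLetter}
    (hl : l ∈ chainSeps 1 (a - 1)) : isSepLetter a l := by
  rcases l with _ | q
  · simp [isSepLetter, isFloorLetter]
  · obtain ⟨r, hr, rfl⟩ := mem_chainSeps.1 hl
    simp [isSepLetter, isFloorLetter, isBoundedLetter]
    omega

theorem isSepLetter_extraEdge {a : ℕ} {e : ℕ × ℕ} (he : e ∈ extraEdges a) :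
    isSepLetter a (some e) := by
  rw [mem_extraEdges] at he
  simp [isSepLetter, isFloorLetter, isBoundedLetter]
  omega

theorem isSepLetter_sepsWith {a : ℕ} (ha : 0 < a) {e : ℕ × ℕ} (he : e ∈ extraEdges a) {p : ℕ}
    {l : ArcLetter} (hl : l ∈ sepsWith a e p) : isSepLetter a l := by
  rw [(sepsWith_perm a e p).mem_iff, List.mem_cons] at hl
  rcases hl with rfl | hl
  · exact isSepLetter_extraEdge he
  · exact isSepLetter_chainSeps ha hl

theorem countP_crossing_le_endSpan {a k : ℕ} (hk : 1 ≤ k) (hk' : k < a) (S : List ArcLetter) :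
    S.countP (fun l => crossesCut k l && !isSepLetter a l) ≤ endSpan a S := by
  induction S with
  | nil => simp
  | cons l S ih =>
    rw [List.countP_cons, endSpan, List.map_cons, List.sum_cons, add_comm]
    refine add_le_add ?_ ih
    rcases l with _ | q
    · simp [crossesCut]
    · by_cases hs : isSepLetter a (some q)
      · simp [hs]
      · have hs' : isSepLetter a (some q) = false := by simpa using hs
        simp [isSepLetter, isFloorLetter, isBoundedLetter] at hs
        simp only [hs', crossesCut, arcSpan, Bool.not_false, Bool.and_true, decide_eq_true_eq,
          Bool.false_eq_true, if_false]
        split_ifs <;> omega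

section extraWord

variable {δ a b p w : ℕ} {e : ℕ × ℕ} {S : List ArcLetter}

theorem perm_of_filter_eq (hS : S.filter (isSepLetter a) = sepsWith a e p) :
    S.Perm (some e :: (chainSeps 1 (a - 1) ++ S.filter fun l => !isSepLetter a l)) := by
  refine (List.filter_append_perm (isSepLetter a) S).symm.trans ?_
  rw [hS]
  exact (sepsWith_perm a e p).append_right _

theorem mem_of_filter_eq (hS : S.filter (isSepLetter a) = sepsWith a e p) : some e ∈ S :=
  (perm_of_filter_eq hS).mem_iff.2 List.mem_cons_self

theorem extraWord_perm (hS : S.filter (isSepLetter a) = sepsWith a e p) :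
    (extraWord δ a b e w S).Perm ((some e, w) ::
      (((chainSeps 1 (a - 1)).map fun l => (l, letterWeight δ a b e w S l)) ++
        (S.filter fun l => !isSepLetter a l).map fun l => (l, 1))) := by
  refine (assignWeights_perm (mem_of_filter_eq hS)).trans (List.Perm.cons _ ?_)
  have h1 : (S.erase (some e)).Perm
      (chainSeps 1 (a - 1) ++ S.filter fun l => !isSepLetter a l) := by
    have := (perm_of_filter_eq hS).erase (some e)
    rwa [List.erase_cons_head] at this
  refine (h1.map _).trans ?_
  rw [List.map_append]
  refine List.Perm.of_eq (congrArg _ (List.map_congr_left fun l hl => ?_))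
  have hl := (List.mem_filter.1 hl).2
  rcases l with _ | q
  · simp [isSepLetter, isFloorLetter] at hl
  · have : isBoundedLetter a (some q) = false := by
      simpa [isSepLetter, isFloorLetter] using hl
    simp [letterWeight, this]

theorem countP_extraWord (q : ArcLetter → Bool) :
    (extraWord δ a b e w S).countP (fun l => q l.1) = S.countP q := by
  conv_rhs => rw [← map_fst_assignWeights (f := letterWeight δ a b e w S) (e := some e) (w := w) S]
  rw [List.countP_map]
  rfl

theorem countP_of_filter_eq (hS : S.filter (isSepLetter a) = sepsWith a e p) (q : ArcLetter → Bool)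
    (hq : ∀ l, q l = true → isSepLetter a l = true) :
    S.countP q = (if q (some e) then 1 else 0) + (chainSeps 1 (a - 1)).countP q := by
  have h1 : S.countP q = (S.filter (isSepLetter a)).countP q := by
    rw [List.countP_filter]
    refine List.countP_congr fun l _ => ?_
    simp only [Bool.and_eq_true]
    exact ⟨fun h => ⟨h, hq l h⟩, fun h => h.1⟩
  rw [h1, hS, (sepsWith_perm a e p).countP_eq, List.countP_cons, add_comm]

theorem countP_bounded_chainSeps {a k m : ℕ} (hk : 1 ≤ k) (hm : k + m ≤ a) :
    (chainSeps k m).countP (isBoundedLetter a) = m := by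
  induction m generalizing k with
  | zero => simp [chainSeps, isBoundedLetter]
  | succ m ih =>
    rw [chainSeps, List.countP_cons, List.countP_cons, ih (by omega) (by omega)]
    have h1 : k ≠ 0 := by omega
    have h2 : k ≠ a := by omega
    simp [isBoundedLetter, h1, h2]

theorem mem_extraWord {l : ArcLetter × ℕ} (hS : S.filter (isSepLetter a) = sepsWith a e p) :
    l ∈ extraWord δ a b e w S ↔ l = (some e, w) ∨
      (l.1 ∈ chainSeps 1 (a - 1) ∧ l.2 = letterWeight δ a b e w S l.1) ∨
      (l.1 ∈ S ∧ isSepLetter a l.1 = false ∧ l.2 = 1) := by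
  rw [(extraWord_perm hS).mem_iff]
  obtain ⟨l, w'⟩ := l
  simp only [List.mem_cons, List.mem_append, List.mem_map, List.mem_filter, Prod.mk.injEq,
    Bool.not_eq_true']
  refine or_congr Iff.rfl (or_congr ?_ ?_)
  · constructor
    · rintro ⟨x, h, rfl, rfl⟩
      exact ⟨h, rfl⟩
    · rintro ⟨h, h'⟩
      exact ⟨l, h, rfl, h'.symm⟩
  · constructor
    · rintro ⟨x, ⟨h, h'⟩, rfl, rfl⟩
      exact ⟨h, h', rfl⟩
    · rintro ⟨h, h', h''⟩
      exact ⟨l, ⟨h, h'⟩, rfl, h''.symm⟩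

theorem letterWeight_chain {k : ℕ} (hk : 1 ≤ k) (hk' : k < a) :
    letterWeight δ a b e w S (some (k, k + 1)) =
      freeFlux δ a b k S - if crossesCut k (some e) then w else 0 := by
  have h1 : k ≠ 0 := by omega
  have h2 : k ≠ a := by omega
  simp [letterWeight, isBoundedLetter, h1, h2]

/-- The range of the weights of the additional edge. -/
def weightBound (δ a b n : ℕ) (e : ℕ × ℕ) (S : List ArcLetter) : ℕ :=
  if e.2 = e.1 + 1 then freeFlux δ a b e.1 S else n

theorem lt_freeFlux {n : ℕ} (hlow : endSpan a S < n) (hb : 2 * n ≤ b)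
    (hw : w < weightBound δ a b n e S) {k : ℕ} (hk : 1 ≤ k) (hk' : k < a) :
    (if crossesCut k (some e) then w else 0) < freeFlux δ a b k S ∧
      freeFlux δ a b k S + S.countP (fun l => crossesCut k l && !isSepLetter a l) = b + δ * k := by
  have h1 := countP_crossing_le_endSpan hk hk' S
  have h2 : n < freeFlux δ a b k S := by
    unfold freeFlux
    omega
  refine ⟨?_, ?_⟩
  · unfold weightBound at hw
    split_ifs with hc
    · split_ifs at hw with h
      · simp [crossesCut] at hc
        obtain rfl : k = e.1 := by omega
        exact hw
      · omega
    · omega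
  · unfold freeFlux
    omega

theorem isFloorWord_extraWord {n : ℕ} (ha : 0 < a) (he : e ∈ extraEdges a)
    (hp : p ∈ insertPositions e) (hS : S.filter (isSepLetter a) = sepsWith a e p)
    (hsrc : S.countP isSourceLetter = b) (hsnk : S.countP (isSinkLetter a) = b + δ * a)
    (hends : EndsPlaced a 0 S) (hlow : endSpan a S < n) (hb : 2 * n ≤ b) (hw0 : 0 < w)
    (hw : w < weightBound δ a b n e S) :
    IsFloorWord δ a a (b + δ * a) b (extraWord δ a b e w S) ∧
      ∀ k, 1 ≤ k → k < a → ∃ w', (some (k, k + 1), w') ∈ extraWord δ a b e w S := by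
  have hgap := gap_of_mem_insertPositions he hp
  have hflux := fun k => lt_freeFlux (δ := δ) hlow hb hw (k := k)
  have he' := mem_extraEdges.1 he
  have hfl : S.countP isFloorLetter = a := by
    rw [countP_of_filter_eq hS, countP_floor_chainSeps]
    · simp [isFloorLetter]; omega
    · intro l hl
      simp [isSepLetter, hl]
  have hmem : ∀ l ∈ extraWord δ a b e w S, l.1 ∈ S := fun l hl => by
    have := List.mem_map_of_mem (f := Prod.fst) hl
    rwa [extraWord, map_fst_assignWeights] at this
  refine ⟨⟨?_, ?_, ?_, ?_, ?_, ?_, ?_, ?_, ?_, ?_⟩, ?_⟩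
  · rw [countP_extraWord, hfl]
  · rw [countP_extraWord, countP_of_filter_eq hS, countP_bounded_chainSeps le_rfl (by omega)]
    · have h1 : e.1 ≠ 0 := by omega
      have h2 : e.2 ≠ a + 1 := by omega
      simp [isBoundedLetter, h1, h2]
      omega
    · intro l hl
      simp [isSepLetter, hl]
  · rw [countP_extraWord, hsnk]
  · rw [countP_extraWord, hsrc]
  · rw [extraWord, map_fst_assignWeights]
    refine hends.isPlaced ?_ (by omega)
    rw [hS, sepsWith, isPlaced_append_cons, List.take_append_drop,
      countP_take_chainSeps hgap.2.2]
    exact ⟨isPlaced_chainSeps 0 _, by omega, by omega⟩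
  · intro q w' hq
    have hqS := hmem _ hq
    rcases (mem_extraWord hS).1 hq with h | ⟨h, -⟩ | ⟨h, h', -⟩
    · obtain ⟨h1, -⟩ := Prod.mk.inj h
      obtain rfl : q = e := by simpa using h1
      omega
    · obtain ⟨r, hr, rfl⟩ := mem_chainSeps.1 h
      simp only
      omega
    · have h1 := hends.bounds hqS
      simp [isSepLetter, isFloorLetter, isBoundedLetter] at h'
      omega
  · intro q w' hq
    rcases (mem_extraWord hS).1 hq with h | ⟨h, h'⟩ | ⟨h, h', h''⟩
    · rw [(Prod.mk.inj h).2]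
      exact hw0
    · obtain ⟨r, hr, rfl⟩ := mem_chainSeps.1 h
      simp only at h'
      rw [letterWeight_chain (by omega) (by omega)] at h'
      have := hflux (1 + r) (by omega) (by omega)
      omega
    · simp only at h''
      omega
  · intro w' hw'
    rcases (mem_extraWord hS).1 hw' with h | ⟨h, h'⟩ | ⟨h, h', h''⟩
    · simp at h
    · exact h'
    · simp [isSepLetter, isFloorLetter] at h'
  · intro q w' hq hqe
    rcases (mem_extraWord hS).1 hq with h | ⟨h, h'⟩ | ⟨h, h', h''⟩
    · obtain ⟨h1, -⟩ := Prod.mk.inj h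
      obtain rfl : q = e := by simpa using h1
      omega
    · obtain ⟨r, hr, rfl⟩ := mem_chainSeps.1 h
      simp only at hqe
      omega
    · exact h''
  · intro k hk hk'
    rw [((extraWord_perm hS).map _).sum_eq]
    simp only [List.map_cons, List.sum_cons, List.map_append, List.sum_append, List.map_map]
    have h1 : ((chainSeps 1 (a - 1)).map ((fun l : ArcLetter × ℕ =>
        if crossesCut k l.1 then l.2 else 0) ∘ fun l => (l, letterWeight δ a b e w S l))).sum =
        letterWeight δ a b e w S (some (k, k + 1)) := by
      rw [sum_map_chainSeps, Finset.sum_eq_single k]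
      · simp [crossesCut]
      · intro r _ hr
        simp [crossesCut]
        omega
      · intro h
        rw [Finset.mem_Ico] at h
        omega
    have h2 : ((S.filter fun l => !isSepLetter a l).map ((fun l : ArcLetter × ℕ =>
        if crossesCut k l.1 then l.2 else 0) ∘ fun l => (l, 1))).sum =
        S.countP fun l => crossesCut k l && !isSepLetter a l := by
      rw [← List.countP_filter]
      generalize S.filter _ = V
      induction V with
      | nil => simp
      | cons l V ih =>
        rw [List.map_cons, List.sum_cons, ih, List.countP_cons, add_comm]
        rfl
    rw [h1, h2, letterWeight_chain hk hk']
    have := hflux k hk hk'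
    omega
  · intro k hk hk'
    refine ⟨_, (mem_extraWord hS).2 (Or.inr (Or.inl ⟨?_, rfl⟩))⟩
    exact mem_chainSeps.2 ⟨k - 1, by omega, Prod.ext (by simp only; omega) (by simp only; omega)⟩

end extraWord

theorem countP_eq_sum_map {α : Type*} (q : α → Bool) (l : List α) :
    l.countP q = (l.map fun x => if q x then 1 else 0).sum := by
  induction l with
  | nil => rfl
  | cons x l ih => rw [List.countP_cons, List.map_cons, List.sum_cons, ih, add_comm]

theorem count_chainSeps {k m r : ℕ} (hr : k ≤ r) (hr' : r < k + m) :
    (chainSeps k m).count (some (r, r + 1)) = 1 := by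
  rw [List.count, countP_eq_sum_map, sum_map_chainSeps, Finset.sum_eq_single r]
  · simp
  · intro s _ hs
    simp [hs]
  · intro h
    rw [Finset.mem_Ico] at h
    omega

theorem length_eq_countP {a : ℕ} {S : List ArcLetter}
    (hle : ∀ q, some q ∈ S → ¬ (q.1 = 0 ∧ q.2 = a + 1)) :
    S.length = S.countP isFloorLetter + S.countP (isBoundedLetter a) +
      (S.countP (isSinkLetter a) + S.countP isSourceLetter) := by
  induction S with
  | nil => rfl
  | cons l S ih =>
    rw [List.length_cons, ih fun q hq => hle q (List.mem_cons_of_mem _ hq)]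
    simp only [List.countP_cons]
    rcases l with _ | q
    · simp [isFloorLetter, isBoundedLetter, isSinkLetter, isSourceLetter]
      omega
    · have := hle q List.mem_cons_self
      by_cases h1 : q.1 = 0 <;> by_cases h2 : q.2 = a + 1 <;>
        simp [isFloorLetter, isBoundedLetter, isSinkLetter, isSourceLetter, h1, h2] at this ⊢ <;>
        omega

theorem IsFloorWord.exists_chain_edge {δ a m t b n : ℕ} {W : List (ArcLetter × ℕ)}
    (hW : IsFloorWord δ a m t b W) (hcod : (W.map fun l => l.2 * arcSpan l.1).sum < n)
    (hb : n ≤ b) {k : ℕ} (hk : 1 ≤ k) (hk' : k < a) : ∃ w, (some (k, k + 1), w) ∈ W := by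
  by_contra! hno
  have h1 := hW.flux k hk hk'
  have h2 : (W.map fun l => if crossesCut k l.1 then l.2 else 0).sum ≤
      (W.map fun l => l.2 * arcSpan l.1).sum := by
    refine List.sum_le_sum fun l hl => ?_
    obtain ⟨_ | q, w⟩ := l
    · simp [crossesCut]
    · simp only [crossesCut, arcSpan, decide_eq_true_eq]
      split_ifs with hc
      · refine Nat.le_mul_of_pos_right _ ?_
        by_contra h3
        have h4 : q = (k, k + 1) := Prod.ext (by simp only; omega) (by simp only; omega)
        exact hno w (h4 ▸ hl)
      · exact Nat.zero_le _
  omega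

theorem IsFloorWord.exists_extraWord {δ a b n : ℕ} {W : List (ArcLetter × ℕ)} (ha : 0 < a)
    (hW : IsFloorWord δ a a (b + δ * a) b W)
    (hcod : (W.map fun l => l.2 * arcSpan l.1).sum < n) (hb : n ≤ b) :
    ∃ e ∈ extraEdges a, ∃ p ∈ insertPositions e,
      ∃ S ∈ fillings a (2 * a + b + (b + δ * a)) (sepsWith a e p) 0 b (b + δ * a),
        ∃ w ∈ Finset.Ico 1 (weightBound δ a b n e S), extraWord δ a b e w S = W := by
  set S := W.map Prod.fst with hSdef
  have hSW : ∀ q, some q ∈ S ↔ ∃ w, (some q, w) ∈ W := by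
    intro q
    simp [hSdef]
  have hle : ∀ q, some q ∈ S → q.2 ≤ a + 1 ∧ ¬ (q.1 = 0 ∧ q.2 = a + 1) := by
    intro q hq
    obtain ⟨w, hw⟩ := (hSW q).1 hq
    exact hW.le q w hw
  have hcount : ∀ q : ArcLetter → Bool, S.countP q = W.countP fun l => q l.1 := by
    intro q
    rw [hSdef, List.countP_map]
    rfl
  have hfilt : ∀ q : ArcLetter → Bool, (∀ l, q l = true → isSepLetter a l = true) →
      (S.filter (isSepLetter a)).countP q = S.countP q := by
    intro q hq
    rw [List.countP_filter]
    refine List.countP_congr fun l _ => ?_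
    simp only [Bool.and_eq_true]
    exact ⟨fun h => h.1, fun h => ⟨h, hq l h⟩⟩
  obtain ⟨e, he, p, hp, hT⟩ := exists_eq_sepsWith ha (T := S.filter (isSepLetter a))
    (fun s hs => (List.mem_filter.1 hs).2) (fun q hq => (hle q (List.mem_filter.1 hq).1).1)
    hW.placed.filter_sep
    (by rw [hfilt _ fun l hl => by simp [isSepLetter, hl], hcount, hW.floors])
    (by rw [hfilt _ fun l hl => by simp [isSepLetter, hl], hcount, hW.bounded])
    (fun k hk hk' => by
      rw [List.mem_filter]
      refine ⟨(hSW _).2 (hW.exists_chain_edge hcod hb hk hk'), ?_⟩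
      simp [isSepLetter, isFloorLetter, isBoundedLetter]
      omega)
  have he' := mem_extraEdges.1 he
  refine ⟨e, he, p, hp, S, ?_, ?_⟩
  · rw [mem_fillings fun s hs => isSepLetter_sepsWith ha he hs]
    refine ⟨?_, hT, by rw [hcount, hW.sources], by rw [hcount, hW.sinks],
      hW.placed.endsPlaced hle⟩
    rw [length_eq_countP fun q hq => (hle q hq).2, hcount, hcount, hcount, hcount, hW.floors,
      hW.bounded, hW.sinks, hW.sources]
    ring
  obtain ⟨A', B', hS', hA'⟩ := List.eq_append_cons_of_mem (mem_of_filter_eq hT)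
  obtain ⟨A, B₀, hWAB, rfl, hB₀⟩ := List.map_eq_append_iff.1 (hSdef.symm.trans hS')
  obtain ⟨l, B, rfl, hl, rfl⟩ := List.map_eq_cons_iff.1 hB₀
  obtain ⟨l, w⟩ := l
  simp only at hl
  subst hl
  have hperm : W.Perm ((some e, w) :: (A ++ B)) := by
    rw [hWAB]
    exact List.perm_middle
  have hVperm : ((A ++ B).map Prod.fst).Perm
      (chainSeps 1 (a - 1) ++ S.filter fun l => !isSepLetter a l) := by
    have h1 := hperm.map Prod.fst
    rw [← hSdef, List.map_cons] at h1
    exact (h1.symm.trans (perm_of_filter_eq hT)).cons_inv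
  have hmemW : ∀ l ∈ A ++ B, l ∈ W := fun l hl => hperm.mem_iff.2 (List.mem_cons_of_mem _ hl)
  have hew : (some e, w) ∈ W := hperm.mem_iff.2 List.mem_cons_self
  have hw0 : 0 < w := hW.weight_pos _ _ hew
  -- the other edges have the weights required by the flux
  have hchainW : ∀ k ω, (some (k, k + 1), ω) ∈ A ++ B → 1 ≤ k → k < a →
      (if crossesCut k (some e) then w else 0) + ω +
        S.countP (fun l => crossesCut k l && !isSepLetter a l) = b + δ * k := by
    intro k ω hkω hk hk'
    rw [← hW.flux k hk hk', (hperm.map _).sum_eq]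
    have hV := List.perm_cons_erase hkω
    set V' := (A ++ B).erase (some (k, k + 1), ω) with hV'
    rw [List.map_cons, List.sum_cons, (hV.map _).sum_eq, List.map_cons, List.sum_cons]
    have hU := (hV.map Prod.fst).symm.trans hVperm
    rw [List.map_cons] at hU
    simp only at hU
    have hnot : some (k, k + 1) ∉ V'.map Prod.fst := by
      rw [← List.count_eq_zero]
      have h1 := hU.count_eq (some (k, k + 1))
      rw [List.count_cons_self, List.count_append, count_chainSeps hk (by omega)] at h1
      have h2 : (S.filter fun l => !isSepLetter a l).count (some (k, k + 1)) = 0 := by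
        rw [List.count_eq_zero, List.mem_filter]
        rintro ⟨-, h⟩
        simp [isSepLetter, isFloorLetter, isBoundedLetter] at h
        omega
      omega
    have hS2 : S.countP (fun l => crossesCut k l && !isSepLetter a l) =
        (V'.map Prod.fst).countP (fun l => crossesCut k l && !isSepLetter a l) := by
      rw [(perm_of_filter_eq hT).countP_eq, List.countP_cons_of_neg
        (by simp [isSepLetter_extraEdge he]), ← hU.countP_eq, List.countP_cons_of_neg]
      simp [isSepLetter, isFloorLetter, isBoundedLetter]
      omega
    have h3 : (V'.map fun l => if crossesCut k l.1 then l.2 else 0).sum =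
        (V'.map Prod.fst).countP (fun l => crossesCut k l && !isSepLetter a l) := by
      rw [List.countP_map, countP_eq_sum_map]
      refine congrArg List.sum (List.map_congr_left fun l hl => ?_)
      have hlW := hmemW l (List.mem_of_mem_erase hl)
      obtain ⟨_ | q, ω'⟩ := l
      · simp [crossesCut]
      · simp only [Function.comp_apply]
        by_cases hc : crossesCut k (some q)
        · have hsep : isSepLetter a (some q) = false := by
            by_contra hs
            rw [Bool.not_eq_false] at hs
            have hq : some q ∈ chainSeps 1 (a - 1) ++ S.filter fun l => !isSepLetter a l :=
              hU.mem_iff.1 (List.mem_cons_of_mem _ (List.mem_map_of_mem (f := Prod.fst) hl))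
            rw [List.mem_append, List.mem_filter] at hq
            rcases hq with hq | hq
            · obtain ⟨r, hr, rfl⟩ := mem_chainSeps.1 hq
              simp [crossesCut] at hc
              obtain rfl : k = 1 + r := by omega
              exact hnot (List.mem_map_of_mem (f := Prod.fst) hl)
            · simp [hs] at hq
          have hend : q.1 = 0 ∨ q.2 = a + 1 := by
            simp [isSepLetter, isFloorLetter, isBoundedLetter] at hsep
            by_cases h0 : q.1 = 0
            · exact Or.inl h0
            · exact Or.inr (hsep h0)
          rw [hW.weight_end q ω' hlW hend]
          simp [hc, hsep]
        · simp [hc]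
    rw [h3, hS2]
    simp only [crossesCut, le_refl, Nat.lt_succ_self, and_self, decide_true, if_true]
    ring
  have hweights : ∀ l ∈ A ++ B, l.2 = letterWeight δ a b e w S l.1 := by
    rintro ⟨_ | q, ω⟩ hl
    · exact hW.weight_floor _ (hmemW _ hl)
    · by_cases hbd : isBoundedLetter a (some q)
      · have hq : some q ∈ chainSeps 1 (a - 1) ++ S.filter fun l => !isSepLetter a l :=
          hVperm.mem_iff.1 (List.mem_map_of_mem (f := Prod.fst) hl)
        rw [List.mem_append, List.mem_filter] at hq
        rcases hq with hq | hq
        · obtain ⟨r, hr, rfl⟩ := mem_chainSeps.1 hq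
          have h1 := hchainW _ _ hl (by omega) (by omega)
          simp only
          rw [letterWeight_chain (by omega) (by omega), freeFlux]
          omega
        · simp [isSepLetter, hbd] at hq
      · have hend : q.1 = 0 ∨ q.2 = a + 1 := by
          simp [isBoundedLetter] at hbd
          by_cases h0 : q.1 = 0
          · exact Or.inl h0
          · exact Or.inr (hbd h0)
        simp [letterWeight, hbd, hW.weight_end q ω (hmemW _ hl) hend]
  refine ⟨w, ?_, ?_⟩
  · rw [Finset.mem_Ico]
    refine ⟨hw0, ?_⟩
    unfold weightBound
    split_ifs with hshort
    · have hmem : some (e.1, e.1 + 1) ∈ (A ++ B).map Prod.fst := by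
        rw [hVperm.mem_iff, List.mem_append]
        refine Or.inl (mem_chainSeps.2 ⟨e.1 - 1, by omega, Prod.ext ?_ ?_⟩) <;> simp only <;> omega
      obtain ⟨⟨l, ω⟩, hl, hl'⟩ := List.mem_map.1 hmem
      simp only at hl'
      subst hl'
      have h1 := hchainW _ _ hl (by omega) (by omega)
      have h2 := hW.weight_pos _ _ (hmemW _ hl)
      simp [crossesCut, hshort] at h1
      unfold freeFlux
      simp only [crossesCut]
      simp
      omega
    · have h1 : w * arcSpan (some e) ≤ (W.map fun l => l.2 * arcSpan l.1).sum :=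
        List.single_le_sum (by simp) _ (List.mem_map.2 ⟨_, hew, rfl⟩)
      have h2 : w * 1 ≤ w * arcSpan (some e) := Nat.mul_le_mul_left _ (by
        simp only [arcSpan]
        omega)
      omega
  · rw [extraWord, hS', assignWeights_append_cons hA', hWAB]
    have hmap : ∀ l : List (ArcLetter × ℕ), (∀ x ∈ l, x ∈ A ++ B) →
        (l.map Prod.fst).map (fun x => (x, letterWeight δ a b e w (A.map Prod.fst ++ some e ::
          B.map Prod.fst) x)) = l := by
      intro l hl
      rw [List.map_map]
      conv_rhs => rw [← List.map_id l]
      refine List.map_congr_left fun x hx => ?_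
      rw [← hS']
      exact Prod.ext rfl (hweights x (hl x hx)).symm
    rw [hmap A fun x hx => List.mem_append_left _ hx, hmap B fun x hx => List.mem_append_right _ hx]

/-- The contribution of the end of a word. -/
def endTerm {R : Type*} [CommRing R] (a : ℕ) (x : R) (l : ArcLetter) : R :=
  if isSepLetter a l then 1 else x ^ arcSpan l * (1 - x)

/-- The contribution of the additional edge. -/
def extraTerm {R : Type*} [CommRing R] (δ a b : ℕ) (x : R) (e : ℕ × ℕ) (w : ℕ)
    (S : List ArcLetter) : R :=
  if e.2 = e.1 + 1 then (1 - x ^ w) ^ 2 * (1 - x ^ (freeFlux δ a b e.1 S - w)) ^ 2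
  else x ^ (w * (e.2 - e.1 - 1)) * (1 - x ^ w) ^ 2

section

variable {R : Type*} [CommRing R] {x : R} {n δ a b p w : ℕ} {e : ℕ × ℕ} {S : List ArcLetter}

theorem endSpan_lt_of_prod_ne_zero (hx : x ^ n = 0) (h : (S.map (endTerm a x)).prod ≠ 0) :
    endSpan a S < n := by
  by_contra! hlow
  have : x ^ endSpan a S ∣ (S.map (endTerm a x)).prod := by
    clear h hlow
    induction S with
    | nil => simp [endSpan]
    | cons l S ih =>
      rw [endSpan, List.map_cons, List.sum_cons, List.map_cons, List.prod_cons, pow_add]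
      refine mul_dvd_mul ?_ ih
      unfold endTerm
      split_ifs
      · simp
      · exact Dvd.intro _ rfl
  have h0 : x ^ endSpan a S = 0 := by
    rw [← Nat.add_sub_cancel' hlow, pow_add, hx, zero_mul]
  rw [h0, zero_dvd_iff] at this
  exact h this

theorem prod_letterTerm_extraWord (hx : x ^ n = 0) (hb : 3 * n ≤ b) (ha : 0 < a)
    (he : e ∈ extraEdges a) (hS : S.filter (isSepLetter a) = sepsWith a e p)
    (hw : w < weightBound δ a b n e S) :
    ((extraWord δ a b e w S).map (letterTerm a x)).prod =
      (S.map (endTerm a x)).prod * extraTerm δ a b x e w S := by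
  have hends : (((S.filter fun l => !isSepLetter a l).map fun l => (l, 1)).map
      (letterTerm a x)).prod = (S.map (endTerm a x)).prod := by
    rw [((perm_of_filter_eq hS).map _).prod_eq, List.map_cons, List.prod_cons, List.map_append,
      List.prod_append]
    have h1 : ((chainSeps 1 (a - 1)).map (endTerm a x)).prod = 1 := by
      refine List.prod_eq_one fun y hy => ?_
      obtain ⟨l, hl, rfl⟩ := List.mem_map.1 hy
      simp [endTerm, isSepLetter_chainSeps ha hl]
    rw [h1, endTerm, if_pos (isSepLetter_extraEdge he), one_mul, one_mul, List.map_map]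
    refine congrArg List.prod (List.map_congr_left fun l hl => ?_)
    have hl := (List.mem_filter.1 hl).2
    simp only [Bool.not_eq_true'] at hl
    have hl' := hl
    rw [isSepLetter, Bool.or_eq_false_iff] at hl'
    simp [endTerm, letterTerm, hl, hl'.1, hl'.2]
  rw [((extraWord_perm hS).map _).prod_eq, List.map_cons, List.prod_cons, List.map_append,
    List.prod_append, hends]
  by_cases h0 : (S.map (endTerm a x)).prod = 0
  · simp [h0]
  have hlow := endSpan_lt_of_prod_ne_zero hx h0
  have he' := mem_extraEdges.1 he
  have hflux := fun k => lt_freeFlux (δ := δ) hlow (by omega) hw (k := k)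
  have hchain : (((chainSeps 1 (a - 1)).map fun l => (l, letterWeight δ a b e w S l)).map
      (letterTerm a x)).prod = ∏ k ∈ Finset.Ico 1 a,
        (1 - x ^ (freeFlux δ a b k S - if crossesCut k (some e) then w else 0)) ^ 2 := by
    rw [List.map_map, prod_map_chainSeps, show 1 + (a - 1) = a by omega]
    have : (letterTerm a x ∘ fun l => (l, letterWeight δ a b e w S l)) none = 1 := by
      simp [letterTerm, isFloorLetter, arcSpan]
    rw [this, one_pow, one_mul]
    refine Finset.prod_congr rfl fun k hk => ?_
    rw [Finset.mem_Ico] at hk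
    have h1 : k ≠ 0 := by omega
    have h2 : k ≠ a := by omega
    rw [Function.comp_apply, letterWeight_chain hk.1 hk.2]
    simp [letterTerm, isFloorLetter, isBoundedLetter, h1, h2, arcSpan]
  have hbig : ∀ k ∈ Finset.Ico 1 a, (e.2 = e.1 + 1 → k ≠ e.1) →
      (1 - x ^ (freeFlux δ a b k S - if crossesCut k (some e) then w else 0)) ^ 2 = 1 := by
    intro k hk hne
    rw [Finset.mem_Ico] at hk
    have h1 := hflux k hk.1 hk.2
    have h2 := countP_crossing_le_endSpan hk.1 hk.2 S
    have h3 : n ≤ freeFlux δ a b k S - if crossesCut k (some e) then w else 0 := by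
      have h4 : (if crossesCut k (some e) then w else 0) ≤ n := by
        split_ifs with hc
        · unfold weightBound at hw
          split_ifs at hw with h
          · simp [crossesCut] at hc
            have := hne h
            omega
          · exact hw.le
        · exact Nat.zero_le _
      omega
    rw [← Nat.add_sub_cancel' h3, pow_add, hx]
    simp
  have hee : letterTerm a x (some e, w) = x ^ (w * (e.2 - e.1 - 1)) * (1 - x ^ w) ^ 2 := by
    have h1 : e.1 ≠ 0 := by omega
    have h2 : e.2 ≠ a + 1 := by omega
    simp [letterTerm, isFloorLetter, isBoundedLetter, h1, h2, arcSpan]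
  rw [hchain, hee]
  unfold extraTerm
  split_ifs with hshort
  · rw [Finset.prod_eq_single e.1 (fun k hk hne => hbig k hk fun _ => hne)]
    · have hc : crossesCut e.1 (some e) := by simp [crossesCut, hshort]
      rw [if_pos hc, show e.2 - e.1 - 1 = 0 by omega]
      ring
    · intro h
      rw [Finset.mem_Ico] at h
      omega
  · rw [Finset.prod_eq_one fun k hk => hbig k hk fun h => absurd h hshort]
    ring

/-- The refined series modulo `x ^ n`, as a sum over chains with an additional edge. -/
theorem map_refinedSeries_eq_sum_extraEdges (φ : ℤ⟦X⟧ →+* R) (hx : φ PowerSeries.X ^ n = 0)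
    (ha : 0 < a) (hb : 3 * n ≤ b) :
    φ (refinedSeries δ 1 a b) = ∑ e ∈ extraEdges a, ∑ p ∈ insertPositions e,
      ∑ S ∈ fillings a (2 * a + b + (b + δ * a)) (sepsWith a e p) 0 b (b + δ * a),
        (S.map (endTerm a (φ PowerSeries.X))).prod *
          ∑ w ∈ Finset.Ico 1 (weightBound δ a b n e S),
            extraTerm δ a b (φ PowerSeries.X) e w S := by
  have hfill : ∀ {e p S}, e ∈ extraEdges a →
      S ∈ fillings a (2 * a + b + (b + δ * a)) (sepsWith a e p) 0 b (b + δ * a) →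
      S.length = 2 * a + b + (b + δ * a) ∧ S.filter (isSepLetter a) = sepsWith a e p ∧
        S.countP isSourceLetter = b ∧ S.countP (isSinkLetter a) = b + δ * a ∧
        EndsPlaced a 0 S := fun he hS =>
    (mem_fillings fun s hs => isSepLetter_sepsWith ha he hs).1 hS
  rw [map_refinedSeries_eq_sum φ ha ((extraEdges a).sigma fun e => (insertPositions e).sigma fun p =>
    (fillings a (2 * a + b + (b + δ * a)) (sepsWith a e p) 0 b (b + δ * a)).sigma fun S =>
      Finset.Ico 1 (weightBound δ a b n e S))
    (fun i => extraWord δ a b i.1 i.2.2.2 i.2.2.1)]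
  · simp only [Finset.sum_sigma]
    refine Finset.sum_congr rfl fun e he => Finset.sum_congr rfl fun p hp =>
      Finset.sum_congr rfl fun S hS => ?_
    rw [Finset.mul_sum]
    exact Finset.sum_congr rfl fun w hw => prod_letterTerm_extraWord hx hb ha he (hfill he hS).2.1
      (Finset.mem_Ico.1 hw).2
  · rintro ⟨e, p, S, w⟩ hi h0
    simp only [Finset.mem_sigma, Finset.mem_Ico] at hi
    obtain ⟨he, hp, hS, hw0, hw⟩ := hi
    obtain ⟨-, h1, h2, h3, h4⟩ := hfill he hS
    rw [prod_letterTerm_extraWord hx hb ha he h1 hw] at h0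
    exact isFloorWord_extraWord ha he hp h1 h2 h3 h4
      (endSpan_lt_of_prod_ne_zero hx (left_ne_zero_of_mul h0)) (by omega) hw0 hw
  · rintro ⟨e, p, S, w⟩ hi ⟨e', p', S', w'⟩ hi' h
    simp only [Finset.mem_sigma, Finset.mem_Ico] at hi hi'
    obtain ⟨he, hp, hS, -⟩ := hi
    obtain ⟨he', hp', hS', -⟩ := hi'
    simp only at h
    have hSS : S = S' := by
      have := congrArg (List.map Prod.fst) h
      rwa [extraWord, extraWord, map_fst_assignWeights, map_fst_assignWeights] at this
    subst hSS
    obtain ⟨rfl, rfl⟩ := sepsWith_injective he he' hp hp'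
      ((hfill he hS).2.1.symm.trans (hfill he' hS').2.1)
    obtain rfl := assignWeights_injective (mem_of_filter_eq (hfill he hS).2.1) h
    rfl
  · intro W hW h0
    have hcod : (W.map fun l => l.2 * arcSpan l.1).sum < n := by
      by_contra! hlow
      have : (φ PowerSeries.X) ^ (W.map fun l => l.2 * arcSpan l.1).sum ∣
          (W.map (letterTerm a (φ PowerSeries.X))).prod := by
        clear hW h0 hlow
        induction W with
        | nil => simp
        | cons l W ih =>
          rw [List.map_cons, List.sum_cons, List.map_cons, List.prod_cons, pow_add]
          exact mul_dvd_mul (Dvd.intro _ rfl) ih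
      rw [← Nat.add_sub_cancel' hlow, pow_add, hx, zero_mul, zero_dvd_iff] at this
      exact h0 this
    obtain ⟨e, he, p, hp, S, hS, w, hw, h⟩ := hW.exists_extraWord ha hcod (by omega)
    exact ⟨⟨e, p, S, w⟩, by simp only [Finset.mem_sigma]; exact ⟨he, hp, hS, hw⟩, h⟩

end

section evaluation

variable {R : Type*} [CommRing R]

/-- The inverse of `1 - x ^ h` if `x ^ n = 0` and `h` is positive. -/
def truncGeom (x : R) (n h : ℕ) : R := ∑ m ∈ Finset.range n, x ^ (h * m)

/-- The value of `x ^ h / (1 - x ^ h)` if `x ^ n = 0` and `h` is positive. -/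
def truncLambert (x : R) (n h : ℕ) : R := ∑ m ∈ Finset.Ico 1 n, x ^ (h * m)

/-- The product of the inverses of `1 - x ^ h` for `0 < h < a`. -/
def truncEuler (x : R) (n a : ℕ) : R := ∏ h ∈ Finset.Ico 1 a, truncGeom x n h

variable {x : R} {n : ℕ}

theorem pow_eq_zero_of_exponent_le (hx : x ^ n = 0) {m : ℕ} (h : n ≤ m) : x ^ m = 0 := by
  rw [← Nat.sub_add_cancel h, pow_add, hx, mul_zero]

theorem truncGeom_eq (hn : 0 < n) (h : ℕ) : truncGeom x n h = 1 + truncLambert x n h := by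
  rw [truncGeom, truncLambert, Finset.range_eq_Ico, Finset.sum_eq_sum_Ico_succ_bot hn]
  simp

theorem mul_truncGeom (hx : x ^ n = 0) {h : ℕ} (hh : 0 < h) :
    (1 - x ^ h) * truncGeom x n h = 1 := by
  rw [truncGeom]
  simp only [pow_mul]
  rw [mul_neg_geom_sum, ← pow_mul, pow_eq_zero_of_exponent_le hx (Nat.le_mul_of_pos_left n hh), sub_zero]

theorem pow_mul_truncGeom (hn : 0 < n) (hx : x ^ n = 0) {h : ℕ} (hh : 0 < h) :
    x ^ h * truncGeom x n h = truncLambert x n h := by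
  linear_combination truncGeom_eq (x := x) hn h - mul_truncGeom hx hh

theorem truncLambert_mul_eq_zero (hx : x ^ n = 0) {h k : ℕ} (hk : n ≤ h + k) :
    truncLambert x n h * truncLambert x n k = 0 := by
  rw [truncLambert, truncLambert, Finset.sum_mul_sum]
  refine Finset.sum_eq_zero fun i hi => Finset.sum_eq_zero fun j hj => ?_
  rw [Finset.mem_Ico] at hi hj
  rw [← pow_add]
  refine pow_eq_zero_of_exponent_le hx ?_
  have h1 := Nat.le_mul_of_pos_right h hi.1
  have h2 := Nat.le_mul_of_pos_right k hj.1
  omega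

theorem truncLambert_eq_zero (hx : x ^ n = 0) {h : ℕ} (hh : n ≤ h) : truncLambert x n h = 0 := by
  refine Finset.sum_eq_zero fun m hm => pow_eq_zero_of_exponent_le hx ?_
  exact hh.trans (Nat.le_mul_of_pos_right _ (Finset.mem_Ico.1 hm).1)

/-- The contribution of the end of a word; the dual part records whether it crosses the cut `k`. -/
def dualEndTerm (a k : ℕ) (x : R) (l : ArcLetter) : DualNumber R :=
  if isSepLetter a l then 1 else
    TrivSqZeroExt.inl (x ^ arcSpan l * (1 - x)) +
      TrivSqZeroExt.inr (if crossesCut k l then x ^ arcSpan l * (1 - x) else 0)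

theorem fst_prod_dualEndTerm (a k : ℕ) (S : List ArcLetter) :
    (S.map (dualEndTerm a k x)).prod.fst = (S.map (endTerm a x)).prod := by
  induction S with
  | nil => simp
  | cons l S ih =>
    rw [List.map_cons, List.prod_cons, TrivSqZeroExt.fst_mul, ih, List.map_cons, List.prod_cons]
    congr 1
    unfold dualEndTerm endTerm
    split_ifs <;> simp

theorem snd_prod_dualEndTerm (a k : ℕ) (S : List ArcLetter) :
    (S.map (dualEndTerm a k x)).prod.snd = (S.map (endTerm a x)).prod *
      (S.countP fun l => crossesCut k l && !isSepLetter a l) := by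
  induction S with
  | nil => simp
  | cons l S ih =>
    rw [List.map_cons, List.prod_cons, TrivSqZeroExt.snd_mul, ih, fst_prod_dualEndTerm,
      List.map_cons, List.prod_cons, List.countP_cons]
    simp only [dualEndTerm, endTerm]
    by_cases h1 : isSepLetter a l <;> by_cases h2 : crossesCut k l <;> simp [h1, h2] <;> ring

/-- The sum of the contributions of the ends from a slot of gap `g` on one of the sides. -/
def slotWeight (x : R) (k g : ℕ) : DualNumber R :=
  TrivSqZeroExt.inl (x ^ g) + TrivSqZeroExt.inr (x ^ max g k)

theorem sum_pow_telescope (x : R) {g a : ℕ} (h : g ≤ a) :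
    ∑ j ∈ Finset.Ico g a, x ^ j * (1 - x) = x ^ g - x ^ a := by
  rw [← Finset.sum_mul]
  linear_combination -geom_sum_Ico_mul x h

theorem sum_source_dualEndTerm {a k : ℕ} (hx : x ^ a = 0) (hk : k ≤ a) (g : ℕ) :
    ∑ j ∈ Finset.Ioc g a, dualEndTerm a k x (some (0, j)) = slotWeight x k g := by
  rcases le_or_gt g a with hg | hg
  swap
  · rw [Finset.Ioc_eq_empty (by omega), slotWeight, pow_eq_zero_of_exponent_le hx hg.le,
      pow_eq_zero_of_exponent_le hx (hg.le.trans (le_max_left g k))]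
    simp
  have h1 : ∀ j, dualEndTerm a k x (some (0, j)) = TrivSqZeroExt.inl (x ^ (j - 1) * (1 - x)) +
      TrivSqZeroExt.inr (if k < j then x ^ (j - 1) * (1 - x) else 0) := by
    intro j
    simp [dualEndTerm, isSepLetter, isFloorLetter, isBoundedLetter, arcSpan, crossesCut]
  have h2 : ∀ f : ℕ → R, ∑ j ∈ Finset.Ioc g a, f (j - 1) = ∑ j ∈ Finset.Ico g a, f j := by
    intro f
    refine Finset.sum_bij' (fun j _ => j - 1) (fun j _ => j + 1) ?_ ?_ ?_ ?_ ?_ <;>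
      simp <;> omega
  ext
  · simp only [h1, slotWeight, TrivSqZeroExt.fst_sum, TrivSqZeroExt.fst_add, TrivSqZeroExt.fst_inl,
      TrivSqZeroExt.fst_inr, add_zero]
    rw [h2 fun j => x ^ j * (1 - x), sum_pow_telescope x hg, hx, sub_zero]
  · simp only [h1, slotWeight, TrivSqZeroExt.snd_sum, TrivSqZeroExt.snd_add, TrivSqZeroExt.snd_inl,
      TrivSqZeroExt.snd_inr, zero_add]
    rw [← Finset.sum_filter, show {j ∈ Finset.Ioc g a | k < j} = Finset.Ioc (max g k) a by
      ext j; simp; omega]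
    have h3 : ∑ j ∈ Finset.Ioc (max g k) a, x ^ (j - 1) * (1 - x) =
        ∑ j ∈ Finset.Ico (max g k) a, x ^ j * (1 - x) := by
      refine Finset.sum_bij' (fun j _ => j - 1) (fun j _ => j + 1) ?_ ?_ ?_ ?_ ?_ <;>
        simp <;> omega
    rw [h3, sum_pow_telescope x (by omega), hx, sub_zero]

theorem sum_sink_dualEndTerm {a k : ℕ} (hx : x ^ a = 0) (hk : k ≤ a) {g : ℕ} (hg : g ≤ a) :
    ∑ i ∈ Finset.Icc 1 g, dualEndTerm a k x (some (i, a + 1)) =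
      slotWeight x (a - k) (a - g) := by
  have h1 : ∀ i ∈ Finset.Icc 1 g, dualEndTerm a k x (some (i, a + 1)) =
      TrivSqZeroExt.inl (x ^ (a - i) * (1 - x)) +
        TrivSqZeroExt.inr (if i ≤ k then x ^ (a - i) * (1 - x) else 0) := by
    intro i hi
    rw [Finset.mem_Icc] at hi
    have h2 : arcSpan (some (i, a + 1)) = a - i := by
      simp only [arcSpan]
      omega
    have h3 : crossesCut k (some (i, a + 1)) = decide (i ≤ k) := by
      simp [crossesCut]
      omega
    rw [dualEndTerm, h2, h3]
    simp [isSepLetter, isFloorLetter, isBoundedLetter]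
  have h2 : ∀ r ≤ a, ∑ i ∈ Finset.Icc 1 r, x ^ (a - i) * (1 - x) = x ^ (a - r) := by
    intro r hr
    have : ∑ i ∈ Finset.Icc 1 r, x ^ (a - i) * (1 - x) =
        ∑ j ∈ Finset.Ico (a - r) a, x ^ j * (1 - x) := by
      refine Finset.sum_bij' (fun j _ => a - j) (fun j _ => a - j) ?_ ?_ ?_ ?_ ?_ <;>
        simp <;> omega
    rw [this, sum_pow_telescope x (by omega), hx, sub_zero]
  rw [Finset.sum_congr rfl h1]
  ext
  · simp only [slotWeight, TrivSqZeroExt.fst_sum, TrivSqZeroExt.fst_add, TrivSqZeroExt.fst_inl,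
      TrivSqZeroExt.fst_inr, add_zero]
    exact h2 g hg
  · simp only [slotWeight, TrivSqZeroExt.snd_sum, TrivSqZeroExt.snd_add, TrivSqZeroExt.snd_inl,
      TrivSqZeroExt.snd_inr, zero_add]
    rw [← Finset.sum_filter, show {i ∈ Finset.Icc 1 g | i ≤ k} = Finset.Icc 1 (min g k) by
      ext j; simp; omega, h2 _ (by omega)]
    congr 1
    omega

theorem slotWeight_mul_eq_zero {a k g : ℕ} (hx : x ^ a = 0) (hk : k ≤ a) (hg : g ≤ a) :
    slotWeight x k g * slotWeight x (a - k) (a - g) = 0 := by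
  have h : ∀ r s : ℕ, a ≤ r + s → x ^ r * x ^ s = 0 := fun r s hrs => by
    rw [← pow_add, pow_eq_zero_of_exponent_le hx hrs]
  ext
  · simp [slotWeight]
    exact h _ _ (by omega)
  · simp [slotWeight]
    rw [h _ _ (by omega), mul_comm, h _ _ (by omega), add_zero]

theorem completeHom_slotWeight {a b g k : ℕ} (hn : 0 < n) (hx : x ^ n = 0) (hb : n ≤ b)
    (ha : n ≤ a) (hg : 1 ≤ g) {G : List ℕ}
    (hG : (G : Multiset ℕ) = 0 ::ₘ g ::ₘ a ::ₘ ((Finset.Ico 1 a).val + (Finset.Ico 1 a).val)) :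
    completeHom b (G.map (slotWeight x k)) =
      TrivSqZeroExt.inl (truncEuler x n a ^ 2 * truncGeom x n g) *
        (1 + TrivSqZeroExt.inr (b * x ^ k + (x ^ max g k - x ^ (g + k)) * truncGeom x n g + 2 *
          ∑ h ∈ Finset.Ico 1 a, (x ^ max h k - x ^ (h + k)) * truncGeom x n h)) := by
  set Y : ℕ → DualNumber R := fun h => 1 - (1 - TrivSqZeroExt.inr (x ^ k)) * slotWeight x k h
    with hY
  set Y' : ℕ → DualNumber R := fun h => TrivSqZeroExt.inl (truncGeom x n h) *
    (1 + TrivSqZeroExt.inr ((x ^ max h k - x ^ (h + k)) * truncGeom x n h)) with hY'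
  have hYY : ∀ h, 1 ≤ h → Y h * Y' h = 1 := by
    intro h hh
    have h1 := mul_truncGeom hx hh
    ext
    · simp [hY, hY', slotWeight]
      exact h1
    · simp [hY, hY', slotWeight, pow_add]
      linear_combination (x ^ max h k - x ^ h * x ^ k) * truncGeom x n h * h1
  have hYa : Y a = 1 := by
    have : slotWeight x k a = 0 := by
      rw [slotWeight, pow_eq_zero_of_exponent_le hx ha,
        pow_eq_zero_of_exponent_le hx (ha.trans (le_max_left a k))]
      simp
    simp [hY, this]
  have hlist : G.Perm (0 :: g :: a :: ((Finset.Ico 1 a).toList ++ (Finset.Ico 1 a).toList)) := by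
    rw [← Multiset.coe_eq_coe, hG]
    simp only [← Multiset.cons_coe, ← Multiset.coe_add, Finset.coe_toList]
  rw [completeHom_perm (hlist.map _), List.map_cons]
  have hnil : (TrivSqZeroExt.inl x : DualNumber R) ^ n = 0 := by
    have := map_pow (TrivSqZeroExt.inlHom R R) x n
    rw [hx, map_zero] at this
    exact this.symm
  have huz : slotWeight x k 0 * (1 - TrivSqZeroExt.inr (x ^ k)) = 1 := by
    ext <;> simp [slotWeight]
  have hdvd : ∀ v ∈ (g :: a :: ((Finset.Ico 1 a).toList ++ (Finset.Ico 1 a).toList)).map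
      (slotWeight x k), TrivSqZeroExt.inl x ∣ v := by
    intro v hv
    obtain ⟨h, hh, rfl⟩ := List.mem_map.1 hv
    have hh : 1 ≤ h := by
      simp at hh
      omega
    refine ⟨slotWeight x (max h k - 1) (h - 1), ?_⟩
    rw [slotWeight, slotWeight, mul_add, ← TrivSqZeroExt.inl_mul, TrivSqZeroExt.inl_mul_inr,
      smul_eq_mul, ← pow_succ', ← pow_succ']
    congr 3 <;> omega
  have key := completeHom_cons_mul_prod hn hnil hb huz _ hdvd
  rw [List.map_map] at key
  have hprod : ∀ f : ℕ → DualNumber R,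
      ((g :: a :: ((Finset.Ico 1 a).toList ++ (Finset.Ico 1 a).toList)).map f).prod =
        f g * (f a * (∏ h ∈ Finset.Ico 1 a, f h) ^ 2) := by
    intro f
    simp [Finset.prod_map_toList, pow_two]
  have hu : slotWeight x k 0 ^ b = 1 + TrivSqZeroExt.inr (b * x ^ k) := by
    clear key hb
    induction b with
    | zero => simp
    | succ b ih =>
      rw [pow_succ, ih]
      ext
      · simp [slotWeight]
      · simp [slotWeight]
        ring
  have hI : (∏ h ∈ Finset.Ico 1 a, Y h) * ∏ h ∈ Finset.Ico 1 a, Y' h = 1 := by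
    rw [← Finset.prod_mul_distrib]
    exact Finset.prod_eq_one fun h hh => hYY h (Finset.mem_Ico.1 hh).1
  have hY'prod : ∏ h ∈ Finset.Ico 1 a, Y' h = TrivSqZeroExt.inl (truncEuler x n a) *
      (1 + TrivSqZeroExt.inr
        (∑ h ∈ Finset.Ico 1 a, (x ^ max h k - x ^ (h + k)) * truncGeom x n h)) := by
    rw [hY', Finset.prod_mul_distrib, truncEuler]
    congr 1
    · exact (map_prod (TrivSqZeroExt.inlHom R R) _ _).symm
    · generalize Finset.Ico 1 a = s
      induction s using Finset.induction_on with
      | empty => simp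
      | insert h s hs ih =>
        rw [Finset.prod_insert hs, Finset.sum_insert hs, ih]
        ext <;> simp [add_comm]
  have hkey : completeHom b (slotWeight x k 0 :: (g :: a :: ((Finset.Ico 1 a).toList ++
      (Finset.Ico 1 a).toList)).map (slotWeight x k)) *
        (Y g * (∏ h ∈ Finset.Ico 1 a, Y h) ^ 2) = 1 + TrivSqZeroExt.inr (b * x ^ k) := by
    rw [← hu, ← key]
    congr 1
    rw [show ((fun v => 1 - (1 - TrivSqZeroExt.inr (x ^ k)) * v) ∘ slotWeight x k) = Y from rfl,
      hprod, hYa, one_mul]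
  set H := completeHom b (slotWeight x k 0 :: (g :: a :: ((Finset.Ico 1 a).toList ++
      (Finset.Ico 1 a).toList)).map (slotWeight x k))
  have hH : H = (1 + TrivSqZeroExt.inr (b * x ^ k)) * (Y' g * (∏ h ∈ Finset.Ico 1 a, Y' h) ^ 2) := by
    rw [← hkey]
    have h1 := hYY g hg
    have h2 : (∏ h ∈ Finset.Ico 1 a, Y h) ^ 2 * (∏ h ∈ Finset.Ico 1 a, Y' h) ^ 2 = 1 := by
      rw [← mul_pow, hI, one_pow]
    calc H = H * ((Y g * Y' g) * ((∏ h ∈ Finset.Ico 1 a, Y h) ^ 2 *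
          (∏ h ∈ Finset.Ico 1 a, Y' h) ^ 2)) := by rw [h1, h2, mul_one, mul_one]
      _ = _ := by ring
  rw [hH, hY'prod, hY']
  ext
  · simp [pow_two]
    ring
  · simp [pow_two]
    ring

theorem map_sub_Ico_val (a : ℕ) :
    (Finset.Ico 1 a).val.map (fun h => a - h) = (Finset.Ico 1 a).val := by
  refine Multiset.Nodup.ext ?_ (Finset.nodup _) |>.2 fun h => ?_
  · refine Multiset.Nodup.map_on ?_ (Finset.nodup _)
    simp only [Finset.mem_val, Finset.mem_Ico]
    omega
  · simp only [Multiset.mem_map, Finset.mem_val, Finset.mem_Ico]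
    exact ⟨by rintro ⟨h, h1, rfl⟩; omega, fun h1 => ⟨a - h, by omega, by omega⟩⟩

theorem coe_slotGaps_sepsWith {a p : ℕ} {e : ℕ × ℕ} (he : e ∈ extraEdges a)
    (hp : p ∈ insertPositions e) : (slotGaps 0 (sepsWith a e p) : Multiset ℕ) =
      0 ::ₘ ((p + 1) / 2) ::ₘ a ::ₘ ((Finset.Ico 1 a).val + (Finset.Ico 1 a).val) := by
  have hgap := gap_of_mem_insertPositions he hp
  have he' := mem_extraEdges.1 he
  rw [sepsWith, Multiset.coe_eq_coe.2 (slotGaps_append_cons _ _ _ _), List.take_append_drop,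
    countP_take_chainSeps hgap.2.2, ← Multiset.cons_coe, coe_slotGaps_chainSeps,
    Multiset.cons_swap, show 0 + (a - 1) + 1 = a by omega, show 0 + 1 + (a - 1) = a by omega,
    zero_add, zero_add]

theorem sum_fillings_dualEndTerm {δ a b p k : ℕ} {e : ℕ × ℕ} (hn : 0 < n) (hx : x ^ n = 0)
    (ha : n ≤ a) (hb : n ≤ b) (he : e ∈ extraEdges a) (hp : p ∈ insertPositions e) (hk : 1 ≤ k)
    (hka : k < a) {g : ℕ} (hg : (p + 1) / 2 = g) :
    ∑ S ∈ fillings a (2 * a + b + (b + δ * a)) (sepsWith a e p) 0 b (b + δ * a),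
        (S.map (dualEndTerm a k x)).prod =
      TrivSqZeroExt.inl (truncEuler x n a ^ 2 * truncGeom x n g) *
        (1 + TrivSqZeroExt.inr (b * x ^ k + (x ^ max g k - x ^ (g + k)) * truncGeom x n g + 2 *
          ∑ h ∈ Finset.Ico 1 a, (x ^ max h k - x ^ (h + k)) * truncGeom x n h)) *
      (TrivSqZeroExt.inl (truncEuler x n a ^ 2 * truncGeom x n (a - g)) *
        (1 + TrivSqZeroExt.inr ((b + δ * a : ℕ) * x ^ (a - k) +
          (x ^ max (a - g) (a - k) - x ^ (a - g + (a - k))) * truncGeom x n (a - g) + 2 *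
          ∑ h ∈ Finset.Ico 1 a, (x ^ max h (a - k) - x ^ (h + (a - k))) * truncGeom x n h))) := by
  have hgap := gap_of_mem_insertPositions he hp
  have he' := mem_extraEdges.1 he
  have hxa := pow_eq_zero_of_exponent_le hx ha
  have hG := coe_slotGaps_sepsWith he hp
  rw [hg] at hG
  rw [sum_fillings a (dualEndTerm a k x) (u := slotWeight x k)
    (v := fun g => slotWeight x (a - k) (a - g)) (fun s hs => by simp [dualEndTerm, hs])
    (sum_source_dualEndTerm hxa hka.le) (fun g hg => sum_sink_dualEndTerm hxa hka.le hg)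
    (fun g hg => slotWeight_mul_eq_zero hxa hka.le hg)
    (fun s hs => isSepLetter_sepsWith (by omega) he hs),
    completeHom_slotWeight hn hx hb ha (by omega) hG]
  · congr 1
    have hmap : (slotGaps 0 (sepsWith a e p)).map (fun g => slotWeight x (a - k) (a - g)) =
        ((slotGaps 0 (sepsWith a e p)).map fun g => a - g).map (slotWeight x (a - k)) := by
      rw [List.map_map]
      rfl
    rw [hmap]
    refine completeHom_slotWeight hn hx (hb.trans (Nat.le_add_right _ _)) ha (by omega) ?_
    rw [← Multiset.map_coe, hG]
    simp only [Multiset.map_cons, Multiset.map_add, map_sub_Ico_val, Nat.sub_zero, Nat.sub_self]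
    rw [Multiset.cons_swap (a - g), Multiset.cons_swap a 0, Multiset.cons_swap a (a - g)]
  · rw [(sepsWith_perm a e p).countP_eq, List.countP_cons, countP_floor_chainSeps]
    simp [isFloorLetter]
    omega
  · rw [(sepsWith_perm a e p).length_eq, List.length_cons, length_chainSeps]
    omega

theorem sum_crossing_terms (hn : 0 < n) (hx : x ^ n = 0) {a g : ℕ} (b : ℕ) (hg : 1 ≤ g)
    (hga : g < a) :
    truncGeom x n g * (b * x ^ g + (x ^ max g g - x ^ (g + g)) * truncGeom x n g + 2 *
      ∑ h ∈ Finset.Ico 1 a, (x ^ max h g - x ^ (h + g)) * truncGeom x n h) =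
    (b + 1 + 2 * g) * truncLambert x n g + 2 * ∑ h ∈ Finset.Ico (g + 1) a, truncLambert x n h := by
  have h1 : ∑ h ∈ Finset.Ico 1 a, (x ^ max h g - x ^ (h + g)) * truncGeom x n h =
      g * x ^ g + (1 - x ^ g) * ∑ h ∈ Finset.Ico (g + 1) a, truncLambert x n h := by
    rw [← Finset.sum_Ico_consecutive _ (show 1 ≤ g + 1 by omega) (show g + 1 ≤ a by omega)]
    congr 1
    · rw [Finset.sum_congr rfl (g := fun _ => x ^ g)]
      · simp
      · intro h hh
        rw [Finset.mem_Ico] at hh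
        rw [max_eq_right (by omega), pow_add]
        linear_combination x ^ g * mul_truncGeom hx (show 0 < h by omega)
    · rw [Finset.mul_sum]
      refine Finset.sum_congr rfl fun h hh => ?_
      rw [Finset.mem_Ico] at hh
      rw [max_eq_left (by omega), ← pow_mul_truncGeom hn hx (show 0 < h by omega), pow_add]
      ring
  rw [h1, max_self, pow_add]
  linear_combination (b + 1 + 2 * g : R) * pow_mul_truncGeom hn hx (show 0 < g by omega) +
    (x ^ g * truncGeom x n g + 2 * ∑ h ∈ Finset.Ico (g + 1) a, truncLambert x n h) *
      mul_truncGeom hx (show 0 < g by omega)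

theorem sum_prod_endTerm {δ a b p g : ℕ} {e : ℕ × ℕ} (hn : 0 < n) (hx : x ^ n = 0)
    (ha : n ≤ a) (hb : n ≤ b) (he : e ∈ extraEdges a) (hp : p ∈ insertPositions e)
    (hg : (p + 1) / 2 = g) :
    ∑ S ∈ fillings a (2 * a + b + (b + δ * a)) (sepsWith a e p) 0 b (b + δ * a),
        (S.map (endTerm a x)).prod =
      truncEuler x n a ^ 4 * (1 + truncLambert x n g + truncLambert x n (a - g)) := by
  have he' := mem_extraEdges.1 he
  have hgap := gap_of_mem_insertPositions he hp
  have h := congrArg TrivSqZeroExt.fst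
    (sum_fillings_dualEndTerm (δ := δ) hn hx ha hb he hp le_rfl (by omega) hg)
  simp only [TrivSqZeroExt.fst_sum, fst_prod_dualEndTerm] at h
  rw [h]
  simp
  rw [truncGeom_eq hn, truncGeom_eq hn]
  linear_combination truncEuler x n a ^ 4 *
    truncLambert_mul_eq_zero hx (show n ≤ g + (a - g) by omega)

theorem sum_prod_endTerm_mul_countP {δ a b g : ℕ} (hn : 0 < n) (hx : x ^ n = 0)
    (ha : n ≤ a) (hb : n ≤ b) (hg : 1 ≤ g) (hga : g < a) :
    ∑ S ∈ fillings a (2 * a + b + (b + δ * a)) (sepsWith a (g, g + 1) (2 * g - 1)) 0 b (b + δ * a),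
        (S.map (endTerm a x)).prod * (S.countP fun l => crossesCut g l && !isSepLetter a l) =
      truncEuler x n a ^ 4 * ((b + 1 + 2 * g) * truncLambert x n g +
        2 * ∑ h ∈ Finset.Ico (g + 1) a, truncLambert x n h +
        ((b + δ * a : ℕ) + 1 + 2 * (a - g : ℕ)) * truncLambert x n (a - g) +
        2 * ∑ h ∈ Finset.Ico (a - g + 1) a, truncLambert x n h) := by
  have he : (g, g + 1) ∈ extraEdges a := mem_extraEdges.2 (by simp only; omega)
  have hp : 2 * g - 1 ∈ insertPositions (g, g + 1) := by simp [insertPositions]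
  have h := congrArg TrivSqZeroExt.snd
    (sum_fillings_dualEndTerm (δ := δ) hn hx ha hb he hp hg hga (g := g) (by omega))
  simp only [TrivSqZeroExt.snd_sum, snd_prod_dualEndTerm] at h
  rw [h]
  have e1 := sum_crossing_terms hn hx b hg hga
  have e2 := sum_crossing_terms hn hx (b + δ * a) (show 1 ≤ a - g by omega) (show a - g < a by omega)
  have z0 := truncLambert_mul_eq_zero hx (show n ≤ g + (a - g) by omega)
  have z1 : truncLambert x n g * ∑ h ∈ Finset.Ico (a - g + 1) a, truncLambert x n h = 0 := by
    rw [Finset.mul_sum]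
    refine Finset.sum_eq_zero fun h hh => truncLambert_mul_eq_zero hx ?_
    rw [Finset.mem_Ico] at hh
    omega
  have z2 : truncLambert x n (a - g) * ∑ h ∈ Finset.Ico (g + 1) a, truncLambert x n h = 0 := by
    rw [Finset.mul_sum]
    refine Finset.sum_eq_zero fun h hh => truncLambert_mul_eq_zero hx ?_
    rw [Finset.mem_Ico] at hh
    omega
  simp only [TrivSqZeroExt.snd_mul, TrivSqZeroExt.fst_mul, TrivSqZeroExt.fst_inl,
    TrivSqZeroExt.snd_inl, TrivSqZeroExt.fst_add, TrivSqZeroExt.snd_add, TrivSqZeroExt.fst_inr,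
    TrivSqZeroExt.snd_inr, TrivSqZeroExt.fst_one, TrivSqZeroExt.snd_one, smul_eq_mul,
    MulOpposite.smul_eq_mul_unop, MulOpposite.unop_op, add_zero, zero_add, mul_one]
  have e3 := truncGeom_eq (x := x) hn g
  have e4 := truncGeom_eq (x := x) hn (a - g)
  generalize (b * x ^ g + (x ^ max g g - x ^ (g + g)) * truncGeom x n g + 2 *
      ∑ h ∈ Finset.Ico 1 a, (x ^ max h g - x ^ (h + g)) * truncGeom x n h) = c1 at *
  generalize ((b + δ * a : ℕ) * x ^ (a - g) +
          (x ^ max (a - g) (a - g) - x ^ (a - g + (a - g))) * truncGeom x n (a - g) + 2 *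
          ∑ h ∈ Finset.Ico 1 a, (x ^ max h (a - g) - x ^ (h + (a - g))) * truncGeom x n h) = c2 at *
  generalize ∑ h ∈ Finset.Ico (a - g + 1) a, truncLambert x n h = s2 at *
  generalize ∑ h ∈ Finset.Ico (g + 1) a, truncLambert x n h = s1 at *
  generalize truncLambert x n g = l1 at *
  generalize truncLambert x n (a - g) = l2 at *
  rw [e3] at e1 ⊢
  rw [e4] at e2 ⊢
  linear_combination truncEuler x n a ^ 4 * ((1 + l2) * e1 + (1 + l1) * e2 +
    ((b + 1 + 2 * g : R) + ((b + δ * a : ℕ) + 1 + 2 * (a - g : ℕ))) * z0 + 2 * z1 + 2 * z2)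

end evaluation

section

variable {R : Type*} [CommRing R] {x : R} {n : ℕ}

theorem sum_Ico_mul_pow (y : R) (N : ℕ) :
    (1 - y) * ∑ m ∈ Finset.Ico 1 (N + 1), (m : R) * y ^ m =
      ∑ m ∈ Finset.Ico 1 (N + 1), y ^ m - N * y ^ (N + 1) := by
  induction N with
  | zero => simp
  | succ N ih =>
    rw [Finset.sum_Ico_succ_top (show 1 ≤ N + 1 by omega),
      Finset.sum_Ico_succ_top (show 1 ≤ N + 1 by omega), mul_add, ih]
    push_cast
    ring

theorem sum_mul_truncLambert (hn : 0 < n) (hx : x ^ n = 0) :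
    ∑ g ∈ Finset.Ico 1 n, (g : R) * truncLambert x n g =
      ∑ g ∈ Finset.Ico 1 n, (truncLambert x n g + truncLambert x n g ^ 2) := by
  have h1 : ∀ g ∈ Finset.Ico 1 n, truncLambert x n g + truncLambert x n g ^ 2 =
      ∑ m ∈ Finset.Ico 1 n, (m : R) * x ^ (g * m) := by
    intro g hg
    have hg := (Finset.mem_Ico.1 hg).1
    have h2 := sum_Ico_mul_pow (x ^ g) (n - 1)
    rw [Nat.sub_add_cancel hn] at h2
    simp only [← pow_mul] at h2
    rw [pow_eq_zero_of_exponent_le hx (Nat.le_mul_of_pos_left n hg), mul_zero, sub_zero] at h2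
    change _ = truncLambert x n g at h2
    have h3 := mul_truncGeom hx (show 0 < g from hg)
    have h4 := truncGeom_eq (x := x) hn g
    linear_combination (∑ m ∈ Finset.Ico 1 n, (m : R) * x ^ (g * m)) * h3 -
      truncGeom x n g * h2 - truncLambert x n g * h4
  rw [Finset.sum_congr rfl h1, Finset.sum_comm]
  refine Finset.sum_congr rfl fun m _ => ?_
  rw [truncLambert, Finset.mul_sum]
  exact Finset.sum_congr rfl fun g _ => by rw [mul_comm m g]

theorem sum_Ico_eq_of_le {f : ℕ → R} {a : ℕ} (hn : 0 < n) (ha : n ≤ a)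
    (hf : ∀ g, n ≤ g → f g = 0) : ∑ g ∈ Finset.Ico 1 a, f g = ∑ g ∈ Finset.Ico 1 n, f g := by
  rw [← Finset.sum_Ico_consecutive _ (show 1 ≤ n from hn) ha,
    Finset.sum_eq_zero (s := Finset.Ico n a) fun g hg => hf g (Finset.mem_Ico.1 hg).1, add_zero]

theorem sum_Ico_reflect_sub (f : ℕ → R) (a : ℕ) :
    ∑ g ∈ Finset.Ico 1 a, f (a - g) = ∑ g ∈ Finset.Ico 1 a, f g := by
  refine Finset.sum_bij' (fun g _ => a - g) (fun g _ => a - g) ?_ ?_ ?_ ?_ ?_ <;> simp <;> omega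

theorem sum_weights_short_edge (hx : x ^ n = 0) {F : ℕ} (hF : 0 < F) (hnF : n ≤ F) :
    ∑ w ∈ Finset.Ico 1 F, (1 - x ^ w) ^ 2 * (1 - x ^ (F - w)) ^ 2 =
      (F : R) - 1 + 2 * ∑ w ∈ Finset.Ico 1 F, ((1 - x ^ w) ^ 2 - 1) := by
  have h1 : ∀ w ∈ Finset.Ico 1 F, (1 - x ^ w) ^ 2 * (1 - x ^ (F - w)) ^ 2 =
      1 + ((1 - x ^ w) ^ 2 - 1) + ((1 - x ^ (F - w)) ^ 2 - 1) := by
    intro w hw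
    rw [Finset.mem_Ico] at hw
    have h2 : x ^ w * x ^ (F - w) = 0 := by
      rw [← pow_add]
      exact pow_eq_zero_of_exponent_le hx (by omega)
    linear_combination (x ^ w - 2) * (x ^ (F - w) - 2) * h2
  rw [Finset.sum_congr rfl h1, Finset.sum_add_distrib, Finset.sum_add_distrib,
    sum_Ico_reflect_sub (fun w => (1 - x ^ w) ^ 2 - 1)]
  simp [Nat.cast_sub (show 1 ≤ F from hF)]
  ring

theorem sum_edges_over_gap (y : R) {a g : ℕ} (hga : g ≤ a) :
    ∑ i ∈ Finset.Icc 1 g, ∑ j ∈ Finset.Ioc g a, y ^ (j - i - 1) * (1 - y) ^ 2 =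
      (1 - y ^ g) * (1 - y ^ (a - g)) := by
  have h1 : ∑ i ∈ Finset.Icc 1 g, y ^ (g - i) * (1 - y) = 1 - y ^ g := by
    rw [← pow_zero y, ← sum_pow_telescope y (Nat.zero_le g)]
    refine Finset.sum_bij' (fun i _ => g - i) (fun i _ => g - i) ?_ ?_ ?_ ?_ ?_ <;> simp <;> omega
  have h2 : ∑ j ∈ Finset.Ioc g a, y ^ (j - g - 1) * (1 - y) = 1 - y ^ (a - g) := by
    rw [← pow_zero y, ← sum_pow_telescope y (Nat.zero_le (a - g))]
    refine Finset.sum_bij' (fun j _ => j - g - 1) (fun j _ => g + j + 1) ?_ ?_ ?_ ?_ ?_ <;>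
      simp <;> omega
  rw [← h1, ← h2, Finset.sum_mul_sum]
  refine Finset.sum_congr rfl fun i hi => Finset.sum_congr rfl fun j hj => ?_
  rw [Finset.mem_Icc] at hi
  rw [Finset.mem_Ioc] at hj
  rw [show j - i - 1 = (g - i) + (j - g - 1) by omega, pow_add]
  ring

theorem sum_positions (f : ℕ → R) {i j : ℕ} (hi : 1 ≤ i) (hij : i ≤ j) :
    ∑ p ∈ Finset.Ico (2 * i - 1) (2 * j - 1), f ((p + 1) / 2) = 2 * ∑ g ∈ Finset.Ico i j, f g := by
  induction j, hij using Nat.le_induction with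
  | base => simp
  | succ j hij ih =>
    rw [Finset.sum_Ico_succ_top hij, show 2 * (j + 1) - 1 = 2 * j - 1 + 1 + 1 by omega,
      Finset.sum_Ico_succ_top (by omega), Finset.sum_Ico_succ_top (by omega), ih,
      show (2 * j - 1 + 1) / 2 = j by omega, show (2 * j - 1 + 1 + 1) / 2 = j by omega]
    ring

/-- The sum of the contributions of the weights of a long edge. -/
def longEdgeSum (x : R) (n : ℕ) (e : ℕ × ℕ) : R :=
  ∑ w ∈ Finset.Ico 1 n, x ^ (w * (e.2 - e.1 - 1)) * (1 - x ^ w) ^ 2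

theorem sum_longEdgeSum (hn : 0 < n) (hx : x ^ n = 0) {a g : ℕ} (hna : n ≤ a) (hga : g ≤ a) :
    ∑ i ∈ Finset.Icc 1 g, ∑ j ∈ Finset.Ioc g a, longEdgeSum x n (i, j) =
      n - 1 - truncLambert x n g - truncLambert x n (a - g) := by
  simp only [longEdgeSum]
  have h1 : ∑ i ∈ Finset.Icc 1 g, ∑ j ∈ Finset.Ioc g a, ∑ w ∈ Finset.Ico 1 n,
      x ^ (w * (j - i - 1)) * (1 - x ^ w) ^ 2 =
      ∑ w ∈ Finset.Ico 1 n, ((1 - (x ^ w) ^ g) * (1 - (x ^ w) ^ (a - g))) := by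
    simp only [← sum_edges_over_gap _ hga, pow_mul]
    simp only [Finset.sum_comm (s := Finset.Ioc g a)]
    rw [Finset.sum_comm]
  rw [h1]
  have h2 : ∀ w ∈ Finset.Ico 1 n, (1 - (x ^ w) ^ g) * (1 - (x ^ w) ^ (a - g)) =
      1 - x ^ (g * w) - x ^ ((a - g) * w) := by
    intro w hw
    have h3 : (x ^ w) ^ g * (x ^ w) ^ (a - g) = 0 := by
      rw [← pow_add, ← pow_mul]
      refine pow_eq_zero_of_exponent_le hx ?_
      rw [Nat.add_sub_cancel' hga]
      exact hna.trans (Nat.le_mul_of_pos_left _ (Finset.mem_Ico.1 hw).1)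
    rw [mul_comm g, mul_comm (a - g), pow_mul, pow_mul]
    linear_combination h3
  rw [Finset.sum_congr rfl h2, Finset.sum_sub_distrib, Finset.sum_sub_distrib, truncLambert,
    truncLambert]
  simp [Nat.cast_sub (show 1 ≤ n from hn)]

variable {δ a b p : ℕ} {e : ℕ × ℕ}

theorem sum_fillings_short_edge (hn : 0 < n) (hx : x ^ n = 0) (ha : n ≤ a) (hb : 3 * n ≤ b)
    {g : ℕ} (hg : 1 ≤ g) (hga : g < a) :
    ∑ S ∈ fillings a (2 * a + b + (b + δ * a)) (sepsWith a (g, g + 1) (2 * g - 1)) 0 b (b + δ * a),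
        (S.map (endTerm a x)).prod * ∑ w ∈ Finset.Ico 1 (weightBound δ a b n (g, g + 1) S),
          extraTerm δ a b x (g, g + 1) w S =
      truncEuler x n a ^ 4 * ((1 + truncLambert x n g + truncLambert x n (a - g)) *
          (b + δ * g - 1 + 2 * (longEdgeSum x n (g, g + 1) - (n - 1))) -
        ((b + 1 + 2 * g) * truncLambert x n g +
          2 * ∑ h ∈ Finset.Ico (g + 1) a, truncLambert x n h +
          ((b + δ * a : ℕ) + 1 + 2 * (a - g : ℕ)) * truncLambert x n (a - g) +
          2 * ∑ h ∈ Finset.Ico (a - g + 1) a, truncLambert x n h)) := by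
  have he : (g, g + 1) ∈ extraEdges a := mem_extraEdges.2 (by simp only; omega)
  have hp : 2 * g - 1 ∈ insertPositions (g, g + 1) := by simp [insertPositions]
  rw [mul_sub, ← mul_assoc, ← sum_prod_endTerm_mul_countP hn hx ha (by omega) hg hga,
    ← sum_prod_endTerm (δ := δ) hn hx ha (by omega : n ≤ b) he hp (by omega), Finset.sum_mul,
    ← Finset.sum_sub_distrib]
  refine Finset.sum_congr rfl fun S _ => ?_
  rw [← mul_sub]
  by_cases h0 : (S.map (endTerm a x)).prod = 0
  · rw [h0, zero_mul, zero_mul]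
  congr 1
  have h1 := countP_crossing_le_endSpan hg hga S
  have h2 := endSpan_lt_of_prod_ne_zero hx h0
  have h3 : freeFlux δ a b g S + S.countP (fun l => crossesCut g l && !isSepLetter a l) =
      b + δ * g := by
    unfold freeFlux
    omega
  have h4 : 2 * n ≤ freeFlux δ a b g S := by omega
  simp only [weightBound, extraTerm, if_true]
  rw [sum_weights_short_edge hx (by omega) (by omega), sum_Ico_eq_of_le hn (by omega)]
  · have h5 : (freeFlux δ a b g S : R) +
        (S.countP (fun l => crossesCut g l && !isSepLetter a l) : ℕ) = b + δ * g := by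
      exact_mod_cast congrArg (Nat.cast : ℕ → R) h3
    rw [longEdgeSum, Finset.sum_sub_distrib]
    simp [Nat.cast_sub (show 1 ≤ n from hn)]
    linear_combination h5
  · intro w hw
    rw [pow_eq_zero_of_exponent_le hx hw]
    ring

theorem sum_extraEdges_short (f : ℕ → R) :
    ∑ e ∈ extraEdges a, (if e.2 = e.1 + 1 then f e.1 else 0) = ∑ g ∈ Finset.Ico 1 a, f g := by
  rw [← Finset.sum_filter]
  refine Finset.sum_bij' (fun e _ => e.1) (fun g _ => (g, g + 1)) ?_ ?_ ?_ ?_ ?_ <;>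
    simp [mem_extraEdges] <;> omega

theorem sum_extraEdges_gaps (f : ℕ → R) (v : ℕ × ℕ → R) :
    ∑ e ∈ extraEdges a, ∑ g ∈ Finset.Ico e.1 e.2, f g * v e =
      ∑ g ∈ Finset.Ico 1 a, f g * ∑ i ∈ Finset.Icc 1 g, ∑ j ∈ Finset.Ioc g a, v (i, j) := by
  simp only [← Finset.sum_product', Finset.mul_sum]
  rw [Finset.sum_sigma', Finset.sum_sigma']
  refine Finset.sum_bij' (fun q _ => ⟨q.2, q.1⟩) (fun q _ => ⟨q.2, q.1⟩) ?_ ?_ ?_ ?_ ?_ <;>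
    simp [mem_extraEdges] <;> omega

theorem map_refinedSeries_eq_sum_gaps (φ : ℤ⟦X⟧ →+* R) (hφ : φ PowerSeries.X = x) (hn : 0 < n)
    (hx : x ^ n = 0) (ha : n ≤ a) (hb : 3 * n ≤ b) :
    φ (refinedSeries δ 1 a b) = truncEuler x n a ^ 4 * ∑ g ∈ Finset.Ico 1 a,
      ((1 + truncLambert x n g + truncLambert x n (a - g)) *
          (b + δ * g - 1 - 2 * (truncLambert x n g + truncLambert x n (a - g))) -
        ((b + 1 + 2 * g) * truncLambert x n g +
          2 * ∑ h ∈ Finset.Ico (g + 1) a, truncLambert x n h +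
          ((b + δ * a : ℕ) + 1 + 2 * (a - g : ℕ)) * truncLambert x n (a - g) +
          2 * ∑ h ∈ Finset.Ico (a - g + 1) a, truncLambert x n h)) := by
  set Z : ℕ → R := fun g => 1 + truncLambert x n g + truncLambert x n (a - g) with hZ
  set N : ℕ → R := fun g => (b + 1 + 2 * g) * truncLambert x n g +
          2 * ∑ h ∈ Finset.Ico (g + 1) a, truncLambert x n h +
          ((b + δ * a : ℕ) + 1 + 2 * (a - g : ℕ)) * truncLambert x n (a - g) +
          2 * ∑ h ∈ Finset.Ico (a - g + 1) a, truncLambert x n h with hN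
  have hedge : ∀ e ∈ extraEdges a, ∑ p ∈ insertPositions e,
      ∑ S ∈ fillings a (2 * a + b + (b + δ * a)) (sepsWith a e p) 0 b (b + δ * a),
        (S.map (endTerm a x)).prod * ∑ w ∈ Finset.Ico 1 (weightBound δ a b n e S),
          extraTerm δ a b x e w S =
      truncEuler x n a ^ 4 * (2 * ∑ g ∈ Finset.Ico e.1 e.2, Z g * longEdgeSum x n e +
        if e.2 = e.1 + 1 then Z e.1 * (b + δ * e.1 - 1 - 2 * (n - 1)) - N e.1 else 0) := by
    intro e he
    have he' := mem_extraEdges.1 he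
    split_ifs with hshort
    · obtain ⟨g, j⟩ := e
      simp only at hshort he'
      subst hshort
      rw [insertPositions, if_pos rfl, Finset.sum_singleton,
        sum_fillings_short_edge hn hx ha hb he'.1 (by omega)]
      simp only [Nat.Ico_succ_singleton, Finset.sum_singleton, hZ, hN]
      ring
    · have h1 : ∀ p ∈ insertPositions e,
          ∑ S ∈ fillings a (2 * a + b + (b + δ * a)) (sepsWith a e p) 0 b (b + δ * a),
            (S.map (endTerm a x)).prod * ∑ w ∈ Finset.Ico 1 (weightBound δ a b n e S),
              extraTerm δ a b x e w S =
          truncEuler x n a ^ 4 * (Z ((p + 1) / 2) * longEdgeSum x n e) := by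
        intro p hp
        simp only [weightBound, extraTerm, if_neg hshort]
        rw [← Finset.sum_mul, sum_prod_endTerm hn hx ha (by omega) he hp rfl, mul_assoc]
        rfl
      rw [Finset.sum_congr rfl h1, ← Finset.mul_sum, insertPositions, if_neg hshort,
        sum_positions (fun g => Z g * longEdgeSum x n e) he'.1 he'.2.1.le, add_zero]
  rw [map_refinedSeries_eq_sum_extraEdges φ (by rw [hφ]; exact hx) (by omega) hb, hφ,
    Finset.sum_congr rfl hedge, ← Finset.mul_sum, Finset.sum_add_distrib, ← Finset.mul_sum,
    sum_extraEdges_gaps, sum_extraEdges_short fun g => Z g * (b + δ * g - 1 - 2 * (n - 1)) - N g,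
    Finset.mul_sum, ← Finset.sum_add_distrib]
  congr 1
  refine Finset.sum_congr rfl fun g hg => ?_
  rw [Finset.mem_Ico] at hg
  rw [sum_longEdgeSum hn hx ha hg.2.le]
  ring

theorem sum_Ico_linear (δ b a : ℕ) (ha : 0 < a) :
    ∑ g ∈ Finset.Ico 1 a, ((b : ℤ) + δ * g - 1) = gMax δ a b := by
  have h : 2 * ∑ g ∈ Finset.Ico 1 a, ((b : ℤ) + δ * g - 1) = 2 * gMax δ a b := by
    rw [two_mul_gMax]
    induction a, ha using Nat.le_induction with
    | base => simp
    | succ a ha ih =>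
      rw [Finset.sum_Ico_succ_top ha, mul_add, ih]
      push_cast
      ring
  omega

theorem map_refinedSeries_one (φ : ℤ⟦X⟧ →+* R) (hφ : φ PowerSeries.X = x) (hn : 0 < n)
    (hx : x ^ n = 0) (ha : n ≤ a) (hb : 3 * n ≤ b) :
    φ (refinedSeries δ 1 a b) = truncEuler x n n ^ 4 * ((gMax δ a b : ℤ) -
      12 * ∑ g ∈ Finset.Ico 1 n, (g : R) * truncLambert x n g) := by
  have hP : truncEuler x n a = truncEuler x n n := by
    rw [truncEuler, truncEuler, ← Finset.prod_Ico_consecutive _ (show 1 ≤ n from hn) ha,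
      Finset.prod_eq_one (s := Finset.Ico n a), mul_one]
    intro g hg
    rw [truncGeom_eq hn, truncLambert_eq_zero hx (Finset.mem_Ico.1 hg).1, add_zero]
  rw [map_refinedSeries_eq_sum_gaps φ hφ hn hx ha hb, hP]
  congr 1
  set L := truncLambert x n with hL
  have hL0 : ∀ g, n ≤ g → L g = 0 := fun g hg => truncLambert_eq_zero hx hg
  have e1 : ∑ g ∈ Finset.Ico 1 a, (g : R) * L g = ∑ g ∈ Finset.Ico 1 n, (g : R) * L g :=
    sum_Ico_eq_of_le hn ha fun g hg => by rw [hL0 g hg, mul_zero]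
  have e2 : ∑ g ∈ Finset.Ico 1 a, (L g + L g ^ 2) = ∑ g ∈ Finset.Ico 1 a, (g : R) * L g := by
    rw [e1, sum_mul_truncLambert hn hx]
    exact sum_Ico_eq_of_le hn ha fun g hg => by rw [hL0 g hg]; ring
  have e3 : ∑ g ∈ Finset.Ico 1 a, ∑ h ∈ Finset.Ico (g + 1) a, L h =
      ∑ g ∈ Finset.Ico 1 a, ((g : R) - 1) * L g := by
    rw [Finset.sum_comm' (t' := Finset.Ico 1 a) (s' := fun h => Finset.Ico 1 h)
      (by intro g h; simp only [Finset.mem_Ico]; omega)]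
    refine Finset.sum_congr rfl fun h hh => ?_
    simp [Nat.cast_sub (Finset.mem_Ico.1 hh).1]
  have e4 : ∑ g ∈ Finset.Ico 1 a, ((b : R) + δ * g - 1) = (gMax δ a b : ℤ) := by
    rw [← sum_Ico_linear δ b a (by omega)]
    push_cast
    rfl
  set q : ℕ → R := fun g => (2 * g + 4) * L g + 2 * L g ^ 2 +
    2 * ∑ h ∈ Finset.Ico (g + 1) a, L h with hq
  set d : ℕ → R := fun g => δ * g * L g with hd
  have hsummand : ∀ g ∈ Finset.Ico 1 a, (1 + L g + L (a - g)) *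
          (b + δ * g - 1 - 2 * (L g + L (a - g))) -
        ((b + 1 + 2 * g) * L g + 2 * ∑ h ∈ Finset.Ico (g + 1) a, L h +
          ((b + δ * a : ℕ) + 1 + 2 * (a - g : ℕ)) * L (a - g) +
          2 * ∑ h ∈ Finset.Ico (a - g + 1) a, L h) =
      (b + δ * g - 1) + (d g - d (a - g)) - (q g + q (a - g)) := by
    intro g hg
    rw [Finset.mem_Ico] at hg
    have h1 : L g * L (a - g) = 0 := truncLambert_mul_eq_zero hx (by omega)
    have h2 : ((a - g : ℕ) : R) = a - g := Nat.cast_sub hg.2.le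
    simp only [hq, hd]
    rw [h2]
    push_cast
    linear_combination (-4 : R) * h1
  rw [Finset.sum_congr rfl hsummand, Finset.sum_sub_distrib, Finset.sum_add_distrib, e4,
    Finset.sum_sub_distrib, Finset.sum_add_distrib, sum_Ico_reflect_sub d, sum_Ico_reflect_sub q,
    ← e1]
  have e5 : ∑ g ∈ Finset.Ico 1 a, q g = 6 * ∑ g ∈ Finset.Ico 1 a, (g : R) * L g := by
    have h1 : ∑ g ∈ Finset.Ico 1 a, q g = 2 * ∑ g ∈ Finset.Ico 1 a, (g : R) * L g +
        2 * ∑ g ∈ Finset.Ico 1 a, (L g + L g ^ 2) + 2 * ∑ g ∈ Finset.Ico 1 a, L g +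
        2 * ∑ g ∈ Finset.Ico 1 a, ∑ h ∈ Finset.Ico (g + 1) a, L h := by
      simp only [Finset.mul_sum, ← Finset.sum_add_distrib, hq]
      exact Finset.sum_congr rfl fun g _ => by ring
    have h2 : ∑ g ∈ Finset.Ico 1 a, ((g : R) - 1) * L g =
        ∑ g ∈ Finset.Ico 1 a, (g : R) * L g - ∑ g ∈ Finset.Ico 1 a, L g := by
      rw [← Finset.sum_sub_distrib]
      exact Finset.sum_congr rfl fun g _ => by ring
    rw [h1, e2, e3, h2]
    ring
  rw [e5]
  ring

end

open scoped PowerSeries.WithPiTopology in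
theorem exists_coeff_partitionSeries_eq {n d : ℕ} (hd : d < n) (s₀ : Finset ℕ) :
    ∃ s, s₀ ⊆ s ∧ PowerSeries.coeff d partitionSeries =
      PowerSeries.coeff d (∏ i ∈ s, ∑ j ∈ Finset.range n, (PowerSeries.X : ℤ⟦X⟧) ^ ((i + 1) * j)) := by
  have h := Nat.Partition.hasProd_powerSeriesMk_card_countRestricted ℤ (show 0 < n by omega)
  have h1 := ((PowerSeries.WithPiTopology.continuous_coeff ℤ d).tendsto _).comp h
  rw [nhds_discrete, Filter.tendsto_pure] at h1
  obtain ⟨s, hs, hs'⟩ := (h1.and (Filter.eventually_ge_atTop s₀)).exists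
  refine ⟨s, hs', ?_⟩
  simp only [Function.comp_apply, PowerSeries.coeff_mk] at hs
  rw [hs, partitionSeries, PowerSeries.coeff_mk, Nat.Partition.countRestricted,
    Finset.filter_true_of_mem, Finset.card_univ]
  intro p _ i hi
  have h2 : p.parts.count i * i ≤ d := by
    have h3 : Multiset.replicate (p.parts.count i) i ≤ p.parts :=
      Multiset.le_count_iff_replicate_le.1 le_rfl
    obtain ⟨t, ht⟩ := Multiset.le_iff_exists_add.1 h3
    have h4 := congrArg Multiset.sum ht
    rw [p.parts_sum, Multiset.sum_add, Multiset.sum_replicate, smul_eq_mul] at h4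
    omega
  have h5 := p.parts_pos hi
  nlinarith

theorem mk_eq_mk_iff {n : ℕ} {f g : ℤ⟦X⟧} :
    Ideal.Quotient.mk (Ideal.span {(PowerSeries.X : ℤ⟦X⟧) ^ n}) f =
      Ideal.Quotient.mk (Ideal.span {(PowerSeries.X : ℤ⟦X⟧) ^ n}) g ↔ PowerSeries.X ^ n ∣ f - g := by
  rw [Ideal.Quotient.eq, Ideal.mem_span_singleton]

theorem mk_X_pow_eq_zero (n : ℕ) :
    Ideal.Quotient.mk (Ideal.span {(PowerSeries.X : ℤ⟦X⟧) ^ n}) PowerSeries.X ^ n = 0 := by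
  rw [← map_pow, Ideal.Quotient.eq_zero_iff_mem]
  exact Ideal.mem_span_singleton_self _

theorem mk_partitionSeries {n : ℕ} (hn : 0 < n) :
    Ideal.Quotient.mk (Ideal.span {(PowerSeries.X : ℤ⟦X⟧) ^ n}) partitionSeries =
      truncEuler (Ideal.Quotient.mk (Ideal.span {(PowerSeries.X : ℤ⟦X⟧) ^ n}) PowerSeries.X) n n := by
  set φ := Ideal.Quotient.mk (Ideal.span {(PowerSeries.X : ℤ⟦X⟧) ^ n}) with hφ
  have hx : φ PowerSeries.X ^ n = 0 := mk_X_pow_eq_zero n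
  set f : ℕ → ℤ⟦X⟧ := fun i => ∑ j ∈ Finset.range n, PowerSeries.X ^ ((i + 1) * j) with hf
  have hφf : ∀ i, φ (f i) = truncGeom (φ PowerSeries.X) n (i + 1) := by
    intro i
    simp [hf, truncGeom]
  have h1 : truncEuler (φ PowerSeries.X) n n = φ (∏ i ∈ Finset.range (n - 1), f i) := by
    rw [map_prod, truncEuler, Finset.prod_Ico_eq_prod_range]
    exact Finset.prod_congr rfl fun i _ => by rw [hφf, add_comm]
  rw [h1, hφ, mk_eq_mk_iff, PowerSeries.X_pow_dvd_iff]
  intro d hd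
  obtain ⟨s, hs, hs'⟩ := exists_coeff_partitionSeries_eq hd (Finset.range (n - 1))
  rw [map_sub, hs', ← map_sub]
  refine PowerSeries.X_pow_dvd_iff.1 (mk_eq_mk_iff.1 ?_) d hd
  change φ (∏ i ∈ s, f i) = φ _
  rw [map_prod, map_prod, ← Finset.prod_subset hs]
  intro i _ hi
  rw [Finset.mem_range, not_lt] at hi
  rw [hφf, truncGeom_eq hn, truncLambert_eq_zero hx (by omega), add_zero]

theorem mk_eisensteinTwo {n : ℕ} :
    Ideal.Quotient.mk (Ideal.span {(PowerSeries.X : ℤ⟦X⟧) ^ n}) eisensteinTwo =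
      ∑ g ∈ Finset.Ico 1 n, (g : ℤ⟦X⟧ ⧸ Ideal.span {(PowerSeries.X : ℤ⟦X⟧) ^ n}) *
        truncLambert (Ideal.Quotient.mk (Ideal.span {(PowerSeries.X : ℤ⟦X⟧) ^ n}) PowerSeries.X)
          n g := by
  have h : ∑ g ∈ Finset.Ico 1 n, (g : ℤ⟦X⟧ ⧸ Ideal.span {(PowerSeries.X : ℤ⟦X⟧) ^ n}) *
        truncLambert (Ideal.Quotient.mk (Ideal.span {(PowerSeries.X : ℤ⟦X⟧) ^ n}) PowerSeries.X)
          n g = Ideal.Quotient.mk (Ideal.span {(PowerSeries.X : ℤ⟦X⟧) ^ n})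
            (∑ g ∈ Finset.Ico 1 n, ∑ m ∈ Finset.Ico 1 n,
              PowerSeries.C (g : ℤ) * PowerSeries.X ^ (g * m)) := by
    simp [truncLambert, Finset.mul_sum]
  rw [h, mk_eq_mk_iff, PowerSeries.X_pow_dvd_iff]
  intro d hd
  rw [map_sub, sub_eq_zero, eisensteinTwo, PowerSeries.coeff_mk, ArithmeticFunction.sigma_one_apply]
  simp only [map_sum, PowerSeries.coeff_C_mul, PowerSeries.coeff_X_pow]
  push_cast
  rcases Nat.eq_zero_or_pos d with rfl | hd0
  · rw [Nat.divisors_zero, Finset.sum_empty, Finset.sum_eq_zero]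
    intro g hg
    refine Finset.sum_eq_zero fun m hm => ?_
    rw [Finset.mem_Ico] at hg hm
    have : g * m ≠ 0 := Nat.mul_ne_zero (by omega) (by omega)
    rw [if_neg this.symm, mul_zero]
  have h2 : d.divisors ⊆ Finset.Ico 1 n := by
    intro g hg
    have := Nat.divisor_le hg
    have := Nat.pos_of_mem_divisors hg
    rw [Finset.mem_Ico]
    omega
  rw [← Finset.sum_subset h2]
  · refine Finset.sum_congr rfl fun g hg => ?_
    have h3 := Nat.mem_divisors.1 hg
    obtain ⟨⟨m, rfl⟩, h4⟩ := h3
    have h5 := Nat.pos_of_mem_divisors hg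
    rw [Finset.sum_eq_single m]
    · simp
    · intro m' _ hm'
      rw [if_neg, mul_zero]
      intro h6
      exact hm' (Nat.eq_of_mul_eq_mul_left h5 h6).symm
    · intro hm
      rw [Finset.mem_Ico] at hm
      have := Nat.pos_of_mul_pos_left hd0
      have := Nat.le_mul_of_pos_left m h5
      omega
  · intro g _ hg
    refine Finset.sum_eq_zero fun m _ => ?_
    rw [if_neg, mul_zero]
    rintro rfl
    exact hg (Nat.mem_divisors.2 ⟨Dvd.intro _ rfl, hd0.ne'⟩)

theorem X_pow_dvd_refinedSeries_sub {δ a b n : ℕ} (ha : n ≤ a) (hb : 3 * n ≤ b) :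
    (PowerSeries.X : ℤ⟦X⟧) ^ n ∣ refinedSeries δ 1 a b -
      partitionSeries ^ 4 * (PowerSeries.C (gMax δ a b) - 12 * eisensteinTwo) := by
  rcases Nat.eq_zero_or_pos n with rfl | hn
  · simp
  rw [← mk_eq_mk_iff, map_refinedSeries_one _ rfl hn (mk_X_pow_eq_zero n) ha hb, map_mul, map_pow,
    mk_partitionSeries hn, map_sub, map_mul, mk_eisensteinTwo]
  congr 2
  simp

theorem coeff_eval_intCast (Q : MvPolynomial (Fin 2) ℚ⟦X⟧) (k : ℕ) :
    ∃ q : MvPolynomial (Fin 2) ℚ, ∀ a b : ℤ,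
      PowerSeries.coeff k (MvPolynomial.eval ![(a : ℚ⟦X⟧), (b : ℚ⟦X⟧)] Q) =
        MvPolynomial.eval ![(a : ℚ), (b : ℚ)] q := by
  refine ⟨∑ m ∈ Q.support, MvPolynomial.monomial m (PowerSeries.coeff k (Q.coeff m)),
    fun a b => ?_⟩
  rw [MvPolynomial.eval_eq', map_sum, map_sum]
  refine Finset.sum_congr rfl fun m _ => ?_
  rw [MvPolynomial.eval_monomial, Finsupp.prod_fintype _ _ (by simp), Fin.prod_univ_two,
    Fin.prod_univ_two]
  have : Q.coeff m * (![(a : ℚ⟦X⟧), (b : ℚ⟦X⟧)] 0 ^ m 0 * ![(a : ℚ⟦X⟧), (b : ℚ⟦X⟧)] 1 ^ m 1) =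
      Q.coeff m * PowerSeries.C ((a : ℚ) ^ m 0 * (b : ℚ) ^ m 1) := by
    simp
  rw [this, PowerSeries.coeff_mul_C]
  simp

theorem eq_of_eval_eq_of_large {q : MvPolynomial (Fin 2) ℚ} {C : ℕ}
    (h : ∀ a b : ℕ, C ≤ a → C ≤ b → MvPolynomial.eval ![(a : ℚ), (b : ℚ)] q = 0) : q = 0 := by
  have hinf : (((↑) : ℕ → ℚ) '' Set.Ici C).Infinite :=
    (Set.Ici_infinite C).image Nat.cast_injective.injOn
  refine MvPolynomial.funext_set (fun _ => ((↑) : ℕ → ℚ) '' Set.Ici C) (fun _ => hinf)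
    fun x hx => ?_
  obtain ⟨a, ha, ha'⟩ := hx 0 trivial
  obtain ⟨b, hb, hb'⟩ := hx 1 trivial
  have hxe : x = ![(a : ℚ), (b : ℚ)] := by
    ext i
    fin_cases i
    · exact ha'.symm
    · exact hb'.symm
  rw [hxe, h a b ha hb, map_zero]

theorem IsAsymptoticRefinedInvariant.unique {δ g : ℕ} {A B : ℤ → ℤ → ℤ⟦X⟧}
    (hA : IsAsymptoticRefinedInvariant δ g A) (hB : IsAsymptoticRefinedInvariant δ g B) : A = B := by
  obtain ⟨⟨P, hP⟩, hA⟩ := hA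
  obtain ⟨⟨Q, hQ⟩, hB⟩ := hB
  funext a b
  rw [← sub_eq_zero]
  ext k
  obtain ⟨q, hq⟩ := coeff_eval_intCast (P - Q) k
  have hD : ∀ a b : ℤ, ((PowerSeries.coeff k (A a b - B a b) : ℤ) : ℚ) =
      MvPolynomial.eval ![(a : ℚ), (b : ℚ)] q := by
    intro a b
    rw [← hq, map_sub (MvPolynomial.eval _), ← hP, ← hQ, ← map_sub, PowerSeries.coeff_map,
      eq_intCast]
  obtain ⟨C, -, hC⟩ := hA (k + 1)
  obtain ⟨C', -, hC'⟩ := hB (k + 1)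
  have hq0 : q = 0 := by
    refine eq_of_eval_eq_of_large (C := max C C') fun a b ha hb => ?_
    have h1 := hC a b (le_of_max_le_left ha) (le_of_max_le_left hb)
      ((le_of_max_le_left hb).trans (Nat.le_add_right _ _))
    have h2 := hC' a b (le_of_max_le_right ha) (le_of_max_le_right hb)
      ((le_of_max_le_right hb).trans (Nat.le_add_right _ _))
    have h3 : (PowerSeries.X : ℤ⟦X⟧) ^ (k + 1) ∣ A a b - B a b := by
      have := dvd_sub h2 h1
      rwa [sub_sub_sub_cancel_left] at this
    have h4 := hD a b
    rw [PowerSeries.X_pow_dvd_iff.1 h3 k (Nat.lt_succ_self k)] at h4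
    simpa using h4.symm
  have h := hD a b
  rw [hq0, map_zero] at h
  exact_mod_cast h

theorem isAsymptoticRefinedInvariant_one (δ : ℕ) : IsAsymptoticRefinedInvariant δ 1
    fun a b => partitionSeries ^ 4 * (PowerSeries.C (gMax δ a b) - 12 * eisensteinTwo) := by
  refine ⟨⟨MvPolynomial.C (PowerSeries.map (Int.castRingHom ℚ) partitionSeries ^ 4) *
    (MvPolynomial.C (PowerSeries.C (1 / 2)) * ((MvPolynomial.X 0 - 1) *
      (2 * MvPolynomial.X 1 + (δ : MvPolynomial (Fin 2) ℚ⟦X⟧) * MvPolynomial.X 0 - 2)) -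
      12 * MvPolynomial.C (PowerSeries.map (Int.castRingHom ℚ) eisensteinTwo)), fun a b => ?_⟩,
    fun n => ⟨3 * n + 1, by omega, fun a b ha hb _ =>
      X_pow_dvd_refinedSeries_sub (by omega) (by omega)⟩⟩
  have h1 : PowerSeries.map (Int.castRingHom ℚ) (PowerSeries.C (gMax δ a b)) =
      PowerSeries.C (1 / 2 : ℚ) * (((a : ℚ⟦X⟧) - 1) * (2 * b + δ * a - 2)) := by
    have h2 : (gMax δ a b : ℚ) = 1 / 2 * (((a : ℚ) - 1) * (2 * b + δ * a - 2)) := by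
      have := congrArg (Int.cast : ℤ → ℚ) (two_mul_gMax δ a b)
      push_cast at this
      linear_combination this / 2
    have h3 : (PowerSeries.C (2 : ℚ)) = 2 := map_ofNat _ 2
    rw [PowerSeries.map_C, eq_intCast, h2, map_mul]
    simp [h3]
  have h4 : PowerSeries.map (Int.castRingHom ℚ) 12 = 12 := map_ofNat _ 12
  rw [map_mul, map_pow, map_sub, h1, map_mul, h4]
  simp

theorem theorem5p3 (δ : ℕ) :
    IsAsymptoticRefinedInvariant δ 1
      (fun a b => partitionSeries ^ 4 * (PowerSeries.C (gMax δ a b) - 12 * eisensteinTwo)) ∧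
    ∀ A : ℤ → ℤ → ℤ⟦X⟧, IsAsymptoticRefinedInvariant δ 1 A →
      ∀ a b : ℤ,
        A a b = partitionSeries ^ 4 * (PowerSeries.C (gMax δ a b) - 12 * eisensteinTwo) :=
  ⟨isAsymptoticRefinedInvariant_one δ, fun _ hA a b =>
    congrFun (congrFun (hA.unique (isAsymptoticRefinedInvariant_one δ)) a) b⟩
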